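/- Let $\mathrm{Sol}$ be the manifold $\mathbb{R}^3$ with the group law $(\alpha,\beta,\lambda)\cdot(x,y,z)=(e^{\lambda}x+\alpha,\,e^{-\lambda}y+\beta,\,z+\lambda)$ and the left-invariant Riemannian metric $e^{-2z}dx^2+e^{2z}dy^2+dz^2$. A closed Sol three-manifold is a compact smooth manifold $L$ diffeomorphic to a quotient $\Lambda\backslash\mathrm{Sol}$, where $\Lambda$ is a discrete group of isometries of $\mathrm{Sol}$ acting without fixed points. A smoothly embedded connected surface in $L$ is called one-sided if its normal line bundle is nontrivial, and it is said to have nonorientable neighborhood if none of its open neighborhoods in $L$ is orientable (equivalently, its tubular neighborhoods are nonorientable). Let $L$ be a closed Sol three-manifold. Then: 1. $L$ contains no smoothly embedded real projective plane $\mathbb{RP}^2$; 2. $L$ contains no smoothly embedded one-sided two-torus; 3. $L$ contains no smoothly embedded one-sided Klein bottle with nonorientable neighborhood. -/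

import Mathlib

open Set Topology Manifold
open scoped Manifold ContDiff EuclideanSpace

noncomputable section

attribute [local instance 2000] chartedSpaceSelf

/-! ### The Riemannian manifold Sol -/

/-- The underlying manifold of the Lie group `Sol = ℝ² ⋊ ℝ`, whose group law is
`(α, β, l) * (x, y, z) = (exp l * x + α, exp (-l) * y + β, z + l)`; points are triples
`p = (x, y, z) = (p 0, p 1, p 2)`. Only the manifold structure of `ℝ³` is used, not its
Euclidean metric. -/
abbrev Sol : Type := EuclideanSpace ℝ (Fin 3)

/-- The coefficient of the `i`-th component in the left-invariant frame
`X = exp z ∂x`, `Y = exp (-z) ∂y`, `Z = ∂z`: a tangent vector `v` at `p` is equal to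
`solCoeff p 0 * v 0 • X + solCoeff p 1 * v 1 • Y + solCoeff p 2 * v 2 • Z`. -/
def solCoeff (p : Sol) : Fin 3 → ℝ := ![Real.exp (-p 2), Real.exp (p 2), 1]

/-- The left-invariant metric for which `(X, Y, Z)` is orthonormal, as a bilinear form at `p`:
`exp (-2 z) dx² + exp (2 z) dy² + dz²`. -/
def solInner (p : Sol) : Sol →L[ℝ] Sol →L[ℝ] ℝ :=
  ∑ i, (solCoeff p i) ^ 2 •
    ((EuclideanSpace.proj i : Sol →L[ℝ] ℝ).smulRight (EuclideanSpace.proj i : Sol →L[ℝ] ℝ))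

theorem solInner_apply (p u v : Sol) :
    solInner p u v = ∑ i, (solCoeff p i * u i) * (solCoeff p i * v i) := by
  simp only [solInner, sum_apply, smul_apply, ContinuousLinearMap.smulRight_apply, smul_eq_mul]
  refine Finset.sum_congr rfl fun i _ => ?_
  change solCoeff p i ^ 2 * (u i * v i) = _
  ring

theorem solCoeff_pos (p : Sol) (i : Fin 3) : 0 < solCoeff p i := by
  fin_cases i <;> simp [solCoeff, Real.exp_pos]

theorem solInner_symm (p u v : Sol) : solInner p u v = solInner p v u := by
  rw [solInner_apply, solInner_apply]
  exact Finset.sum_congr rfl fun i _ => by ring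

theorem solInner_pos (p v : Sol) (hv : v ≠ 0) : 0 < solInner p v v := by
  rw [solInner_apply]
  have : ∃ i, v i ≠ 0 := by
    by_contra! h
    exact hv (by ext i; simpa using h i)
  obtain ⟨i, hi⟩ := this
  refine Finset.sum_pos' (fun i _ => mul_self_nonneg _) ⟨i, Finset.mem_univ i, ?_⟩
  exact mul_self_pos.2 (mul_ne_zero (solCoeff_pos p i).ne' hi)

theorem solInner_isVonNBounded (p : Sol) :
    Bornology.IsVonNBounded ℝ {v : Sol | solInner p v v < 1} := by
  rw [NormedSpace.isVonNBounded_iff]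
  refine (Metric.isBounded_iff_subset_closedBall 0).2 ⟨√(∑ i, ((solCoeff p i)⁻¹) ^ 2), ?_⟩
  intro v hv
  rw [mem_closedBall_zero_iff, EuclideanSpace.norm_eq]
  refine Real.sqrt_le_sqrt (Finset.sum_le_sum fun i _ => ?_)
  have h1 : (solCoeff p i * v i) ^ 2 ≤ 1 := by
    have hv' : solInner p v v < 1 := hv
    rw [solInner_apply] at hv'
    have := Finset.single_le_sum (f := fun i => (solCoeff p i * v i) * (solCoeff p i * v i))
      (fun i _ => mul_self_nonneg _) (Finset.mem_univ i)
    simp only at this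
    nlinarith
  have h2 := solCoeff_pos p i
  rw [Real.norm_eq_abs, sq_abs, inv_pow, ← one_div, le_div_iff₀ (pow_pos h2 2)]
  nlinarith

theorem contDiff_solInner : ContDiff ℝ ∞ solInner := by
  unfold solInner
  refine ContDiff.sum fun i _ => ?_
  suffices h : ContDiff ℝ ∞ fun p : Sol => solCoeff p i from
    (ContinuousLinearMap.toSpanSingleton ℝ _).contDiff.comp (h.pow 2)
  fin_cases i
  · change ContDiff ℝ ∞ fun p : Sol => Real.exp (-p 2)
    fun_prop
  · change ContDiff ℝ ∞ fun p : Sol => Real.exp (p 2)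
    fun_prop
  · exact contDiff_const

/-- The Riemannian metric of Sol. -/
def solMetric : Bundle.ContMDiffRiemannianMetric 𝓘(ℝ, Sol) ∞ Sol
    (fun p : Sol => TangentSpace 𝓘(ℝ, Sol) p) where
  inner p := solInner p
  symm p v w := solInner_symm p v w
  pos p v hv := solInner_pos p v hv
  isVonNBounded p := solInner_isVonNBounded p
  contMDiff := by
    intro x
    refine (Bundle.contMDiffAt_section x).2 ?_
    refine contDiff_solInner.contMDiff.contMDiffAt.congr_of_eventuallyEq (.of_forall fun y => ?_)
    dsimp only
    erw [hom_trivializationAt_apply]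
    ext v w
    erw [inCoordinates_apply_eq₂ (mem_univ _) (mem_univ _) (mem_univ _)]
    have hs : ∀ u : Sol,
        (trivializationAt Sol (TangentSpace 𝓘(ℝ, Sol)) x).symm y u = u := fun u =>
      (Bundle.Trivialization.symmL_apply (R := ℝ) _ (mem_univ _) _).symm.trans
        (congrArg (fun T : Sol →L[ℝ] Sol => T u) (TangentBundle.symmL_model_space x y))
    erw [hs v, hs w]
    simp
    rfl

/-- The group of isometries of Sol: the diffeomorphisms which preserve the Riemannian metric. -/
def solIsometryGroup : Subgroup (Sol ≃ₜ Sol) where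
  carrier := {Φ | ContDiff ℝ ∞ Φ ∧ ContDiff ℝ ∞ Φ.symm ∧
    ∀ p u v : Sol, solMetric.inner (Φ p) (fderiv ℝ Φ p u) (fderiv ℝ Φ p v) =
      solMetric.inner p u v}
  one_mem' := by
    refine ⟨contDiff_id, contDiff_id, fun p u v => ?_⟩
    have h : fderiv ℝ ((1 : Sol ≃ₜ Sol) : Sol → Sol) p = ContinuousLinearMap.id ℝ Sol :=
      fderiv_id
    rw [h]
    rfl
  mul_mem' := by
    rintro Φ Ψ ⟨hΦ, hΦ', hΦg⟩ ⟨hΨ, hΨ', hΨg⟩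
    refine ⟨hΦ.comp hΨ, hΨ'.comp hΦ', fun p u v => ?_⟩
    have h : fderiv ℝ ((Φ * Ψ : Sol ≃ₜ Sol) : Sol → Sol) p =
        (fderiv ℝ Φ (Ψ p)).comp (fderiv ℝ Ψ p) :=
      fderiv_comp p (hΦ.differentiable (by simp) _) (hΨ.differentiable (by simp) _)
    rw [h]
    exact (hΦg (Ψ p) _ _).trans (hΨg p u v)
  inv_mem' := by
    rintro Φ ⟨hΦ, hΦ', hΦg⟩
    refine ⟨hΦ', hΦ, fun p u v => ?_⟩
    have h : (fderiv ℝ Φ (Φ.symm p)).comp (fderiv ℝ Φ.symm p) = ContinuousLinearMap.id ℝ Sol := by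
      rw [← fderiv_comp p (hΦ.differentiable (by simp) _) (hΦ'.differentiable (by simp) _)]
      have : (Φ ∘ Φ.symm : Sol → Sol) = id := by ext x; simp
      rw [this]
      exact fderiv_id
    have h' : ∀ w, fderiv ℝ Φ (Φ.symm p) (fderiv ℝ Φ.symm p w) = w :=
      fun w => congrArg (fun T : Sol →L[ℝ] Sol => T w) h
    have key := hΦg (Φ.symm p) (fderiv ℝ Φ.symm p u) (fderiv ℝ Φ.symm p v)
    rw [h', h', Φ.apply_symm_apply] at key
    exact key.symm

/-! ### Quotient manifolds -/

/-- `q : M → N` exhibits the smooth manifold `N` as the quotient of the smooth manifold `M` by the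
relation `r`: it is a surjective local diffeomorphism whose fibres are the classes of `r`. -/
def IsQuotientManifold {n : ℕ} {M : Type*} [TopologicalSpace M]
    [ChartedSpace (EuclideanSpace ℝ (Fin n)) M] {N : Type*} [TopologicalSpace N]
    [ChartedSpace (EuclideanSpace ℝ (Fin n)) N] (r : M → M → Prop) (q : M → N) : Prop :=
  IsLocalDiffeomorph (𝓡 n) (𝓡 n) ∞ q ∧ Function.Surjective q ∧ ∀ x y, q x = q y ↔ r x y

/-- A Sol-manifold: a smooth 3-manifold which is the quotient of Sol by a discrete (for the
compact-open topology) group of isometries acting without fixed points. -/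
def IsSolManifold (L : Type*) [TopologicalSpace L]
    [ChartedSpace (EuclideanSpace ℝ (Fin 3)) L] : Prop :=
  ∃ Γ : Subgroup (Sol ≃ₜ Sol), Γ ≤ solIsometryGroup ∧
    IsDiscrete ((fun γ : Sol ≃ₜ Sol => (γ : C(Sol, Sol))) '' (Γ : Set (Sol ≃ₜ Sol))) ∧
    (∀ γ ∈ Γ, ∀ p : Sol, γ p = p → γ = 1) ∧
    ∃ q : Sol → L, IsQuotientManifold (n := 3) (fun x y => ∃ γ ∈ Γ, γ x = y) q

/-! ### Surfaces -/

/-- `S` is diffeomorphic to the real projective plane, the quotient of the unit sphere of `ℝ³` by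
the antipodal map. -/
def IsProjectivePlane (S : Type*) [TopologicalSpace S]
    [ChartedSpace (EuclideanSpace ℝ (Fin 2)) S] : Prop :=
  ∃ q : Metric.sphere (0 : EuclideanSpace ℝ (Fin 3)) 1 → S,
    IsQuotientManifold (n := 2) (fun x y => y = x ∨ y = -x) q

/-- `S` is diffeomorphic to the two-torus `ℝ² / ℤ²`. -/
def IsTwoTorus (S : Type*) [TopologicalSpace S]
    [ChartedSpace (EuclideanSpace ℝ (Fin 2)) S] : Prop :=
  ∃ q : EuclideanSpace ℝ (Fin 2) → S,
    IsQuotientManifold (n := 2) (fun x y => ∃ m n : ℤ, y 0 = x 0 + (m : ℝ) ∧ y 1 = x 1 + (n : ℝ)) q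

/-- `S` is diffeomorphic to the Klein bottle, the quotient of `ℝ²` by the group generated by
`(s, t) ↦ (s + 1, -t)` and `(s, t) ↦ (s, t + 1)`. -/
def IsKleinBottle (S : Type*) [TopologicalSpace S]
    [ChartedSpace (EuclideanSpace ℝ (Fin 2)) S] : Prop :=
  ∃ q : EuclideanSpace ℝ (Fin 2) → S,
    IsQuotientManifold (n := 2) (fun x y => ∃ m n : ℤ, y 0 = x 0 + (m : ℝ) ∧ y 1 = (-1 : ℝ) ^ m * x 1 + (n : ℝ)) q

/-! ### One-sidedness and orientability -/

/-- An (immersed) surface `f : S → L` in a 3-manifold is two-sided if its normal bundle is trivial,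
that is, if there is a continuous vector field along `f` which is nowhere tangent to the surface. -/
def IsTwoSided {S L : Type*} [TopologicalSpace S] [ChartedSpace (EuclideanSpace ℝ (Fin 2)) S]
    [TopologicalSpace L] [ChartedSpace (EuclideanSpace ℝ (Fin 3)) L]
    [IsManifold (𝓡 3) ∞ L] (f : S → L) : Prop :=
  ∃ v : ∀ x : S, TangentSpace (𝓡 3) (f x),
    Continuous (fun x => (⟨f x, v x⟩ : TangentBundle (𝓡 3) L)) ∧
    ∀ x, v x ∉ range (mfderiv (𝓡 2) (𝓡 3) f x)

/-- A smooth `n`-manifold is orientable if it has an atlas (of smoothly compatible charts) whose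
coordinate changes all have positive Jacobian determinant. -/
def IsOrientableManifold (n : ℕ) (M : Type*) [TopologicalSpace M]
    [ChartedSpace (EuclideanSpace ℝ (Fin n)) M] : Prop :=
  ∃ A ⊆ IsManifold.maximalAtlas (𝓡 n) ∞ M, (∀ x : M, ∃ e ∈ A, x ∈ e.source) ∧
    ∀ e ∈ A, ∀ e' ∈ A, ∀ x ∈ e.source ∩ e'.source,
      0 < (fderiv ℝ (e' ∘ e.symm) (e x)).det

/-- `f : S → L` has nonorientable neighborhood: no open neighborhood of its image in `L` is
orientable. (Shrinking a neighborhood preserves orientability, so for an embedded compact surface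
this says that its tubular neighborhoods are nonorientable.) -/
def HasNonorientableNeighborhood {S L : Type*}
    [TopologicalSpace L] [ChartedSpace (EuclideanSpace ℝ (Fin 3)) L] (f : S → L) : Prop :=
  ∀ U : TopologicalSpace.Opens L, range f ⊆ U → ¬ IsOrientableManifold 3 U

end

/-! Write L as a quotient of Sol by Γ and lift the embedded surface f to F : N → Sol, with N the
plane or the sphere. The image of F is a closed hypersurface of a simply connected space, so it has
two sides (`exists_side`), and f is two-sided as soon as the group H ≤ Γ of deck transformations of
the image preserves them (`IsSurfaceLift.isTwoSided_of_isSide`).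

Geometry enters through the classification of isometries (`isStraight_or_isSwap`): each is affine in
the coordinates, and either preserves the x- and y-directions and shifts z, or exchanges them and
reflects z. When Γ acts freely and cocompactly, an orientation-reversing element must shift z by a
nonzero amount, and hence preserves a vertical axis (`IsSolQuotient.exists_isStraight_of_notMem`,
`IsStraight.exists_axis`). If all of H preserves an axis, the lifted surface stays in a tube around
it; the complement of the tube is connected and H-invariant, so no element of H can exchange the two
sides (`IsSurfaceLift.isTwoSided_of_le_axisStabilizer`).

Torus: H is generated by commuting α and β. If both preserve the orientation of Sol, the
orientations of the plane and of Sol together give an invariant conormal. Otherwise one of them has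
an axis, which everything commuting with it preserves.

Klein bottle: the generators satisfy β α β = α, which forces β to preserve orientation. If α does
too, the surface has an orientable neighborhood, contrary to hypothesis. Otherwise α shifts z, the
relation forces β = 1, and the axis of α is preserved by H.

Projective plane: Γ has no involutions, so the lift F to the sphere satisfies F(-x) = F(x), and the
unit normal n given by a side is even too. Sending the radial direction to n and tangent vectors to
their images under dF gives an odd continuous family of endomorphisms of a 3-dimensional space. Some
member is singular (`exists_det_eq_zero_of_odd`), but immersivity and transversality make all of
them invertible. -/

noncomputable section

attribute [local instance 2000] chartedSpaceSelf

/-! ### Smooth functions on Sol and the left-invariant frame -/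

/-- The algebra of smooth functions on Sol. -/
def smoothFun : Subalgebra ℝ (Sol → ℝ) where
  carrier := {f | ContDiff ℝ ∞ f}
  mul_mem' {f g} (hf : ContDiff ℝ ∞ f) (hg : ContDiff ℝ ∞ g) := hf.mul hg
  add_mem' {f g} (hf : ContDiff ℝ ∞ f) (hg : ContDiff ℝ ∞ g) := hf.add hg
  algebraMap_mem' r := (contDiff_const : ContDiff ℝ ∞ fun _ : Sol => r)

theorem smoothFun_contDiff (f : smoothFun) : ContDiff ℝ ∞ (f : Sol → ℝ) := f.2

theorem smoothFun_differentiable (f : smoothFun) : Differentiable ℝ (f : Sol → ℝ) :=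
  (smoothFun_contDiff f).differentiable (by simp)

/-- The vectors of the frame `X, Y, Z` at a point. -/
def solFrame (i : Fin 3) (p : Sol) : Sol :=
  (solCoeff p i)⁻¹ • EuclideanSpace.single i 1

theorem contDiff_solFrame (i : Fin 3) : ContDiff ℝ ∞ (solFrame i) := by
  have h : ContDiff ℝ ∞ fun p : Sol => solCoeff p i := by
    fin_cases i
    · change ContDiff ℝ ∞ fun p : Sol => Real.exp (-p 2)
      fun_prop
    · change ContDiff ℝ ∞ fun p : Sol => Real.exp (p 2)
      fun_prop
    · exact contDiff_const
  exact (h.inv fun p => (solCoeff_pos p i).ne').smul contDiff_const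

/-- Differentiation along a vector of the frame. -/
def frameD (i : Fin 3) : Derivation ℝ smoothFun smoothFun :=
  Derivation.mk'
    { toFun := fun f => ⟨fun p => fderiv ℝ (f : Sol → ℝ) p (solFrame i p),
        ((smoothFun_contDiff f).fderiv_right (m := ∞) (by simp)).clm_apply (contDiff_solFrame i)⟩
      map_add' := fun f g => by
        ext p
        change fderiv ℝ ((f : Sol → ℝ) + (g : Sol → ℝ)) p _ = _
        rw [fderiv_add (smoothFun_differentiable f p) (smoothFun_differentiable g p)]
        rfl
      map_smul' := fun r f => by
        ext p
        change fderiv ℝ (r • (f : Sol → ℝ)) p _ = _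
        rw [fderiv_const_smul (smoothFun_differentiable f p)]
        rfl }
    (fun f g => by
      ext p
      change fderiv ℝ ((f : Sol → ℝ) * (g : Sol → ℝ)) p _ = _
      rw [fderiv_mul (smoothFun_differentiable f p) (smoothFun_differentiable g p)]
      simp)

theorem frameD_apply (i : Fin 3) (f : smoothFun) (p : Sol) :
    (frameD i f : Sol → ℝ) p = fderiv ℝ (f : Sol → ℝ) p (solFrame i p) := rfl

theorem fderiv_solFrame_apply (i : Fin 3) (p v : Sol) :
    fderiv ℝ (solFrame i) p v =
      (![v 2, -v 2, 0] : Fin 3 → ℝ) i • solFrame i p := by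
  have hp : HasFDerivAt (fun p : Sol => p 2) (EuclideanSpace.proj 2 : Sol →L[ℝ] ℝ) p :=
    (EuclideanSpace.proj 2 : Sol →L[ℝ] ℝ).hasFDerivAt
  fin_cases i
  · have h : solFrame 0 = fun p : Sol => Real.exp (p 2) • EuclideanSpace.single (0 : Fin 3) (1 : ℝ) := by
      funext p; simp [solFrame, solCoeff, Real.exp_neg]
    change fderiv ℝ (solFrame 0) p v = v 2 • solFrame 0 p
    rw [h, (hp.exp.smul_const _).fderiv]
    simp [smul_smul, mul_comm]
  · have h : solFrame 1 = fun p : Sol => Real.exp (-p 2) • EuclideanSpace.single (1 : Fin 3) (1 : ℝ) := by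
      funext p; simp [solFrame, solCoeff, Real.exp_neg]
    change fderiv ℝ (solFrame 1) p v = (-v 2) • solFrame 1 p
    rw [h, (hp.fun_neg.exp.smul_const _).fderiv]
    simp [smul_smul, mul_comm]
  · have h : solFrame 2 = fun p : Sol => EuclideanSpace.single (2 : Fin 3) (1 : ℝ) := by
      funext p; simp [solFrame, solCoeff]
    change fderiv ℝ (solFrame 2) p v = (0 : ℝ) • solFrame 2 p
    rw [h]
    simp

/-- The second derivative of f is symmetric and cancels, leaving f differentiated along the Lie
bracket of two frame fields. -/
theorem frameD_frameD_sub (i j : Fin 3) (f : smoothFun) (p : Sol) :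
    (frameD i (frameD j f) : Sol → ℝ) p - (frameD j (frameD i f) : Sol → ℝ) p =
      fderiv ℝ (f : Sol → ℝ) p (fderiv ℝ (solFrame j) p (solFrame i p)) -
        fderiv ℝ (f : Sol → ℝ) p (fderiv ℝ (solFrame i) p (solFrame j p)) := by
  have h1 : ∀ j, DifferentiableAt ℝ (solFrame j) p := fun j =>
    (contDiff_solFrame j).differentiable (by simp) p
  have h2 : DifferentiableAt ℝ (fderiv ℝ (f : Sol → ℝ)) p :=
    ((smoothFun_contDiff f).fderiv_right (m := ∞) (by simp)).differentiable (by simp) p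
  have h3 : ∀ i j, (frameD i (frameD j f) : Sol → ℝ) p =
      fderiv ℝ (fderiv ℝ (f : Sol → ℝ)) p (solFrame i p) (solFrame j p) +
        fderiv ℝ (f : Sol → ℝ) p (fderiv ℝ (solFrame j) p (solFrame i p)) := by
    intro i j
    change fderiv ℝ (fun p => fderiv ℝ (f : Sol → ℝ) p (solFrame j p)) p (solFrame i p) = _
    rw [fderiv_clm_apply h2 (h1 j)]
    simp [add_comm]
  have h4 : IsSymmSndFDerivAt ℝ (f : Sol → ℝ) p :=
    ContDiffAt.isSymmSndFDerivAt (n := ∞) (smoothFun_contDiff f).contDiffAt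
      (by simpa using (WithTop.coe_le_coe.2 le_top : ((2 : ℕ∞) : WithTop ℕ∞) ≤ ∞))
  rw [h3, h3, h4.eq (solFrame i p) (solFrame j p)]
  ring

/-- With the next two lemmas, these are the brackets [X, Y] = 0, [Z, X] = X, [Z, Y] = -Y, on which
the algebraic study of isometries rests. -/
theorem frameD_comm_zero_one (f : smoothFun) : frameD 0 (frameD 1 f) = frameD 1 (frameD 0 f) := by
  ext p
  have := frameD_frameD_sub 0 1 f p
  simp only [fderiv_solFrame_apply] at this
  simp [solFrame] at this
  linarith

theorem frameD_comm_two_zero (f : smoothFun) :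
    frameD 2 (frameD 0 f) = frameD 0 (frameD 2 f) + frameD 0 f := by
  ext p
  have := frameD_frameD_sub 2 0 f p
  simp only [fderiv_solFrame_apply] at this
  change _ = (frameD 0 (frameD 2 f) : Sol → ℝ) p + (frameD 0 f : Sol → ℝ) p
  rw [frameD_apply 0 f]
  simp [solFrame, solCoeff] at this ⊢
  linarith

theorem frameD_comm_two_one (f : smoothFun) :
    frameD 2 (frameD 1 f) = frameD 1 (frameD 2 f) - frameD 1 f := by
  ext p
  have := frameD_frameD_sub 2 1 f p
  simp only [fderiv_solFrame_apply] at this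
  change _ = (frameD 1 (frameD 2 f) : Sol → ℝ) p - (frameD 1 f : Sol → ℝ) p
  rw [frameD_apply 1 f]
  simp [solFrame, solCoeff] at this ⊢
  linarith

/-! ### Isometries of Sol -/

/-- The covariant derivative of the frame: the value of the one-form with components `r` on
`∇_{E_j} E_k`. -/
def solChristoffel {R : Type*} [CommRing R] (j k : Fin 3) (r : Fin 3 → R) : R :=
  (![![r 2, 0, -r 0], ![0, -r 2, r 1], ![0, 0, 0]] : Fin 3 → Fin 3 → R) j k

/-- The covariant derivatives of an orthonormal coframe which has the structure equations of Sol. -/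
def solCoframeD {R : Type*} [CommRing R] (A : Fin 3 → Fin 3 → R) (i j k : Fin 3) : R :=
  (![A 0 j * A 2 k, -A 1 j * A 2 k, -A 0 j * A 0 k + A 1 j * A 1 k] : Fin 3 → R) i

/-- Uniqueness of the Levi-Civita connection. -/
theorem eq_zero_of_symm_of_antisymm {R : Type*} [CommRing R] [Module ℝ R]
    (A : Fin 3 → Fin 3 → R) (hA : ∀ k l, ∑ i, A k i * A l i = if k = l then 1 else 0)
    (T : Fin 3 → Fin 3 → Fin 3 → R) (hs : ∀ i j k, T i j k = T i k j)
    (ha : ∀ j k l, ∑ i, T i j k * A i l + ∑ i, T i j l * A i k = 0) (i j k : Fin 3) :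
    T i j k = 0 := by
  -- The Koszul permutation: a tensor symmetric in one pair of slots and skew in an overlapping pair
  -- equals its own negative.
  have hU : ∀ j k l, ∑ i, T i j k * A i l = 0 := by
    intro j k l
    have s : ∀ j k l, ∑ i, T i j k * A i l = ∑ i, T i k j * A i l := fun j k l =>
      Finset.sum_congr rfl fun i _ => by rw [hs]
    have h : ∑ i, T i j k * A i l + ∑ i, T i j k * A i l = 0 := by
      linear_combination ha j k l - ha l j k + ha k l j - s j l k - s k j l + s l k j
    rw [← two_smul ℝ] at h
    exact (smul_eq_zero_iff_right (two_ne_zero' ℝ)).1 h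
  have h : ∑ l, (∑ m, T m j k * A m l) * A i l = T i j k := by
    simp only [Finset.sum_mul]
    rw [Finset.sum_comm]
    simp only [mul_assoc, ← Finset.mul_sum, hA]
    simp
  rw [← h]
  simp [hU]

/-- The components of an isometry with respect to the frame, as elements of an algebra with three
derivations. -/
theorem coframe_derivative {R : Type*} [CommRing R] [Algebra ℝ R] (D : Fin 3 → Derivation ℝ R R)
    (h01 : ∀ f, D 0 (D 1 f) = D 1 (D 0 f)) (h20 : ∀ f, D 2 (D 0 f) = D 0 (D 2 f) + D 0 f)
    (h21 : ∀ f, D 2 (D 1 f) = D 1 (D 2 f) - D 1 f) (a b c u v : R)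
    (hu : ∀ j, D j u = -u * D j c) (hv : ∀ j, D j v = v * D j c)
    (A : Fin 3 → Fin 3 → R) (hA0 : ∀ j, A 0 j = u * D j a) (hA1 : ∀ j, A 1 j = v * D j b)
    (hA2 : ∀ j, A 2 j = D j c)
    (hA : ∀ k l, ∑ i, A i k * A i l = if k = l then 1 else 0)
    (hA' : ∀ k l, ∑ i, A k i * A l i = if k = l then 1 else 0) (i j k : Fin 3) :
    D j (A i k) = solChristoffel j k (A i) + solCoframeD A i j k := by
  rw [← sub_eq_zero, ← sub_sub]
  refine eq_zero_of_symm_of_antisymm A hA'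
    (fun i j k => D j (A i k) - solChristoffel j k (A i) - solCoframeD A i j k) ?_ ?_ i j k
  -- Torsion-freeness: the failure of D j and D k to commute is matched by the Christoffel terms,
  -- and the terms from differentiating u and v by those of the coframe.
  · have s0 : ∀ j k, D j (A 0 k) = u * D j (D k a) - A 2 j * A 0 k := by
      intro j k; rw [hA0, hA2, Derivation.leibniz, hu]; simp only [smul_eq_mul]; ring
    have s1 : ∀ j k, D j (A 1 k) = v * D j (D k b) + A 2 j * A 1 k := by
      intro j k; rw [hA1, hA2, Derivation.leibniz, hv]; simp only [smul_eq_mul]; ring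
    have s2 : ∀ j k, D j (A 2 k) = D j (D k c) := fun j k => by rw [hA2]
    intro i j k
    fin_cases i <;> fin_cases j <;> fin_cases k <;>
      simp [s0, s1, s2, solChristoffel, solCoframeD, h01, h20, h21] <;>
      simp only [hA0, hA1, hA2] <;> ring
  -- Metric compatibility: differentiate the orthonormality relations. Both connection terms are
  -- skew, so they drop out.
  · intro j k l
    have h : ∀ k l, ∑ i, (A i k * D j (A i l) + A i l * D j (A i k)) = 0 := by
      intro k l
      have := congrArg (D j) (hA k l)
      rw [map_sum] at this
      simp only [Derivation.leibniz, smul_eq_mul] at this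
      rw [this]
      split_ifs <;> simp
    have hΓ : ∀ k l, ∑ i, solChristoffel j k (A i) * A i l =
        solChristoffel j k fun m => if m = l then 1 else 0 := by
      intro k l
      fin_cases j <;> fin_cases k <;> simp [solChristoffel, ← hA]
    have hδ : solChristoffel j k (fun m => if m = l then (1 : R) else 0) +
        solChristoffel j l (fun m => if m = k then (1 : R) else 0) = 0 := by
      fin_cases j <;> fin_cases k <;> fin_cases l <;> simp [solChristoffel]
    have hT : ∑ i, (solCoframeD A i j k * A i l + solCoframeD A i j l * A i k) = 0 := by
      simp [Fin.sum_univ_three, solCoframeD]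
      ring
    have h1 := h k l
    simp only [sub_mul, Finset.sum_sub_distrib, Finset.sum_add_distrib] at h1 hT ⊢
    rw [hΓ, hΓ]
    simp only [mul_comm (A _ _) (D _ _)] at h1
    linear_combination h1 - hT - hδ

/-- The third component of an isometry has a gradient which is tangent to the axes. -/
theorem coframe_sq_eq_one {R : Type*} [CommRing R] [Algebra ℝ R] (D : Fin 3 → Derivation ℝ R R)
    (h01 : ∀ f, D 0 (D 1 f) = D 1 (D 0 f)) (h20 : ∀ f, D 2 (D 0 f) = D 0 (D 2 f) + D 0 f)
    (h21 : ∀ f, D 2 (D 1 f) = D 1 (D 2 f) - D 1 f) (c : R)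
    (A : Fin 3 → Fin 3 → R) (hA2 : ∀ j, A 2 j = D j c)
    (hA' : ∀ k l, ∑ i, A k i * A l i = if k = l then 1 else 0)
    (hD : ∀ i j k, D j (A i k) = solChristoffel j k (A i) + solCoframeD A i j k) :
    A 2 2 * A 2 2 = 1 := by
  have e := hA'
  simp only [Fin.sum_univ_three] at e
  have e00 := e 0 0
  have e11 := e 1 1
  have e22 := e 2 2
  have e01 := e 0 1
  have e02 := e 0 2
  have e12 := e 1 2
  simp at e00 e11 e22 e01 e02 e12
  have d00 : D 0 (D 0 c) = A 2 2 - A 0 0 * A 0 0 + A 1 0 * A 1 0 := by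
    rw [← hA2, hD]; simp [solChristoffel, solCoframeD]; ring
  have d01 : D 0 (D 1 c) = - A 0 0 * A 0 1 + A 1 0 * A 1 1 := by
    rw [← hA2, hD]; simp [solChristoffel, solCoframeD]
  have d10 : D 1 (D 0 c) = - A 0 0 * A 0 1 + A 1 0 * A 1 1 := by rw [← h01, d01]
  have d02 : D 0 (D 2 c) = -A 2 0 - A 0 0 * A 0 2 + A 1 0 * A 1 2 := by
    rw [← hA2, hD]; simp [solChristoffel, solCoframeD]; ring
  have d20 : D 2 (D 0 c) = - A 0 0 * A 0 2 + A 1 0 * A 1 2 := by rw [h20, d02, ← hA2]; ring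
  have d11 : D 1 (D 1 c) = -A 2 2 - A 0 1 * A 0 1 + A 1 1 * A 1 1 := by
    rw [← hA2, hD]; simp [solChristoffel, solCoframeD]; ring
  have d12 : D 1 (D 2 c) = A 2 1 - A 0 1 * A 0 2 + A 1 1 * A 1 2 := by
    rw [← hA2, hD]; simp [solChristoffel, solCoframeD]; ring
  have d21 : D 2 (D 1 c) = - A 0 1 * A 0 2 + A 1 1 * A 1 2 := by rw [h21, d12, ← hA2]; ring
  have d22 : D 2 (D 2 c) = - A 0 2 * A 0 2 + A 1 2 * A 1 2 := by
    rw [← hA2, hD]; simp [solChristoffel, solCoframeD]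
  -- The height function of Sol is harmonic, so c is harmonic as well.
  have lap : D 0 (D 0 c) + D 1 (D 1 c) + D 2 (D 2 c) = 0 := by
    rw [d00, d11, d22]; linear_combination e11 - e00
  have lapD : ∀ j, D j (D 0 (D 0 c)) + D j (D 1 (D 1 c)) + D j (D 2 (D 2 c)) = 0 := by
    intro j; rw [← map_add, ← map_add, lap, map_zero]
  have grad : D 0 c * D 0 c + D 1 c * D 1 c + D 2 c * D 2 c = 1 := by
    rw [← hA2, ← hA2, ← hA2]; exact e22
  have gradD : ∀ j, D 0 c * D j (D 0 c) + D 1 c * D j (D 1 c) + D 2 c * D j (D 2 c) = 0 := by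
    intro j
    have := congrArg (D j) grad
    simp only [map_add, Derivation.leibniz, smul_eq_mul, Derivation.map_one_eq_zero] at this
    have h2 : (2 : ℝ) • (D 0 c * D j (D 0 c) + D 1 c * D j (D 1 c) + D 2 c * D j (D 2 c)) = 0 := by
      rw [two_smul, ← this]; ring
    exact (smul_eq_zero_iff_right (two_ne_zero' ℝ)).1 h2
  have gradDD : ∀ j, D j (D 0 c) * D j (D 0 c) + D j (D 1 c) * D j (D 1 c)
      + D j (D 2 c) * D j (D 2 c) + (D 0 c * D j (D j (D 0 c)) + D 1 c * D j (D j (D 1 c))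
      + D 2 c * D j (D j (D 2 c))) = 0 := by
    intro j
    have := congrArg (D j) (gradD j)
    simp only [map_add, Derivation.leibniz, smul_eq_mul, map_zero] at this
    rw [← this]; ring
  -- Moving the Laplacian past each frame derivative leaves commutator terms, which carry the
  -- curvature in Bochner's formula.
  have k0 : D 0 (D 0 (D 0 c)) + D 1 (D 1 (D 0 c)) + D 2 (D 2 (D 0 c)) =
      D 0 (D 2 c) + D 2 (D 0 c) := by
    rw [← h01 c, ← h01 (D 1 c), h20 c, map_add, h20 (D 2 c), h20 c]
    linear_combination lapD 0
  have k1 : D 0 (D 0 (D 1 c)) + D 1 (D 1 (D 1 c)) + D 2 (D 2 (D 1 c)) =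
      -D 1 (D 2 c) - D 2 (D 1 c) := by
    rw [h01 c, h01 (D 0 c), h21 c, map_sub, h21 (D 2 c), h21 c]
    linear_combination lapD 1
  have k2 : D 0 (D 0 (D 2 c)) + D 1 (D 1 (D 2 c)) + D 2 (D 2 (D 2 c)) =
      2 * D 1 (D 1 c) - 2 * D 0 (D 0 c) := by
    have x0 : D 0 (D 2 c) = D 2 (D 0 c) - D 0 c := by rw [h20]; ring
    have x1 : D 1 (D 2 c) = D 2 (D 1 c) + D 1 c := by rw [h21]; ring
    have y0 : D 0 (D 2 (D 0 c)) = D 2 (D 0 (D 0 c)) - D 0 (D 0 c) := by rw [h20 (D 0 c)]; ring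
    have y1 : D 1 (D 2 (D 1 c)) = D 2 (D 1 (D 1 c)) + D 1 (D 1 c) := by rw [h21 (D 1 c)]; ring
    rw [x0, x1, map_sub, map_add, y0, y1]
    linear_combination lapD 2
  -- Bochner's formula for c, harmonic with unit gradient: |Hess c|² + Ric(∇c, ∇c) = 0. The Hessian
  -- is that of the height, of squared norm 2, and Ric = -2 dz², so 2 - 2 (A 2 2)² = 0.
  have key : (2 : ℝ) • (A 2 2 * A 2 2 - 1) = 0 := by
    rw [two_smul]
    have s0 := gradD 0
    have s1 := gradD 1
    have s2 := gradD 2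
    have t0 := gradDD 0
    have t1 := gradDD 1
    have t2 := gradDD 2
    have T : D 0 c * (D 0 (D 2 c) + D 2 (D 0 c)) + D 1 c * (-D 1 (D 2 c) - D 2 (D 1 c)) +
      D 2 c * (2 * D 1 (D 1 c) - 2 * D 0 (D 0 c)) + (D 0 (D 0 c) * D 0 (D 0 c) +
        D 0 (D 1 c) * D 0 (D 1 c) + D 0 (D 2 c) * D 0 (D 2 c) + D 1 (D 0 c) * D 1 (D 0 c) +
        D 1 (D 1 c) * D 1 (D 1 c) + D 1 (D 2 c) * D 1 (D 2 c) + D 2 (D 0 c) * D 2 (D 0 c) +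
        D 2 (D 1 c) * D 2 (D 1 c) + D 2 (D 2 c) * D 2 (D 2 c)) = 0 := by
      linear_combination t0 + t1 + t2 - D 0 c * k0 - D 1 c * k1 - D 2 c * k2
    rw [d00, d01, d02, d10, d11, d12, d20, d21, d22, ← hA2, ← hA2, ← hA2] at T
    clear t0 t1 t2 s0 s1 s2 k0 k1 k2 gradDD gradD grad lapD lap d00 d01 d02 d10 d11 d12 d20 d21 d22
    linear_combination -T + e00 * (A 0 0 * A 0 0 + A 0 1 * A 0 1 + A 0 2 * A 0 2 + 1) +
      e11 * (A 1 0 * A 1 0 + A 1 1 * A 1 1 + A 1 2 * A 1 2 + 1) -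
      2 * e01 * (A 0 0 * A 1 0 + A 0 1 * A 1 1 + A 0 2 * A 1 2)
  exact sub_eq_zero.1 ((smul_eq_zero_iff_right (two_ne_zero' ℝ)).1 key)

theorem exists_const_of_fderiv_solFrame {f : Sol → ℝ} (hf : Differentiable ℝ f) (g : Sol →L[ℝ] ℝ)
    (h : ∀ p j, fderiv ℝ f p (solFrame j p) = g (solFrame j p)) : ∃ c, ∀ p, f p = g p + c := by
  have hz : ∀ p, fderiv ℝ (f - ⇑g) p = 0 := by
    intro p
    rw [fderiv_sub (hf p) g.differentiableAt, g.fderiv, sub_eq_zero]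
    ext v
    have hv : v = ∑ j, (solCoeff p j * v j) • solFrame j p := by
      ext i
      simp only [solFrame, smul_smul]
      rw [PiLp.ext_iff.1 (rfl : _ = _) i]
      simp [Pi.single_apply]
      rw [mul_right_comm, mul_inv_cancel₀ (solCoeff_pos p i).ne', one_mul]
    rw [hv, map_sum, map_sum]
    exact Finset.sum_congr rfl fun j _ => by rw [map_smul, map_smul, h]
  refine ⟨(f - ⇑g) 0, fun p => ?_⟩
  rw [← is_const_of_fderiv_eq_zero (𝕜 := ℝ) (hf.sub g.differentiable) hz p 0]
  simp

/-- `Φ` acts as an element of the subgroup of isometries of Sol preserving each of the foliations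
by lines parallel to the coordinate axes and the orientation of the vertical one. -/
def IsStraight (Φ : Sol → Sol) (e₀ e₁ l a b : ℝ) : Prop :=
  ∀ p, Φ p 0 = e₀ * Real.exp l * p 0 + a ∧ Φ p 1 = e₁ * Real.exp (-l) * p 1 + b ∧ Φ p 2 = p 2 + l

/-- `Φ` acts as an isometry of Sol which exchanges the first two foliations by lines parallel to the
coordinate axes. -/
def IsSwap (Φ : Sol → Sol) (e₀ e₁ l a b : ℝ) : Prop :=
  ∀ p, Φ p 0 = e₀ * Real.exp l * p 1 + a ∧ Φ p 1 = e₁ * Real.exp (-l) * p 0 + b ∧ Φ p 2 = -p 2 + l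

theorem fderiv_apply_coord {Φ : Sol → Sol} (hΦ : ContDiff ℝ ∞ Φ) (p v : Sol) (i : Fin 3) :
    fderiv ℝ (fun p => Φ p i) p v = (fderiv ℝ Φ p v) i := by
  have h := ((EuclideanSpace.proj i : Sol →L[ℝ] ℝ).hasFDerivAt (x := Φ p)).comp p
    (hΦ.differentiable (by simp) p).hasFDerivAt
  exact congrArg (fun T : Sol →L[ℝ] ℝ => T v) h.fderiv

theorem solInner_solFrame (p : Sol) (k l : Fin 3) :
    solInner p (solFrame k p) (solFrame l p) = if k = l then 1 else 0 := by
  have h := (solCoeff_pos p k).ne'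
  rw [solInner_apply]
  simp [solFrame]
  by_cases hkl : k = l
  · subst hkl; simp [h]
  · simp [hkl, Ne.symm hkl]

theorem eq_const_of_frameD_eq_zero {f : smoothFun} (h : ∀ j, frameD j f = 0) (p : Sol) :
    (f : Sol → ℝ) p = (f : Sol → ℝ) 0 := by
  obtain ⟨c, hc⟩ := exists_const_of_fderiv_solFrame (smoothFun_differentiable f) 0 fun p j => by
    rw [← frameD_apply, h]; rfl
  simp [hc]

/-- The classification of the isometries of Sol. -/
theorem isStraight_or_isSwap {Φ : Sol ≃ₜ Sol} (hΦ : Φ ∈ solIsometryGroup) :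
    ∃ e₀ e₁ l a b : ℝ, e₀ * e₀ = 1 ∧ e₁ * e₁ = 1 ∧
      (IsStraight Φ e₀ e₁ l a b ∨ IsSwap Φ e₀ e₁ l a b) := by
  obtain ⟨hs, -, hm⟩ := hΦ
  have hsi : ∀ i, ContDiff ℝ ∞ fun p => Φ p i := fun i =>
    (EuclideanSpace.proj i : Sol →L[ℝ] ℝ).contDiff.comp hs
  let f : Fin 3 → smoothFun := fun i => ⟨fun p => Φ p i, hsi i⟩
  let u : smoothFun := ⟨fun p => Real.exp (-Φ p 2), (hsi 2).neg.exp⟩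
  let v : smoothFun := ⟨fun p => Real.exp (Φ p 2), (hsi 2).exp⟩
  have huv : v * u = 1 := by
    ext p
    change Real.exp (Φ p 2) * Real.exp (-Φ p 2) = 1
    rw [← Real.exp_add]; simp
  have hu : ∀ j, frameD j u = -u * frameD j (f 2) := by
    intro j
    ext p
    have h := (((hsi 2).differentiable (by simp) p).hasFDerivAt.fun_neg.exp).fderiv
    change fderiv ℝ (fun p => Real.exp (-Φ p 2)) p (solFrame j p) =
      -Real.exp (-Φ p 2) * fderiv ℝ (fun p => Φ p 2) p (solFrame j p)
    rw [h]; simp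
  have hv : ∀ j, frameD j v = v * frameD j (f 2) := by
    intro j
    ext p
    have h := (((hsi 2).differentiable (by simp) p).hasFDerivAt.exp).fderiv
    change fderiv ℝ (fun p => Real.exp (Φ p 2)) p (solFrame j p) =
      Real.exp (Φ p 2) * fderiv ℝ (fun p => Φ p 2) p (solFrame j p)
    rw [h]; simp
  -- The matrix of dΦ in the left-invariant orthonormal frame; it is orthogonal because Φ is an
  -- isometry.
  let A : Fin 3 → Fin 3 → smoothFun := fun i j =>
    ![u * frameD j (f 0), v * frameD j (f 1), frameD j (f 2)] i
  have hAp : ∀ i j p, (A i j : Sol → ℝ) p =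
      solCoeff (Φ p) i * (fderiv ℝ Φ p (solFrame j p)) i := by
    intro i j p
    rw [← fderiv_apply_coord hs]
    fin_cases i
    · rfl
    · rfl
    · exact (one_mul _).symm
  have hA : ∀ k l, ∑ i, A i k * A i l = if k = l then 1 else 0 := by
    intro k l
    ext p
    have h := hm p (solFrame k p) (solFrame l p)
    change solInner _ _ _ = solInner _ _ _ at h
    rw [solInner_solFrame, solInner_apply] at h
    have e1 : ((∑ i, A i k * A i l : smoothFun) : Sol → ℝ) p =
        ∑ i, (A i k : Sol → ℝ) p * (A i l : Sol → ℝ) p := by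
      simp
    rw [e1]
    simp only [hAp]
    rw [h]
    split_ifs <;> rfl
  have hA' : ∀ k l, ∑ i, A k i * A l i = if k = l then 1 else 0 := by
    have h : (Matrix.of A).transpose * Matrix.of A = 1 := by
      ext1 k l
      simp only [Matrix.mul_apply, Matrix.transpose_apply, Matrix.of_apply, hA, Matrix.one_apply]
    rw [mul_eq_one_comm] at h
    intro k l
    have := congrFun (congrFun h k) l
    simpa only [Matrix.mul_apply, Matrix.transpose_apply, Matrix.of_apply, Matrix.one_apply] using this
  have hD := coframe_derivative frameD frameD_comm_zero_one frameD_comm_two_zero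
    frameD_comm_two_one (f 0) (f 1) (f 2) u v hu hv A (fun _ => rfl) (fun _ => rfl) (fun _ => rfl)
    hA hA'
  have hsq := coframe_sq_eq_one frameD frameD_comm_zero_one frameD_comm_two_zero
    frameD_comm_two_one (f 2) A (fun _ => rfl) hA' hD
  have hzero : ∀ x y z : smoothFun, x * x + y * y + z * z = 1 → z * z = 1 → x = 0 ∧ y = 0 := by
    intro x y z h1 h2
    have h3 : ∀ p, (x : Sol → ℝ) p = 0 ∧ (y : Sol → ℝ) p = 0 := by
      intro p
      have h1' : (x : Sol → ℝ) p * (x : Sol → ℝ) p + (y : Sol → ℝ) p * (y : Sol → ℝ) p +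
          (z : Sol → ℝ) p * (z : Sol → ℝ) p = 1 := congrArg (fun f : smoothFun => (f : Sol → ℝ) p) h1
      have h2' : (z : Sol → ℝ) p * (z : Sol → ℝ) p = 1 :=
        congrArg (fun f : smoothFun => (f : Sol → ℝ) p) h2
      constructor <;> nlinarith [mul_self_nonneg ((x : Sol → ℝ) p), mul_self_nonneg ((y : Sol → ℝ) p)]
    exact ⟨Subtype.ext (funext fun p => (h3 p).1), Subtype.ext (funext fun p => (h3 p).2)⟩
  -- The last row and last column are unit vectors whose corner entry already has square 1, so their
  -- other entries vanish.
  have r2 := hA' 2 2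
  have c2 := hA 2 2
  simp only [Fin.sum_univ_three, if_true] at r2 c2
  obtain ⟨h20, h21⟩ := hzero _ _ _ r2 hsq
  obtain ⟨h02, h12⟩ := hzero _ _ _ c2 hsq
  -- In the derivative of an entry of either diagonal block, every term contains one of the entries
  -- just shown to vanish.
  have hconst : ∀ i j p, (A i j : Sol → ℝ) p = (A i j : Sol → ℝ) 0 := by
    have hd := hD
    intro i j
    refine eq_const_of_frameD_eq_zero fun k => ?_
    have k0 : frameD k (A 0 2) = 0 := by rw [h02, map_zero]
    have k1 : frameD k (A 1 2) = 0 := by rw [h12, map_zero]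
    have k2 : frameD k (A 2 0) = 0 := by rw [h20, map_zero]
    have k3 : frameD k (A 2 1) = 0 := by rw [h21, map_zero]
    have k4 := hd 2 k 2
    have k5 := hd 0 k 0
    have k6 := hd 0 k 1
    have k7 := hd 1 k 0
    have k8 := hd 1 k 1
    fin_cases i <;> fin_cases j <;> simp only [Fin.zero_eta, Fin.mk_one, Fin.reduceFinMk] <;>
      first | assumption | skip
    all_goals first | rw [k4] | rw [k5] | rw [k6] | rw [k7] | rw [k8]
    all_goals fin_cases k <;> simp [solChristoffel, solCoframeD, h20, h21, h02, h12]
  -- Differentiating the vanishing entries A 0 2 and A 1 2 ties the upper block to the sign of A 2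
  -- 2: diagonal for +1, antidiagonal for -1.
  have m00 : A 0 0 * (A 2 2 - 1) = 0 := by
    have := hD 0 0 2
    rw [h02, map_zero] at this
    simp [solChristoffel, solCoframeD] at this
    linear_combination -this
  have m01 : A 0 1 * (A 2 2 + 1) = 0 := by
    have := hD 0 1 2
    rw [h02, map_zero] at this
    simp [solChristoffel, solCoframeD] at this
    linear_combination -this
  have m10 : A 1 0 * (A 2 2 + 1) = 0 := by
    have := hD 1 0 2
    rw [h12, map_zero] at this
    simp [solChristoffel, solCoframeD] at this
    linear_combination this
  have m11 : A 1 1 * (A 2 2 - 1) = 0 := by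
    have := hD 1 1 2
    rw [h12, map_zero] at this
    simp [solChristoffel, solCoframeD] at this
    linear_combination this
  have r0 := hA' 0 0
  have r1 := hA' 1 1
  simp only [Fin.sum_univ_three, if_true, h02, h12, mul_zero, add_zero] at r0 r1
  have at0 : ∀ {x y : smoothFun}, x = y → (x : Sol → ℝ) 0 = (y : Sol → ℝ) 0 := fun h => by rw [h]
  obtain ⟨K, hK⟩ : ∃ K : Fin 3 → Fin 3 → ℝ, K = fun i j => (A i j : Sol → ℝ) 0 := ⟨_, rfl⟩
  have hKp : ∀ i j p, (A i j : Sol → ℝ) p = K i j := fun i j p => by rw [hconst, hK]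
  replace m00 : K 0 0 * (K 2 2 - 1) = 0 := by rw [hK]; exact at0 m00
  replace m01 : K 0 1 * (K 2 2 + 1) = 0 := by rw [hK]; exact at0 m01
  replace m10 : K 1 0 * (K 2 2 + 1) = 0 := by rw [hK]; exact at0 m10
  replace m11 : K 1 1 * (K 2 2 - 1) = 0 := by rw [hK]; exact at0 m11
  replace r0 : K 0 0 * K 0 0 + K 0 1 * K 0 1 = 1 := by rw [hK]; exact at0 r0
  replace r1 : K 1 0 * K 1 0 + K 1 1 * K 1 1 = 1 := by rw [hK]; exact at0 r1
  replace hsq : K 2 2 * K 2 2 = 1 := by rw [hK]; exact at0 hsq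
  replace h20 : K 2 0 = 0 := by rw [hK]; exact at0 h20
  replace h21 : K 2 1 = 0 := by rw [hK]; exact at0 h21
  replace h02 : K 0 2 = 0 := by rw [hK]; exact at0 h02
  replace h12 : K 1 2 = 0 := by rw [hK]; exact at0 h12
  have d2 : ∀ p j, fderiv ℝ (fun p => Φ p 2) p (solFrame j p) = K 2 j := fun p j => hKp 2 j p
  have d0 : ∀ p j, fderiv ℝ (fun p => Φ p 0) p (solFrame j p) = Real.exp (Φ p 2) * K 0 j := by
    intro p j
    rw [← hKp 0 j p]
    change _ = Real.exp (Φ p 2) * (Real.exp (-Φ p 2) * _)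
    rw [← mul_assoc, ← Real.exp_add, add_neg_cancel, Real.exp_zero, one_mul]
    rfl
  have d1 : ∀ p j, fderiv ℝ (fun p => Φ p 1) p (solFrame j p) = Real.exp (-Φ p 2) * K 1 j := by
    intro p j
    rw [← hKp 1 j p]
    change _ = Real.exp (-Φ p 2) * (Real.exp (Φ p 2) * _)
    rw [← mul_assoc, ← Real.exp_add, neg_add_cancel, Real.exp_zero, one_mul]
    rfl
  obtain ⟨l, hl⟩ := exists_const_of_fderiv_solFrame ((hsi 2).differentiable (by simp))
    (K 2 2 • EuclideanSpace.proj 2) fun p j => by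
      rw [d2]
      fin_cases j <;> simp [solFrame, h20, h21, solCoeff]
  simp only [smul_apply, smul_eq_mul, PiLp.proj_apply] at hl
  rcases mul_self_eq_one_iff.1 hsq with h | h
  · have k01 : K 0 1 = 0 := by
      rw [h] at m01; linarith
    have k10 : K 1 0 = 0 := by
      rw [h] at m10; linarith
    obtain ⟨a, ha⟩ := exists_const_of_fderiv_solFrame ((hsi 0).differentiable (by simp))
      ((K 0 0 * Real.exp l) • EuclideanSpace.proj 0) fun p j => by
        rw [d0, hl, h]
        fin_cases j <;> simp [solFrame, h02, k01, solCoeff, Real.exp_add, Real.exp_neg]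
        ring
    obtain ⟨b, hb⟩ := exists_const_of_fderiv_solFrame ((hsi 1).differentiable (by simp))
      ((K 1 1 * Real.exp (-l)) • EuclideanSpace.proj 1) fun p j => by
        rw [d1, hl, h]
        fin_cases j <;> simp [solFrame, h12, k10, solCoeff, Real.exp_add, Real.exp_neg]
        ring
    refine ⟨K 0 0, K 1 1, l, a, b, by simpa [k01] using r0, by simpa [k10] using r1,
      Or.inl fun p => ⟨ha p, hb p, ?_⟩⟩
    simpa [h] using hl p
  · have k01 : K 0 0 = 0 := by
      rw [h] at m00; linarith
    have k10 : K 1 1 = 0 := by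
      rw [h] at m11; linarith
    obtain ⟨a, ha⟩ := exists_const_of_fderiv_solFrame ((hsi 0).differentiable (by simp))
      ((K 0 1 * Real.exp l) • EuclideanSpace.proj 1) fun p j => by
        rw [d0, hl, h]
        fin_cases j <;> simp [solFrame, h02, k01, solCoeff, Real.exp_add, Real.exp_neg]
        ring
    obtain ⟨b, hb⟩ := exists_const_of_fderiv_solFrame ((hsi 1).differentiable (by simp))
      ((K 1 0 * Real.exp (-l)) • EuclideanSpace.proj 0) fun p j => by
        rw [d1, hl, h]
        fin_cases j <;> simp [solFrame, h12, k10, solCoeff, Real.exp_add, Real.exp_neg]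
        ring
    refine ⟨K 0 1, K 1 0, l, a, b, by simpa [k01] using r0, by simpa [k10] using r1,
      Or.inr fun p => ⟨ha p, hb p, ?_⟩⟩
    simpa [h] using hl p

/-! ### The two sides of a closed hypersurface -/

/-- The functions `h` and `k` have the same sign near `x` outside `S`. -/
def SameSide {E : Type*} [TopologicalSpace E] (S : Set E) (h k : E → ℝ) (x : E) : Prop :=
  ∀ᶠ y in 𝓝 x, y ∉ S → (0 < h y ↔ 0 < k y)

theorem SameSide.symm {E : Type*} [TopologicalSpace E] {S : Set E} {h k : E → ℝ} {x : E} (H : SameSide S h k x) :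
    SameSide S k h x := H.mono fun _ hy hS => (hy hS).symm

theorem SameSide.trans {E : Type*} [TopologicalSpace E] {S : Set E} {h k m : E → ℝ} {x : E} (H : SameSide S h k x)
    (K : SameSide S k m x) : SameSide S h m x := by
  filter_upwards [H, K] with y h1 h2 hS using (h1 hS).trans (h2 hS)

section Sides

variable {E : Type*} [NormedAddCommGroup E] [NormedSpace ℝ E]

/-- The set `S` is defined in the open set `U` by the equation `h = 0`, where `h` is continuously
differentiable and has nonzero derivative along `S`. -/
structure IsDefiningFunction (S U : Set E) (h : E → ℝ) : Prop where
  isOpen : IsOpen U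
  contDiffAt : ∀ y ∈ U, ContDiffAt ℝ 1 h y
  fderiv_ne_zero : ∀ y ∈ U ∩ S, fderiv ℝ h y ≠ 0
  mem_iff : ∀ y ∈ U, y ∈ S ↔ h y = 0

theorem IsDefiningFunction.neg {S U : Set E} {h : E → ℝ} (H : IsDefiningFunction S U h) :
    IsDefiningFunction S U fun y => -h y where
  isOpen := H.isOpen
  contDiffAt y hy := (H.contDiffAt y hy).neg
  fderiv_ne_zero y hy := by
    rw [fderiv_fun_neg]
    exact neg_ne_zero.2 (H.fderiv_ne_zero y hy)
  mem_iff y hy := by rw [H.mem_iff y hy, neg_eq_zero]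

/-- Strict differentiability makes h increasing along v uniformly for base points near x, with no
need for an implicit function theorem. -/
theorem HasStrictFDerivAt.eventually_lt {h : E → ℝ} {φ : E →L[ℝ] ℝ} {x v : E}
    (hh : HasStrictFDerivAt h φ x) (hv : 0 < φ v) :
    ∀ᶠ z : E × E in 𝓝 (x, x), ∀ t : ℝ, 0 < t → z.1 = z.2 + t • v → h z.2 < h z.1 := by
  have hv0 : 0 < ‖v‖ := norm_pos_iff.2 (by rintro rfl; simp at hv)
  have := hh.isLittleO.def (c := φ v / (2 * ‖v‖)) (by positivity)
  filter_upwards [this] with z hz t ht e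
  have e' : z.1 - z.2 = t • v := by rw [e]; abel
  rw [e', norm_smul, map_smul, Real.norm_eq_abs, Real.norm_eq_abs, _root_.abs_of_pos ht] at hz
  have e2 : φ v / (2 * ‖v‖) * (t * ‖v‖) = t * φ v / 2 := by field_simp
  rw [e2, abs_le] at hz
  have := mul_pos ht hv
  simp only [smul_eq_mul] at hz
  linarith [hz.1]

theorem exists_pos_ne_zero {φ ψ : E →L[ℝ] ℝ} (hφ : φ ≠ 0) (hψ : ψ ≠ 0) :
    ∃ v, 0 < φ v ∧ ψ v ≠ 0 := by
  have : ∃ v, φ v ≠ 0 ∧ ψ v ≠ 0 := by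
    obtain ⟨v₁, h₁⟩ : ∃ v, φ v ≠ 0 := by
      by_contra! h; exact hφ (ContinuousLinearMap.ext h)
    obtain ⟨v₂, h₂⟩ : ∃ v, ψ v ≠ 0 := by
      by_contra! h; exact hψ (ContinuousLinearMap.ext h)
    by_cases h₃ : ψ v₁ = 0
    · by_cases h₄ : φ v₂ = 0
      · exact ⟨v₁ + v₂, by simpa [h₄] using h₁, by simpa [h₃] using h₂⟩
      · exact ⟨v₂, h₄, h₂⟩
    · exact ⟨v₁, h₁, h₃⟩
  obtain ⟨v, h₁, h₂⟩ := this
  rcases lt_or_gt_of_ne h₁ with h | h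
  · exact ⟨-v, by simpa using h, by simpa using h₂⟩
  · exact ⟨v, h, h₂⟩

theorem IsDefiningFunction.hasStrictFDerivAt {S U : Set E} {h : E → ℝ}
    (H : IsDefiningFunction S U h) {x : E} (hx : x ∈ U) :
    HasStrictFDerivAt h (fderiv ℝ h x) x :=
  (H.contDiffAt x hx).hasStrictFDerivAt (by simp)

/-- Near x both functions increase along lines parallel to v. By the intermediate value theorem each
such line meets {h = 0} = S = {k = 0}, and the position of y relative to that crossing decides both
signs. -/
theorem IsDefiningFunction.eventually_pos_iff {S U V : Set E} {h k : E → ℝ}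
    (H : IsDefiningFunction S U h) (K : IsDefiningFunction S V k) {x v : E} (hU : x ∈ U)
    (hV : x ∈ V) (hS : x ∈ S) (h1 : 0 < fderiv ℝ h x v) (h2 : 0 < fderiv ℝ k x v) :
    ∀ᶠ y in 𝓝 x, (0 < h y ↔ 0 < k y) := by
  have e1 := (H.hasStrictFDerivAt hU).eventually_lt h1
  have e2 := (K.hasStrictFDerivAt hV).eventually_lt h2
  rw [nhds_prod_eq, Metric.nhds_basis_ball.prod_self.eventually_iff] at e1 e2
  obtain ⟨r₁, hr₁, B₁⟩ := e1
  obtain ⟨r₂, hr₂, B₂⟩ := e2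
  obtain ⟨r₃, hr₃, B₃⟩ := Metric.isOpen_iff.1 (H.isOpen.inter K.isOpen) x ⟨hU, hV⟩
  set r := min r₁ (min r₂ r₃) with hr
  have hr0 : 0 < r := by positivity
  have B : ∀ b ∈ Metric.ball x r, ∀ t : ℝ, 0 < t → b + t • v ∈ Metric.ball x r →
      h b < h (b + t • v) ∧ k b < k (b + t • v) := by
    intro b hb t ht ha
    have i1 : Metric.ball x r ⊆ Metric.ball x r₁ := Metric.ball_subset_ball (by simp [hr])
    have i2 : Metric.ball x r ⊆ Metric.ball x r₂ := Metric.ball_subset_ball (by simp [hr])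
    exact ⟨B₁ (x := (b + t • v, b)) ⟨i1 ha, i1 hb⟩ t ht rfl,
      B₂ (x := (b + t • v, b)) ⟨i2 ha, i2 hb⟩ t ht rfl⟩
  have B3 : Metric.ball x r ⊆ U ∩ V :=
    (Metric.ball_subset_ball (by simp [hr])).trans B₃
  have hx0 : h x = 0 := (H.mem_iff x hU).1 hS
  have hcont : ∀ s : ℝ, Continuous fun y : E => y + s • v := fun s => by fun_prop
  have hb : ∀ s : ℝ, x + s • v ∈ Metric.ball x r →
      ∀ᶠ y in 𝓝 x, y + s • v ∈ Metric.ball x r := fun s hs =>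
    (hcont s).continuousAt.eventually (Metric.isOpen_ball.mem_nhds hs)
  obtain ⟨s, hs0, hs⟩ : ∃ s : ℝ, 0 < s ∧ ∀ t ∈ Icc (-s) s, x + t • v ∈ Metric.ball x r := by
    have : ContinuousAt (fun t : ℝ => x + t • v) 0 := by fun_prop
    have h0 := this.eventually (Metric.isOpen_ball.mem_nhds
      (show x + (0 : ℝ) • v ∈ Metric.ball x r by simpa using hr0))
    obtain ⟨s, hs0, hs⟩ := Metric.eventually_nhds_iff.1 h0
    refine ⟨s / 2, by positivity, fun t ht => hs ?_⟩
    rw [Real.dist_eq, sub_zero, abs_lt]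
    constructor <;> linarith [ht.1, ht.2]
  have hsm := hs (-s) ⟨le_rfl, by linarith⟩
  have hsp := hs s ⟨by linarith, le_rfl⟩
  have hneg : h (x + (-s) • v) < 0 := by
    have := (B _ hsm s hs0 (by simpa using hr0)).1
    simpa [hx0] using this
  have hpos : 0 < h (x + s • v) := by
    have := (B x (by simpa using hr0) s hs0 hsp).1
    rwa [hx0] at this
  have hc : ∀ t : ℝ, x + t • v ∈ Metric.ball x r → ContinuousAt (fun y => h (y + t • v)) x :=
    fun t ht => ContinuousAt.comp (g := h) (H.contDiffAt _ (B3 ht).1).continuousAt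
      (hcont t).continuousAt
  filter_upwards [hb _ hsm, hb _ hsp, (hc _ hsm).eventually_lt_const hneg,
    (hc _ hsp).eventually_const_lt hpos, Metric.ball_mem_nhds x hr0] with y m1 m2 n1 n2 hy
  have hseg : ∀ t ∈ Icc (-s) s, y + t • v ∈ Metric.ball x r := by
    intro t ht
    have hconv := (convex_ball x r) m1 m2 (a := (s - t) / (2 * s)) (b := (s + t) / (2 * s))
      (div_nonneg (by linarith [ht.2]) (by positivity))
      (div_nonneg (by linarith [ht.1]) (by positivity)) (by field_simp; ring)
    convert hconv using 1
    rw [smul_add, smul_add, add_add_add_comm, ← add_smul, smul_smul, smul_smul, ← add_smul]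
    congr 1
    · rw [show (s - t) / (2 * s) + (s + t) / (2 * s) = 1 by field_simp; ring, one_smul]
    · congr 1; field_simp; ring
  obtain ⟨t, ht, ht0⟩ : ∃ t ∈ Icc (-s) s, h (y + t • v) = 0 := by
    have := intermediate_value_Icc (f := fun t : ℝ => h (y + t • v)) (by linarith : -s ≤ s)
      (fun t ht => (ContinuousAt.comp (g := h) (f := fun t : ℝ => y + t • v)
        (H.contDiffAt _ (B3 (hseg t ht)).1).continuousAt
        (by fun_prop)).continuousWithinAt)
    exact this ⟨n1.le, n2.le⟩
  have hk0 : k (y + t • v) = 0 := by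
    rw [← K.mem_iff _ (B3 (hseg t ht)).2, H.mem_iff _ (B3 (hseg t ht)).1, ht0]
  rcases lt_trichotomy t 0 with h0 | h0 | h0
  · have := B _ (hseg t ht) (-t) (by linarith) (by simpa using hy)
    rw [ht0, hk0] at this
    simp at this
    simp [this]
  · subst h0
    simp at ht0 hk0
    simp [ht0, hk0]
  · have := B y hy t h0 (hseg t ht)
    rw [ht0, hk0] at this
    simp [this.1.le, this.2.le, not_lt.2]

theorem IsDefiningFunction.sameSide_or {S U V : Set E} {h k : E → ℝ}
    (H : IsDefiningFunction S U h) (K : IsDefiningFunction S V k) {x : E} (hU : x ∈ U)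
    (hV : x ∈ V) : SameSide S h k x ∨ SameSide S h (fun y => -k y) x := by
  by_cases hS : x ∈ S
  · obtain ⟨v, hv, hv'⟩ := exists_pos_ne_zero (H.fderiv_ne_zero x ⟨hU, hS⟩)
      (K.fderiv_ne_zero x ⟨hV, hS⟩)
    rcases lt_or_gt_of_ne hv' with hk | hk
    · right
      refine (H.eventually_pos_iff K.neg hU hV hS hv ?_).mono fun y hy _ => hy
      rw [fderiv_fun_neg]
      simpa using hk
    · left
      exact (H.eventually_pos_iff K hU hV hS hv hk).mono fun y hy _ => hy
  · have hh := mt (H.mem_iff x hU).2 hS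
    have hk := mt (K.mem_iff x hV).2 hS
    have ch := (H.contDiffAt x hU).continuousAt
    have ck := (K.contDiffAt x hV).continuousAt
    rcases lt_or_gt_of_ne hh with hh | hh <;> rcases lt_or_gt_of_ne hk with hk | hk
    · left
      filter_upwards [ch.eventually_lt_const hh, ck.eventually_lt_const hk] with y h1 h2 _
      simp [h1.le, h2.le, not_lt.2]
    · right
      filter_upwards [ch.eventually_lt_const hh, ck.eventually_const_lt hk] with y h1 h2 _
      simp [h1.le, h2.le, not_lt.2]
    · right
      filter_upwards [ch.eventually_const_lt hh, ck.eventually_lt_const hk] with y h1 h2 _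
      simp [h1, h2]
    · left
      filter_upwards [ch.eventually_const_lt hh, ck.eventually_const_lt hk] with y h1 h2 _
      simp [h1, h2]

theorem IsDefiningFunction.frequently_notMem {S U : Set E} {h : E → ℝ}
    (H : IsDefiningFunction S U h) {x : E} (hU : x ∈ U) : ∃ᶠ y in 𝓝 x, y ∉ S := by
  by_cases hS : x ∈ S
  · intro hf
    simp only [not_not] at hf
    refine H.fderiv_ne_zero x ⟨hU, hS⟩ ?_
    have : h =ᶠ[𝓝 x] fun _ => 0 := by
      filter_upwards [hf, H.isOpen.mem_nhds hU] with y h1 h2 using (H.mem_iff y h2).1 h1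
    rw [this.fderiv_eq]
    simp
  · exact fun hf => hf.self_of_nhds hS

/-- A function agreeing in sign with both k and -k off S would force a whole neighborhood into S,
which has empty interior. -/
theorem IsDefiningFunction.sameSide_neg {S U V : Set E} {h k : E → ℝ}
    (H : IsDefiningFunction S U h) (K : IsDefiningFunction S V k) {x : E} (hU : x ∈ U)
    (hV : x ∈ V) : SameSide S h (fun y => -k y) x ↔ ¬ SameSide S h k x := by
  refine ⟨fun h1 h2 => ?_, fun h1 => (H.sameSide_or K hU hV).resolve_left h1⟩
  refine H.frequently_notMem hU ?_
  filter_upwards [h1, h2, K.isOpen.mem_nhds hV] with y h1 h2 hy hS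
  have h3 := (h1 hS).symm.trans (h2 hS)
  have h4 := mt (K.mem_iff y hy).2 hS
  rcases lt_or_gt_of_ne h4 with h | h
  · exact absurd (h3.1 (by simpa using h)) (not_lt.2 h.le)
  · have := h3.2 h
    simp at this
    exact absurd this (not_lt.2 h.le)

/-- In a real normed space, a closed hypersurface has two sides. -/
theorem exists_side {S : Set E} (hS : IsClosed S)
    (hloc : ∀ x ∈ S, ∃ U h, x ∈ U ∧ IsDefiningFunction S U h) :
    ∃ P : Set E, Disjoint P S ∧ (∀ x ∉ S, ∀ᶠ y in 𝓝 x, y ∈ P ↔ x ∈ P) ∧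
      ∀ x ∈ S, ∃ U h, x ∈ U ∧ IsDefiningFunction S U h ∧ ∀ y ∈ U, y ∈ P ↔ 0 < h y := by
  classical
  have hloc' : ∀ x, ∃ U h, x ∈ U ∧ IsDefiningFunction S U h := by
    intro x
    by_cases hx : x ∈ S
    · exact hloc x hx
    -- Away from the closed set S the constant 1 serves as an equation, so the local equations are
    -- indexed by all points of E.
    · exact ⟨Sᶜ, fun _ => 1, hx, hS.isOpen_compl, fun _ _ => contDiffAt_const,
        fun y hy => absurd hy.2 hy.1, fun y hy => by simpa using hy⟩
  choose U h hxU H using hloc'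
  -- Relative signs of the local equations form a cocycle with values in ℤ/2.
  have hcomp : ∀ i j k, ∀ x ∈ U i ∩ U j ∩ U k, (SameSide S (h i) (h k) x ↔
      (SameSide S (h i) (h j) x ↔ SameSide S (h j) (h k) x)) := by
    rintro i j k x ⟨⟨hi, hj⟩, hk⟩
    by_cases hij : SameSide S (h i) (h j) x
    · have : SameSide S (h i) (h k) x ↔ SameSide S (h j) (h k) x :=
        ⟨fun h => hij.symm.trans h, fun h => hij.trans h⟩
      simp [this, hij]
    · have hij' := ((H i).sameSide_neg (H j) hi hj).2 hij
      have : SameSide S (h i) (h k) x ↔ SameSide S (fun y => -h j y) (h k) x :=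
        ⟨fun h => hij'.symm.trans h, fun h => hij'.trans h⟩
      have h2 : SameSide S (fun y => -h j y) (h k) x ↔ ¬ SameSide S (h j) (h k) x := by
        rw [show SameSide S (fun y => -h j y) (h k) x ↔ SameSide S (h k) (fun y => -h j y) x from
          ⟨SameSide.symm, SameSide.symm⟩, (H k).sameSide_neg (H j) hk hj]
        exact not_congr ⟨SameSide.symm, SameSide.symm⟩
      simp [this, h2, hij]
  have hlc : ∀ i j, ∀ x ∈ U i ∩ U j, ∀ᶠ y in 𝓝 x,
      (SameSide S (h i) (h j) y ↔ SameSide S (h i) (h j) x) := by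
    rintro i j x ⟨hi, hj⟩
    by_cases hij : SameSide S (h i) (h j) x
    · filter_upwards [eventually_eventually_nhds.2 hij] with y hy
      exact iff_of_true hy hij
    · have hij' := ((H i).sameSide_neg (H j) hi hj).2 hij
      filter_upwards [eventually_eventually_nhds.2 hij', (H i).isOpen.mem_nhds hi,
        (H j).isOpen.mem_nhds hj] with y hy hi' hj'
      exact iff_of_false (((H i).sameSide_neg (H j) hi' hj').1 hy) hij
  -- The double covering glued from this locally constant cocycle. Since E is simply connected, the
  -- identity lifts to a section G, which amounts to a coherent choice of sign for all local
  -- equations.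
  let Z : FiberBundleCore E E Bool :=
    { baseSet := U
      isOpen_baseSet := fun i => (H i).isOpen
      indexAt := id
      mem_baseSet_at := hxU
      coordChange := fun i j x b => if SameSide S (h i) (h j) x then b else !b
      coordChange_self := fun i x _ v => if_pos (.of_forall fun _ _ => Iff.rfl)
      continuousOn_coordChange := fun i j => by
        rintro ⟨x, b⟩ ⟨hx, -⟩
        refine ContinuousAt.continuousWithinAt ?_
        have h1 : (fun p : E × Bool => if SameSide S (h i) (h j) p.1 then p.2 else !p.2) =ᶠ[𝓝 (x, b)]
            fun p => if SameSide S (h i) (h j) x then p.2 else !p.2 := by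
          filter_upwards [continuous_fst.continuousAt.eventually (hlc i j x hx)] with p hp
          simp only [hp]
        refine ContinuousAt.congr ?_ h1.symm
        split_ifs
        · exact continuousAt_snd
        · exact ((continuous_of_discreteTopology (f := fun b : Bool => !b)).comp
            (continuous_snd (X := E))).continuousAt
      coordChange_comp := fun i j k x hx v => by
        have := hcomp i j k x hx
        by_cases h1 : SameSide S (h i) (h j) x <;> by_cases h2 : SameSide S (h j) (h k) x <;>
          simp [this, h1, h2] }
  have hcov : IsCoveringMap (Bundle.TotalSpace.proj : Z.TotalSpace → E) :=
    FiberBundle.isCoveringMap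
  obtain ⟨G, ⟨-, hG⟩, -⟩ := hcov.existsUnique_continuousMap_lifts (ContinuousMap.id E) 0
    (⟨0, true⟩ : Z.TotalSpace) rfl
  have hG1 : ∀ x, (G x).1 = x := fun x => congrFun hG x
  have hGc : ∀ i, ∀ x ∈ U i, ∀ᶠ y in 𝓝 x, ((Z.localTriv i) (G y)).2 = ((Z.localTriv i) (G x)).2 := by
    intro i x hx
    have hsrc : G x ∈ (Z.localTriv i).source := by
      rw [Z.mem_localTriv_source]
      change (G x).1 ∈ U i
      rwa [hG1]
    have := continuousAt_snd.comp
      (((Z.localTriv i).toOpenPartialHomeomorph.continuousAt hsrc).comp G.continuous.continuousAt)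
    exact this.eventually (((isOpen_discrete {((Z.localTriv i) (G x)).2}).mem_nhds rfl))
  let s : E → E → Bool := fun i x => ((Z.localTriv i) (G x)).2
  have hs : ∀ i j x, x ∈ U i ∩ U j → s j x = if SameSide S (h i) (h j) x then s i x else !(s i x) := by
    intro i j x hx
    obtain ⟨b, e⟩ : ∃ b : Bool, ∀ k, s k x = Z.coordChange x k x b := by
      refine ⟨(G x).2, fun k => ?_⟩
      change Z.coordChange (G x).1 k (G x).1 (G x).2 = _
      rw [hG1 x]
    rw [e j, ← Z.coordChange_comp x i j x ⟨⟨hxU x, hx.1⟩, hx.2⟩, ← e i]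
  have hside : ∀ i, ∀ x ∈ U i, x ∉ S → ((0 < h x x ↔ s x x = true) ↔ (0 < h i x ↔ s i x = true)) := by
    intro i x hx hxS
    rw [hs x i x ⟨hxU x, hx⟩]
    by_cases hxi : SameSide S (h x) (h i) x
    · rw [if_pos hxi, hxi.self_of_nhds hxS]
    · rw [if_neg hxi]
      have h1 := (((H x).sameSide_neg (H i) (hxU x) hx).2 hxi).self_of_nhds hxS
      have h2 := mt ((H i).mem_iff x hx).2 hxS
      have h3 : 0 < -h i x ↔ ¬ 0 < h i x := by
        rcases lt_or_gt_of_ne h2 with h | h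
        · simp [h, h.le]
        · simp [h, h.le]
      rw [h1, h3]
      cases s x x <;> simp
  -- Points off S where the local equation has the sign selected by the section; `hside` makes this
  -- independent of the equation used.
  let P : Set E := {x | x ∉ S ∧ (0 < h x x ↔ s x x = true)}
  have hP : ∀ i, ∀ x ∈ U i, x ∈ P ↔ x ∉ S ∧ (0 < h i x ↔ s i x = true) := by
    intro i x hx
    exact and_congr_right fun hxS => hside i x hx hxS
  refine ⟨P, Set.disjoint_left.2 fun x hx => hx.1, fun x hx => ?_, fun x hx => ?_⟩
  · have h0 := mt ((H x).mem_iff x (hxU x)).2 hx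
    have hc := ((H x).contDiffAt x (hxU x)).continuousAt
    have hpos : ∀ᶠ y in 𝓝 x, (0 < h x y ↔ 0 < h x x) := by
      rcases lt_or_gt_of_ne h0 with h0 | h0
      · filter_upwards [hc.eventually_lt_const h0] with y hy
        exact iff_of_false (not_lt.2 hy.le) (not_lt.2 h0.le)
      · filter_upwards [hc.eventually_const_lt h0] with y hy
        exact iff_of_true hy h0
    filter_upwards [hGc x x (hxU x), (H x).isOpen.mem_nhds (hxU x), hS.isOpen_compl.mem_nhds hx,
      hpos] with y h1 h2 h3 h4
    rw [hP x y h2, hP x x (hxU x), h4]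
    simp only [hx, not_false_eq_true, true_and, show y ∉ S from h3]
    exact Iff.of_eq (congrArg (fun b => (0 < h x x ↔ b = true)) h1)
  · obtain ⟨W, hW, hWo, hxW⟩ := mem_nhds_iff.1 (Filter.inter_mem (hGc x x (hxU x))
      ((H x).isOpen.mem_nhds (hxU x)))
    have hmono : ∀ {k}, IsDefiningFunction S (U x) k → IsDefiningFunction S W k := fun hk =>
      ⟨hWo, fun y hy => hk.contDiffAt y (hW hy).2, fun y hy => hk.fderiv_ne_zero y
        ⟨(hW hy.1).2, hy.2⟩, fun y hy => hk.mem_iff y (hW hy).2⟩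
    have key : ∀ y ∈ W, y ∈ P ↔ h x y ≠ 0 ∧ (0 < h x y ↔ s x x = true) := by
      intro y hy
      rw [hP x y (hW hy).2, (H x).mem_iff y (hW hy).2]
      exact and_congr_right fun _ => Iff.of_eq (congrArg (fun b => (0 < h x y ↔ b = true)) (hW hy).1)
    cases hb : s x x
    · refine ⟨W, fun y => -h x y, hxW, hmono (H x).neg, fun y hy => ?_⟩
      rw [key y hy, hb]
      simp
      constructor
      · rintro ⟨h1, h2⟩; exact lt_of_le_of_ne h2 h1
      · intro h; exact ⟨h.ne, h.le⟩
    · refine ⟨W, h x, hxW, hmono (H x), fun y hy => ?_⟩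
      rw [key y hy, hb]
      simp
      exact fun h => h.ne'

end Sides

/-! ### The covering by Sol -/

/-- `q` is the quotient map of Sol by the group `Γ` of isometries, which acts freely. -/
structure IsSolQuotient {L : Type*} [TopologicalSpace L] [ChartedSpace (EuclideanSpace ℝ (Fin 3)) L]
    (Γ : Subgroup (Sol ≃ₜ Sol)) (q : Sol → L) : Prop where
  isometry : Γ ≤ solIsometryGroup
  free : ∀ γ ∈ Γ, ∀ p : Sol, γ p = p → γ = 1
  diffeo : IsLocalDiffeomorph (𝓡 3) (𝓡 3) ∞ q
  surjective : Function.Surjective q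
  fiber : ∀ x y, q x = q y ↔ ∃ γ ∈ Γ, γ x = y

section Covering

variable {L : Type*} [TopologicalSpace L] [ChartedSpace (EuclideanSpace ℝ (Fin 3)) L]
  {Γ : Subgroup (Sol ≃ₜ Sol)} {q : Sol → L}

theorem IsSolQuotient.apply_eq (hq : IsSolQuotient Γ q) {γ : Sol ≃ₜ Sol} (hγ : γ ∈ Γ) (p : Sol) :
    q (γ p) = q p := ((hq.fiber _ _).2 ⟨γ, hγ, rfl⟩).symm

theorem IsSolQuotient.eq_of_apply_eq (hq : IsSolQuotient Γ q) {γ δ : Sol ≃ₜ Sol} (hγ : γ ∈ Γ)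
    (hδ : δ ∈ Γ) {p : Sol} (h : γ p = δ p) : γ = δ := by
  have := hq.free (δ⁻¹ * γ) (Γ.mul_mem (Γ.inv_mem hδ) hγ) p (by
    change δ.symm (γ p) = p
    rw [h, δ.symm_apply_apply])
  exact (inv_mul_eq_one.1 this).symm

theorem IsSolQuotient.continuous (hq : IsSolQuotient Γ q) : Continuous q :=
  hq.diffeo.contMDiff.continuous

theorem IsSolQuotient.isOpenMap (hq : IsSolQuotient Γ q) : IsOpenMap q := hq.diffeo.isOpenMap

theorem IsSolQuotient.exists_injOn (hq : IsSolQuotient Γ q) (p : Sol) :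
    ∃ U, IsOpen U ∧ p ∈ U ∧ InjOn q U :=
  hq.diffeo.isLocalHomeomorph.isLocallyInjective p

/-- If q is injective on U and γ U meets U, two points of U with the same image coincide, so γ has a
fixed point and is 1. -/
theorem IsSolQuotient.isCoveringMap (hq : IsSolQuotient Γ q) : IsCoveringMap q := by
  let : MulAction Γ Sol :=
    { smul := fun γ x => (γ : Sol ≃ₜ Sol) x
      one_smul := fun _ => rfl
      mul_smul := fun _ _ _ => rfl }
  have h : IsQuotientCoveringMap q Γ :=
    { hq.isOpenMap.isQuotientMap hq.continuous hq.surjective with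
      continuous_const_smul := fun γ => (γ : Sol ≃ₜ Sol).continuous
      apply_eq_iff_mem_orbit := fun {x y} => by
        rw [eq_comm, hq.fiber]
        exact ⟨fun ⟨γ, hγ, h⟩ => ⟨⟨γ, hγ⟩, h⟩, fun ⟨γ, h⟩ => ⟨γ.1, γ.2, h⟩⟩
      disjoint := fun p => by
        obtain ⟨U, hU, hp, hinj⟩ := hq.exists_injOn p
        refine ⟨U, hU.mem_nhds hp, ?_⟩
        rintro γ ⟨_, ⟨x, hx, rfl⟩, hx'⟩
        exact Subtype.ext (hq.free γ γ.2 x (hinj hx' hx (hq.apply_eq γ.2 x))) }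
  exact h.isCoveringMap

theorem IsSolQuotient.eq_of_lift_eq (hq : IsSolQuotient Γ q) {A : Type*} [TopologicalSpace A]
    [PreconnectedSpace A] {F G : A → Sol} (hF : Continuous F) (hG : Continuous G)
    (h : ∀ a, q (F a) = q (G a)) {a : A} (ha : F a = G a) : F = G :=
  hq.isCoveringMap.eq_of_comp_eq hF hG (funext h) a ha

theorem IsSolQuotient.exists_lift (hq : IsSolQuotient Γ q) {A : Type*} [TopologicalSpace A]
    [SimplyConnectedSpace A] [LocallyPathConnectedSpace A] {f : A → L} (hf : Continuous f) :
    ∃ F : A → Sol, Continuous F ∧ ∀ a, q (F a) = f a := by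
  obtain ⟨a⟩ : Nonempty A := inferInstance
  obtain ⟨e, he⟩ := hq.surjective (f a)
  obtain ⟨F, ⟨-, hF⟩, -⟩ := hq.isCoveringMap.existsUnique_continuousMap_lifts ⟨f, hf⟩ a e he
  exact ⟨F, F.continuous, congrFun hF⟩

/-- Two lifts differ by an element of Γ at one point, hence everywhere by uniqueness of lifts. -/
theorem IsSolQuotient.exists_deck (hq : IsSolQuotient Γ q) {A : Type*} [TopologicalSpace A]
    [ConnectedSpace A] {F G : A → Sol} (hF : Continuous F) (hG : Continuous G)
    (h : ∀ a, q (F a) = q (G a)) : ∃ γ ∈ Γ, ∀ a, G a = γ (F a) := by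
  obtain ⟨a⟩ : Nonempty A := inferInstance
  obtain ⟨γ, hγ, hγa⟩ := (hq.fiber _ _).1 (h a)
  refine ⟨γ, hγ, fun b => ?_⟩
  have := hq.eq_of_lift_eq (γ.continuous.comp hF) hG (fun b => ?_) (a := a) hγa
  · exact (congrFun this b).symm
  · rw [← h b]
    exact hq.apply_eq hγ _

/-- Lift to Sol of an embedded surface `f`, where `g : N → S` is a covering of the surface, whose
fibres are identified with orbits of the subgroup `H` of `Γ`. -/
structure IsSurfaceLift {S N : Type*} [TopologicalSpace S] [ChartedSpace (EuclideanSpace ℝ (Fin 2)) S]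
    [TopologicalSpace N] [ChartedSpace (EuclideanSpace ℝ (Fin 2)) N]
    (Γ : Subgroup (Sol ≃ₜ Sol)) (q : Sol → L) (H : Subgroup (Sol ≃ₜ Sol)) (g : N → S) (f : S → L)
    (F : N → Sol) : Prop where
  le : H ≤ Γ
  diffeo : IsLocalDiffeomorph (𝓡 2) (𝓡 2) ∞ g
  surjective : Function.Surjective g
  embedding : IsSmoothEmbedding (𝓡 2) (𝓡 3) ∞ f
  continuous : Continuous F
  lift : ∀ s, q (F s) = f (g s)
  fiber : ∀ s s', g s = g s' → ∃ h ∈ H, F s' = h (F s)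
  invariant : ∀ h ∈ H, ∀ s, ∃ s', g s' = g s ∧ F s' = h (F s)

variable {S N : Type*} [TopologicalSpace S] [ChartedSpace (EuclideanSpace ℝ (Fin 2)) S]
  [TopologicalSpace N] [ChartedSpace (EuclideanSpace ℝ (Fin 2)) N]
  {H : Subgroup (Sol ≃ₜ Sol)} {g : N → S} {f : S → L} {F : N → Sol}

theorem IsSurfaceLift.mem_range_iff (hF : IsSurfaceLift Γ q H g f F) {h : Sol ≃ₜ Sol} (hh : h ∈ H)
    (p : Sol) : h p ∈ range F ↔ p ∈ range F := by
  have key : ∀ h ∈ H, ∀ p ∈ range F, h p ∈ range F := by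
    rintro h hh _ ⟨s, rfl⟩
    obtain ⟨s', -, hs'⟩ := hF.invariant h hh s
    exact ⟨s', hs'⟩
  refine ⟨fun hp => ?_, key h hh p⟩
  have := key h⁻¹ (H.inv_mem hh) _ hp
  rwa [show h⁻¹ (h p) = p from h.symm_apply_apply p] at this

/-- Two points of the lifted surface near each other in `L` are near each other in `N`. -/
theorem IsSurfaceLift.exists_nhds (hF : IsSurfaceLift Γ q H g f F) (s : N) {W : Set N}
    (hW : W ∈ 𝓝 s) : ∃ V ∈ 𝓝 (f (g s)), ∀ s', f (g s') ∈ V → ∃ w ∈ W, g w = g s' := by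
  have h1 : g '' W ∈ 𝓝 (g s) := hF.diffeo.isOpenMap.image_mem_nhds hW
  rw [hF.embedding.isEmbedding.nhds_eq_comap] at h1
  obtain ⟨V, hV, h2⟩ := Filter.mem_comap.1 h1
  exact ⟨V, hV, fun s' hs' => h2 hs'⟩

/-- A limit point lies over the compact image of f, so it is γ (F s₀). As f is an embedding, nearby
points of the lift have the form F s = γ (F w) with w near s₀ and g w = g s; by freeness γ ∈ H. -/
theorem IsSurfaceLift.isClosed_range (hF : IsSurfaceLift Γ q H g f F) (hq : IsSolQuotient Γ q)
    [T2Space L] [CompactSpace S] : IsClosed (range F) := by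
  refine isClosed_of_closure_subset fun r hr => ?_
  have hc : IsClosed (q ⁻¹' range f) :=
    (isCompact_range hF.embedding.contMDiff.continuous).isClosed.preimage hq.continuous
  have hsub : range F ⊆ q ⁻¹' range f := by
    rintro _ ⟨s, rfl⟩
    exact ⟨g s, (hF.lift s).symm⟩
  obtain ⟨x, hx⟩ := closure_minimal hsub hc hr
  obtain ⟨s₀, rfl⟩ := hF.surjective x
  rw [← hF.lift, hq.fiber] at hx
  obtain ⟨γ, hγ, rfl⟩ := hx
  obtain ⟨U, hU, hrU, hinj⟩ := hq.exists_injOn (γ (F s₀))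
  obtain ⟨V, hV, hVW⟩ := hF.exists_nhds s₀
    ((γ.continuous.comp hF.continuous).continuousAt.preimage_mem_nhds (hU.mem_nhds hrU))
  have hV' : q ⁻¹' V ∈ 𝓝 (γ (F s₀)) := hq.continuous.continuousAt.preimage_mem_nhds (by
    rwa [hq.apply_eq hγ, hF.lift])
  obtain ⟨_, ⟨hsU, hsV⟩, ⟨s, rfl⟩⟩ := mem_closure_iff_nhds.1 hr _
    (Filter.inter_mem (hU.mem_nhds hrU) hV')
  obtain ⟨w, hwW, hw⟩ := hVW s (by rw [← hF.lift]; exact hsV)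
  have e1 : γ (F w) = F s := hinj hwW hsU (by
    rw [Function.comp_apply, hq.apply_eq hγ, hF.lift, hF.lift, hw])
  obtain ⟨h, hh, e2⟩ := hF.fiber w s hw
  have : γ = h := hq.eq_of_apply_eq hγ (hF.le hh) (e1.trans e2)
  rw [this, hF.mem_range_iff hh]
  exact mem_range_self _

theorem IsDefiningFunction.exists_of_eventually {E : Type*} [NormedAddCommGroup E] [NormedSpace ℝ E]
    {S : Set E} {h : E → ℝ} {x : E} (hc : ContDiffAt ℝ 1 h x) (h0 : fderiv ℝ h x ≠ 0)
    (hS : ∀ᶠ y in 𝓝 x, y ∈ S ↔ h y = 0) : ∃ U, x ∈ U ∧ IsDefiningFunction S U h := by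
  have h1 : ∀ᶠ y in 𝓝 x, fderiv ℝ h y ≠ 0 :=
    (hc.fderiv_right (m := 0) (by simp)).continuousAt.eventually_ne h0
  obtain ⟨U, hU, hUo, hx⟩ := mem_nhds_iff.1 ((hc.eventually (by simp)).and (h1.and hS))
  exact ⟨U, hx, hUo, fun y hy => (hU hy).1, fun y hy => (hU hy.1).2.1, fun y hy => (hU hy).2.2⟩

theorem isLocalDiffeomorphAt_of_mem_maximalAtlas {ψ : OpenPartialHomeomorph L (EuclideanSpace ℝ (Fin 3))}
    (hψ : ψ ∈ IsManifold.maximalAtlas (𝓡 3) ∞ L) {y : L} (hy : y ∈ ψ.source) :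
    IsLocalDiffeomorphAt (𝓡 3) (𝓡 3) ∞ ψ y :=
  PartialDiffeomorph.isLocalDiffeomorphAt (𝓡 3) (𝓡 3) ∞
    { ψ with
      contMDiffOn_toFun := contMDiffOn_of_mem_maximalAtlas hψ
      contMDiffOn_invFun := contMDiffOn_symm_of_mem_maximalAtlas hψ } hy

/-- In suitable charts an immersion is u ↦ (u, 0); the last coordinate, pulled back by q, is a local
equation. The embedding hypothesis rules out other sheets of the surface nearby. -/
theorem IsSurfaceLift.exists_isDefiningFunction (hF : IsSurfaceLift Γ q H g f F)
    (hq : IsSolQuotient Γ q) {p : Sol} (hp : p ∈ range F) :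
    ∃ U h, p ∈ U ∧ IsDefiningFunction (range F) U h := by
  obtain ⟨s, rfl⟩ := hp
  have him := hF.embedding.isImmersion.isImmersionAt (g s)
  set φ := him.domChart
  set ψ := him.codChart
  set e := him.equiv
  have hφ : g s ∈ φ.source := him.mem_domChart_source
  have hψ : f (g s) ∈ ψ.source := him.mem_codChart_source
  have hform : ∀ x ∈ φ.source, ψ (f x) = e (φ x, 0) := by
    intro x hx
    have hx1 : φ x ∈ (φ.extend (𝓡 2)).target := by simpa using φ.map_source hx
    have := him.writtenInCharts hx1
    simpa [φ, him.domChart.left_inv hx] using this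
  have : FiniteDimensional ℝ (EuclideanSpace ℝ (Fin 2) × him.complement) :=
    e.symm.toLinearEquiv.finiteDimensional
  have : FiniteDimensional ℝ him.complement :=
    Module.Finite.of_surjective (LinearMap.snd ℝ (EuclideanSpace ℝ (Fin 2)) him.complement)
      LinearMap.snd_surjective
  -- Codimension one: 3 = 2 + dim of the complement, so the normal coordinate is a single real
  -- function.
  have hdim : Module.finrank ℝ him.complement = Module.finrank ℝ ℝ := by
    have := e.toLinearEquiv.finrank_eq
    rw [Module.finrank_prod] at this
    simp at this ⊢
    omega
  let ℓ : him.complement ≃L[ℝ] ℝ := ContinuousLinearEquiv.ofFinrankEq hdim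
  let A : Sol →L[ℝ] ℝ := (ℓ : him.complement →L[ℝ] ℝ).comp
    ((ContinuousLinearMap.snd ℝ (EuclideanSpace ℝ (Fin 2)) him.complement).comp (e.symm : Sol →L[ℝ] _))
  have hA0 : ∀ y : Sol, A y = 0 ↔ (e.symm y).2 = 0 := fun y => by simp [A]
  have hqψ : q (F s) ∈ ψ.source := by rw [hF.lift]; exact hψ
  have hT : IsLocalDiffeomorphAt (𝓡 3) (𝓡 3) ∞ (ψ ∘ q) (F s) :=
    (hq.diffeo (F s)).comp (𝓡 3) _ (isLocalDiffeomorphAt_of_mem_maximalAtlas him.codChart_mem_maximalAtlas hqψ)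
  have hTc : ContDiffAt ℝ ∞ (ψ ∘ q) (F s) := hT.contMDiffAt.contDiffAt
  obtain ⟨h, hh⟩ : ∃ h : Sol → ℝ, h = A ∘ ψ ∘ q := ⟨_, rfl⟩
  suffices hs : ∃ U, F s ∈ U ∧ IsDefiningFunction (range F) U h by
    obtain ⟨U, h1, h2⟩ := hs
    exact ⟨U, h, h1, h2⟩
  refine IsDefiningFunction.exists_of_eventually ?_ ?_ ?_
  · rw [hh]
    exact A.contDiff.contDiffAt.comp _ (hTc.of_le (by simp))
  · have hd : fderiv ℝ h (F s) = A.comp (fderiv ℝ (ψ ∘ q) (F s)) := by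
      rw [hh]
      exact (A.hasFDerivAt.comp _ (hTc.differentiableAt (by simp)).hasFDerivAt).fderiv
    intro h0
    obtain ⟨v, hv⟩ : ∃ v, A v ≠ 0 := ⟨e (0, ℓ.symm 1), by simp [A]⟩
    let D := hT.mfderivToContinuousLinearEquiv (by simp)
    have hD : ∀ w, fderiv ℝ (ψ ∘ q) (F s) w = D w := fun w => by
      rw [← mfderiv_eq_fderiv]; rfl
    apply hv
    have h1 : A (fderiv ℝ (ψ ∘ q) (F s) (D.symm v)) = 0 :=
      congrArg (fun T : Sol →L[ℝ] ℝ => T (D.symm v)) (hd.symm.trans h0)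
    exact (congrArg A (D.apply_symm_apply v)).symm.trans ((congrArg A (hD _)).symm.trans h1)
  · obtain ⟨U, hU, hpU, hinj⟩ := hq.exists_injOn (F s)
    set W := F ⁻¹' U
    have hW : W ∈ 𝓝 s := hF.continuous.continuousAt.preimage_mem_nhds (hU.mem_nhds hpU)
    have hgs : g '' W ∩ φ.source ∈ 𝓝 (g s) := Filter.inter_mem
      (hF.diffeo.isOpenMap.image_mem_nhds hW) (φ.open_source.mem_nhds hφ)
    obtain ⟨V, hV, hVW⟩ := Filter.mem_comap.1 (hF.embedding.isEmbedding.nhds_eq_comap (g s) ▸ hgs)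
    have hcq : ContinuousAt q (F s) := hq.continuous.continuousAt
    have h1 : ∀ᶠ r in 𝓝 (F s), q r ∈ V := hcq.eventually (by rw [hF.lift]; exact hV)
    have h2 : ∀ᶠ r in 𝓝 (F s), q r ∈ ψ.source :=
      hcq.eventually (ψ.open_source.mem_nhds hqψ)
    have hval : (e.symm ((ψ ∘ q) (F s))).1 = φ (g s) := by
      simp only [Function.comp_apply, hF.lift, hform _ hφ]
      simp
    have hc3 : ContinuousAt (fun r => (e.symm ((ψ ∘ q) r)).1) (F s) :=
      continuous_fst.continuousAt.comp (e.symm.continuous.continuousAt.comp hTc.continuousAt)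
    have h3 : ∀ᶠ r in 𝓝 (F s), (e.symm ((ψ ∘ q) r)).1 ∈ φ.target :=
      hc3.eventually (φ.open_target.mem_nhds (by beta_reduce; rw [hval]; exact φ.map_source hφ))
    have h4 : ∀ᶠ r in 𝓝 (F s), φ.symm (e.symm ((ψ ∘ q) r)).1 ∈ g '' W := by
      have hc4 : ContinuousAt (fun r => φ.symm (e.symm ((ψ ∘ q) r)).1) (F s) :=
        ContinuousAt.comp (g := φ.symm)
          (φ.continuousAt_symm (by rw [hval]; exact φ.map_source hφ)) hc3
      refine hc4.eventually ?_
      beta_reduce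
      rw [hval, φ.left_inv hφ]
      exact hF.diffeo.isOpenMap.image_mem_nhds hW
    filter_upwards [h1, h2, h3, h4, hU.mem_nhds hpU] with r r1 r2 r3 r4 r5
    rw [hh, Function.comp_apply, hA0]
    constructor
    · rintro ⟨s', rfl⟩
      have : g s' ∈ φ.source := (hVW (show f (g s') ∈ V by rw [← hF.lift]; exact r1)).2
      rw [Function.comp_apply, hF.lift, hform _ this]
      simp
    · intro h0
      obtain ⟨w, hw, hwe⟩ := r4
      set x' := φ.symm (e.symm ((ψ ∘ q) r)).1 with hx'
      have hx's : x' ∈ φ.source := φ.map_target r3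
      have e1 : ψ (f x') = ψ (q r) := by
        rw [hform _ hx's, hx', φ.right_inv r3]
        apply e.symm.injective
        rw [e.symm_apply_apply]
        exact Prod.ext rfl h0.symm
      have e2 : f x' = q r := ψ.injOn (him.source_subset_preimage_source hx's) r2 e1
      refine ⟨w, hinj hw r5 ?_⟩
      rw [hF.lift, hwe, e2]

end Covering

/-! ### Vector fields along a surface -/

section TwoSided

variable {L : Type*} [TopologicalSpace L] [ChartedSpace (EuclideanSpace ℝ (Fin 3)) L]
  {Γ : Subgroup (Sol ≃ₜ Sol)} {q : Sol → L}
  {S N : Type*} [TopologicalSpace S] [ChartedSpace (EuclideanSpace ℝ (Fin 2)) S]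
  [TopologicalSpace N] [ChartedSpace (EuclideanSpace ℝ (Fin 2)) N]
  {H : Subgroup (Sol ≃ₜ Sol)} {g : N → S} {f : S → L} {F : N → Sol}

/-- Projecting the normal form to its first factor gives a differentiable local left inverse of f;
the chain rule does the rest. -/
theorem Manifold.IsImmersionAt.mfderiv_injective [IsManifold (𝓡 2) ∞ S] [IsManifold (𝓡 3) ∞ L]
    {x : S} (him : IsImmersionAt (𝓡 2) (𝓡 3) ∞ f x) :
    Function.Injective (mfderiv (𝓡 2) (𝓡 3) f x) := by
  set φ := him.domChart
  set ψ := him.codChart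
  set e := him.equiv
  have hφ : x ∈ φ.source := him.mem_domChart_source
  have hψ : f x ∈ ψ.source := him.mem_codChart_source
  have hform : ∀ x ∈ φ.source, ψ (f x) = e (φ x, 0) := by
    intro x hx
    have hx1 : φ x ∈ (φ.extend (𝓡 2)).target := by simpa using φ.map_source hx
    have := him.writtenInCharts hx1
    simpa [φ, him.domChart.left_inv hx] using this
  let B : Sol →L[ℝ] EuclideanSpace ℝ (Fin 2) :=
    (ContinuousLinearMap.fst ℝ (EuclideanSpace ℝ (Fin 2)) him.complement).comp (e.symm : Sol →L[ℝ] _)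
  have hB : ∀ x' ∈ φ.source, B (ψ (f x')) = φ x' := fun x' hx' => by
    rw [hform x' hx']; simp [B]
  have hG : MDifferentiableAt (𝓡 3) (𝓡 2) (φ.symm ∘ B ∘ ψ) (f x) := by
    have h1 : MDifferentiableAt (𝓡 3) (𝓡 3) ψ (f x) :=
      (contMDiffAt_of_mem_maximalAtlas him.codChart_mem_maximalAtlas hψ).mdifferentiableAt (by simp)
    have h2 : MDifferentiableAt (𝓡 3) (𝓡 2) B (ψ (f x)) := B.mdifferentiableAt
    have h3 : MDifferentiableAt (𝓡 2) (𝓡 2) φ.symm ((B ∘ ψ) (f x)) :=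
      (contMDiffAt_symm_of_mem_maximalAtlas him.domChart_mem_maximalAtlas (by
        rw [Function.comp_apply, hB x hφ]; exact φ.map_source hφ)).mdifferentiableAt (by simp)
    exact h3.comp _ (h2.comp _ h1)
  have hid : (φ.symm ∘ B ∘ ψ) ∘ f =ᶠ[𝓝 x] id := by
    filter_upwards [φ.open_source.mem_nhds hφ] with x' hx'
    simp only [Function.comp_apply, hB x' hx', φ.left_inv hx', id]
  have hcomp := mfderiv_comp x hG (him.contMDiffAt.mdifferentiableAt (by simp))
  rw [hid.mfderiv_eq, mfderiv_id] at hcomp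
  intro u v huv
  have key : ∀ w, w = mfderiv (𝓡 3) (𝓡 2) (φ.symm ∘ B ∘ ψ) (f x) (mfderiv (𝓡 2) (𝓡 3) f x w) :=
    fun w => congrArg (fun T : EuclideanSpace ℝ (Fin 2) →L[ℝ] EuclideanSpace ℝ (Fin 2) => T w) hcomp
  rw [key u, huv, ← key v]

theorem IsSurfaceLift.contMDiff (hF : IsSurfaceLift Γ q H g f F) (hq : IsSolQuotient Γ q) :
    ContMDiff (𝓡 2) (𝓡 3) ∞ F := by
  intro s
  have hloc := hq.diffeo (F s)
  have h1 : F =ᶠ[𝓝 s] hloc.localInverse ∘ (f ∘ g) := by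
    filter_upwards [hF.continuous.continuousAt.eventually hloc.localInverse_eventuallyEq_left]
      with s' hs'
    rw [Function.comp_apply, Function.comp_apply, ← hF.lift]
    exact hs'.symm
  refine ContMDiffAt.congr_of_eventuallyEq ?_ h1
  have h2 : ContMDiffAt (𝓡 3) (𝓡 3) ∞ hloc.localInverse ((f ∘ g) s) := by
    rw [Function.comp_apply, ← hF.lift]
    exact hloc.localInverse_contMDiffAt
  exact h2.comp s (hF.embedding.contMDiff.contMDiffAt.comp s (hF.diffeo s).contMDiffAt)

theorem IsSurfaceLift.mfderiv_comp_eq (hF : IsSurfaceLift Γ q H g f F) (hq : IsSolQuotient Γ q)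
    (s : N) (v : EuclideanSpace ℝ (Fin 2)) :
    (mfderiv (𝓡 3) (𝓡 3) q (F s) (mfderiv (𝓡 2) (𝓡 3) F s v) : EuclideanSpace ℝ (Fin 3)) =
      mfderiv (𝓡 2) (𝓡 3) f (g s) (mfderiv (𝓡 2) (𝓡 2) g s v) := by
  have h1 := mfderiv_comp s ((hq.diffeo (F s)).mdifferentiableAt (by simp))
    ((hF.contMDiff hq s).mdifferentiableAt (by simp))
  have h2 := mfderiv_comp s (hF.embedding.contMDiff.mdifferentiableAt (by simp) (x := g s))
    ((hF.diffeo s).mdifferentiableAt (by simp))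
  have h3 : q ∘ F = f ∘ g := funext hF.lift
  rw [h3] at h1
  exact congrArg (fun T : EuclideanSpace ℝ (Fin 2) →L[ℝ] EuclideanSpace ℝ (Fin 3) => T v)
    (h1.symm.trans h2)

theorem IsSurfaceLift.mfderiv_injective [IsManifold (𝓡 2) ∞ S] [IsManifold (𝓡 3) ∞ L]
    (hF : IsSurfaceLift Γ q H g f F) (hq : IsSolQuotient Γ q) (s : N) :
    Function.Injective (mfderiv (𝓡 2) (𝓡 3) F s) := by
  intro u v huv
  have hg := ((hF.diffeo s).mfderivToContinuousLinearEquiv (by simp)).injective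
  apply hg
  apply (hF.embedding.isImmersion.isImmersionAt (g s)).mfderiv_injective
  have e := hF.mfderiv_comp_eq hq s
  exact (e u).symm.trans ((congrArg (fun w => (mfderiv (𝓡 3) (𝓡 3) q (F s) w :
    EuclideanSpace ℝ (Fin 3))) huv).trans (e v))

/-- The gradient of a linear form with respect to the metric of Sol. -/
def solGrad (p : Sol) (φ : Sol →L[ℝ] ℝ) : Sol :=
  WithLp.toLp 2 fun i => φ (EuclideanSpace.single i 1) / solCoeff p i ^ 2

theorem solInner_solGrad (p : Sol) (φ : Sol →L[ℝ] ℝ) (v : Sol) :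
    solInner p (solGrad p φ) v = φ v := by
  have hv : v = ∑ i, v i • EuclideanSpace.single i (1 : ℝ) := by
    ext j; simp [Pi.single_apply]
  conv_rhs => rw [hv, map_sum]
  rw [solInner_apply]
  refine Finset.sum_congr rfl fun i _ => ?_
  have := (solCoeff_pos p i).ne'
  simp only [solGrad, map_smul, smul_eq_mul]
  field_simp

theorem eq_solGrad {p w : Sol} {φ : Sol →L[ℝ] ℝ} (h : ∀ v, solInner p w v = φ v) :
    w = solGrad p φ := by
  by_contra hne
  have h1 := solInner_pos p (w - solGrad p φ) (sub_ne_zero.2 hne)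
  have h2 : ∀ v, solInner p (w - solGrad p φ) v = 0 := fun v => by
    rw [map_sub]
    exact sub_eq_zero.2 ((h v).trans (solInner_solGrad p φ v).symm)
  exact h1.ne' (h2 _)

theorem apply_solGrad_pos {p : Sol} {φ : Sol →L[ℝ] ℝ} (hφ : φ ≠ 0) : 0 < φ (solGrad p φ) := by
  rw [← solInner_solGrad p]
  refine solInner_pos p _ fun h0 => hφ ?_
  ext v
  rw [← solInner_solGrad p φ v, h0]
  simp

/-- The unit normal vector of the kernel of a linear form, with respect to the metric of Sol. -/
def solNormal (p : Sol) (φ : Sol →L[ℝ] ℝ) : Sol := (√(φ (solGrad p φ)))⁻¹ • solGrad p φ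

theorem apply_solNormal_pos {p : Sol} {φ : Sol →L[ℝ] ℝ} (hφ : φ ≠ 0) : 0 < φ (solNormal p φ) := by
  have := apply_solGrad_pos (p := p) hφ
  rw [solNormal, map_smul, smul_eq_mul]
  positivity

/-- An isometry carries gradients to gradients up to the factor c, and dividing by the length
removes c. Thus only the direction of a conormal has to be invariant. -/
theorem solNormal_map {h : Sol ≃ₜ Sol} (hh : h ∈ solIsometryGroup) {p : Sol} {φ ψ : Sol →L[ℝ] ℝ}
    {c : ℝ} (hc : 0 < c) (hψ : ∀ v, ψ (fderiv ℝ h p v) = c * φ v) :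
    solNormal (h p) ψ = fderiv ℝ h p (solNormal p φ) := by
  have hg : c • fderiv ℝ h p (solGrad p φ) = solGrad (h p) ψ := by
    refine eq_solGrad fun w => ?_
    have hinv : fderiv ℝ h p (fderiv ℝ h.symm (h p) w) = w := by
      have h1 := fderiv_comp (h p) (g := h) (f := h.symm) (hh.1.differentiable (by simp) _)
        (hh.2.1.differentiable (by simp) _)
      have h2 : (h ∘ h.symm : Sol → Sol) = id := by ext x; simp
      rw [h2, fderiv_id, h.symm_apply_apply] at h1
      exact (congrArg (fun T : Sol →L[ℝ] Sol => T w) h1).symm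
    rw [map_smul, smul_apply, ← hinv, hψ, smul_eq_mul]
    congr 1
    rw [← solInner_solGrad p φ]
    exact hh.2.2 p _ _
  have h2 : ψ (solGrad (h p) ψ) = c ^ 2 * φ (solGrad p φ) := by
    rw [← hg, map_smul, hψ, smul_eq_mul]; ring
  rw [solNormal, solNormal, h2, Real.sqrt_mul (by positivity), Real.sqrt_sq hc.le, ← hg, map_smul,
    smul_smul, mul_inv]
  congr 1
  field_simp

theorem continuous_solNormal {X : Type*} [TopologicalSpace X] {p : X → Sol} {φ : X → Sol →L[ℝ] ℝ}
    (hp : Continuous p) (hφ : Continuous φ) (h0 : ∀ x, φ x ≠ 0) :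
    Continuous fun x => solNormal (p x) (φ x) := by
  have hc : ∀ i, Continuous fun x => solCoeff (p x) i := by
    intro i
    fin_cases i
    · change Continuous fun x => Real.exp (-p x 2)
      fun_prop
    · change Continuous fun x => Real.exp (p x 2)
      fun_prop
    · exact continuous_const
  have hg : Continuous fun x => solGrad (p x) (φ x) := by
    refine (PiLp.continuous_toLp 2 _).comp (continuous_pi fun i => ?_)
    exact (hφ.clm_apply continuous_const).div ((hc i).pow 2) fun x =>
      (pow_pos (solCoeff_pos _ _) 2).ne'
  refine Continuous.smul (Continuous.inv₀ (hφ.clm_apply hg).sqrt fun x => ?_) hg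
  exact (Real.sqrt_pos.2 (apply_solGrad_pos (h0 x))).ne'

theorem IsSolQuotient.mfderiv_map (hq : IsSolQuotient Γ q) {h : Sol ≃ₜ Sol} (hh : h ∈ Γ) (p v : Sol) :
    (mfderiv (𝓡 3) (𝓡 3) q (h p) (fderiv ℝ h p v) : EuclideanSpace ℝ (Fin 3)) =
      mfderiv (𝓡 3) (𝓡 3) q p v := by
  have h1 := mfderiv_comp p (I' := 𝓡 3) (g := q) (f := h)
    ((hq.diffeo (h p)).mdifferentiableAt (by simp))
    (((hq.isometry hh).1.differentiable (by simp) p).mdifferentiableAt)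
  rw [show q ∘ h = q from funext fun p => hq.apply_eq hh p, mfderiv_eq_fderiv] at h1
  exact (congrArg (fun T : Sol →L[ℝ] Sol => T v) h1).symm

/-- A surface is two-sided if its lift to Sol has a continuous field of conormal directions which
is invariant under the deck transformations. -/
theorem IsSurfaceLift.isTwoSided [IsManifold (𝓡 3) ∞ L] (hF : IsSurfaceLift Γ q H g f F)
    (hq : IsSolQuotient Γ q) {φ : N → Sol →L[ℝ] ℝ} (hφ : Continuous φ) (h0 : ∀ s, φ s ≠ 0)
    (htan : ∀ s v, φ s (mfderiv (𝓡 2) (𝓡 3) F s v) = 0)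
    (heq : ∀ s s', g s = g s' → ∃ h ∈ Γ, F s' = h (F s) ∧ ∃ c > 0,
      ∀ v, φ s' (fderiv ℝ h (F s) v) = c * φ s v) : IsTwoSided f := by
  let n : N → Sol := fun s => solNormal (F s) (φ s)
  have hn : Continuous n := continuous_solNormal hF.continuous hφ h0
  let T : N → TangentBundle (𝓡 3) L := fun s =>
    tangentMap (𝓡 3) (𝓡 3) q ⟨F s, n s⟩
  have hT : Continuous T := by
    refine (hq.diffeo.contMDiff.continuous_tangentMap (by simp)).comp ?_
    exact (tangentBundleModelSpaceHomeomorph (𝓡 3)).symm.continuous.comp (hF.continuous.prodMk hn)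
  -- The pushed-down normal depends only on the point of S, so it descends along g.
  have hval : ∀ s s', g s = g s' → (mfderiv (𝓡 3) (𝓡 3) q (F s) (n s) : EuclideanSpace ℝ (Fin 3)) =
      mfderiv (𝓡 3) (𝓡 3) q (F s') (n s') := by
    intro s s' hss
    obtain ⟨h, hh, e, c, hc, hφc⟩ := heq s s' hss
    have e2 : n s' = fderiv ℝ h (F s) (n s) := by
      change solNormal (F s') (φ s') = _
      rw [e]
      exact solNormal_map (hq.isometry hh) hc hφc
    rw [e2, e]
    exact (hq.mfderiv_map hh _ _).symm
  have hcast : ∀ a b : L, a = b → ∀ w : EuclideanSpace ℝ (Fin 3),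
      (⟨a, w⟩ : TangentBundle (𝓡 3) L) = ⟨b, w⟩ := by
    rintro a _ rfl w; rfl
  let σ : S → N := Function.surjInv hF.surjective
  have hσ : ∀ x, g (σ x) = x := Function.surjInv_eq hF.surjective
  let v : ∀ x : S, TangentSpace (𝓡 3) (f x) := fun x =>
    (mfderiv (𝓡 3) (𝓡 3) q (F (σ x)) (n (σ x)) : EuclideanSpace ℝ (Fin 3))
  have hv : ∀ s, v (g s) = (mfderiv (𝓡 3) (𝓡 3) q (F s) (n s) : EuclideanSpace ℝ (Fin 3)) :=
    fun s => hval _ _ (hσ _)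
  refine ⟨v, ?_, fun x => ?_⟩
  · have hquot : IsQuotientMap g := hF.diffeo.isOpenMap.isQuotientMap
      hF.diffeo.contMDiff.continuous hF.surjective
    rw [hquot.continuous_iff]
    convert hT using 1
    funext s
    change (⟨f (g s), v (g s)⟩ : TangentBundle (𝓡 3) L) = ⟨q (F s), _⟩
    rw [hv]
    exact hcast _ _ (hF.lift s).symm _
  -- If the pushed-down normal were tangent to f, then n would be tangent to F, yet φ kills tangent
  -- vectors and is positive on n.
  · rintro ⟨w, hw⟩
    obtain ⟨s, rfl⟩ := hF.surjective x
    obtain ⟨w', rfl⟩ := ((hF.diffeo s).mfderivToContinuousLinearEquiv (by simp)).surjective w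
    have h1 := (hF.mfderiv_comp_eq hq s w').trans (hw.trans (hv s))
    have h2 : mfderiv (𝓡 2) (𝓡 3) F s w' = n s :=
      ((hq.diffeo (F s)).mfderivToContinuousLinearEquiv (by simp)).injective h1
    have h3 := apply_solNormal_pos (p := F s) (h0 s)
    have h4 := htan s w'
    rw [h2] at h4
    exact h3.ne' h4

end TwoSided

/-! ### Conormal fields of two-sided hypersurfaces -/

section Conormal

variable {E : Type*} [NormedAddCommGroup E] [NormedSpace ℝ E]

/-- The open set `P` is one of the sides of the hypersurface `S`. -/
structure IsSide (S P : Set E) : Prop where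
  disjoint : Disjoint P S
  eventually : ∀ x ∉ S, ∀ᶠ y in 𝓝 x, y ∈ P ↔ x ∈ P
  exists_isDefiningFunction : ∀ x ∈ S, ∃ U h, x ∈ U ∧ IsDefiningFunction S U h ∧
    ∀ y ∈ U, y ∈ P ↔ 0 < h y

theorem IsSide.notMem {S P : Set E} (hP : IsSide S P) {x : E} (hx : x ∈ S) : x ∉ P :=
  fun h => Set.disjoint_left.1 hP.disjoint h hx

theorem IsSide.mem_iff_of_isPreconnected {S P : Set E} (hP : IsSide S P) {T : Set E}
    (hT : IsPreconnected T) (hTS : Disjoint T S) {x y : E} (hx : x ∈ T) (hy : y ∈ T) :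
    x ∈ P ↔ y ∈ P := by
  have h : IsLocallyConstant fun t : T => (t : E) ∈ P := by
    refine (IsLocallyConstant.iff_eventually_eq _).2 fun t => ?_
    have := hP.eventually t (Set.disjoint_left.1 hTS t.2)
    filter_upwards [continuous_subtype_val.continuousAt.eventually this] with s hs using propext hs
  have : PreconnectedSpace T := isPreconnected_iff_preconnectedSpace.1 hT
  exact Iff.of_eq (h.apply_eq_of_preconnectedSpace ⟨x, hx⟩ ⟨y, hy⟩)

/-- `φ` is a linear form which is positive on the tangent vectors at `p` pointing into `P`. -/
structure IsConormal (P : Set E) (p : E) (φ : E →L[ℝ] ℝ) : Prop where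
  ne_zero : φ ≠ 0
  pos : ∀ v, 0 < φ v → ∀ᶠ t in 𝓝[>] (0 : ℝ), p + t • v ∈ P
  neg : ∀ v, φ v < 0 → ∀ᶠ t in 𝓝[>] (0 : ℝ), p + t • v ∉ P

/-- Both forms see P on their positive side, so φ > 0 implies ψ ≥ 0; this forces equal kernels and a
positive ratio. -/
theorem IsConormal.eq_smul {P : Set E} {p : E} {φ ψ : E →L[ℝ] ℝ} (hφ : IsConormal P p φ)
    (hψ : IsConormal P p ψ) : ∃ c : ℝ, 0 < c ∧ ψ = c • φ := by
  have h1 : ∀ v, 0 < φ v → 0 ≤ ψ v := by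
    intro v hv
    by_contra! hn
    obtain ⟨t, h1, h2⟩ := ((hφ.pos v hv).and (hψ.neg v hn)).exists
    exact h2 h1
  obtain ⟨u, hu⟩ : ∃ u, φ u ≠ 0 := by
    by_contra! h; exact hφ.ne_zero (ContinuousLinearMap.ext h)
  obtain ⟨v, hv⟩ : ∃ v, φ v = 1 := ⟨(φ u)⁻¹ • u, by simp [hu]⟩
  have h2 : ∀ w, φ w = 0 → ψ w = 0 := by
    intro w hw
    by_contra hne
    -- The coefficient of w makes ψ equal to -1 while φ stays equal to 1.
    have := h1 (v + (-(ψ v + 1) / ψ w) • w) (by simp [hw, hv])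
    simp only [map_add, map_smul, smul_eq_mul] at this
    rw [div_mul_cancel₀ _ hne] at this
    linarith
  have h3 : ψ = ψ v • φ := by
    ext w
    have := h2 (w - φ w • v) (by simp [hv])
    simp only [map_sub, map_smul, smul_eq_mul] at this
    simp only [smul_apply, smul_eq_mul]
    linarith
  refine ⟨ψ v, lt_of_le_of_ne (h1 v (by simp [hv])) fun h0 => hψ.ne_zero ?_, h3⟩
  rw [h3, ← h0, zero_smul]

theorem IsDefiningFunction.isConormal {S P U : Set E} {k : E → ℝ} (hk : IsDefiningFunction S U k)
    (hP : ∀ y ∈ U, y ∈ P ↔ 0 < k y) {p : E} (hp : p ∈ U) (hS : p ∈ S) :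
    IsConormal P p (fderiv ℝ k p) := by
  have hU : ∀ v : E, ∀ᶠ t in 𝓝[>] (0 : ℝ), p + t • v ∈ U := fun v => by
    have : ContinuousAt (fun t : ℝ => p + t • v) 0 := by fun_prop
    exact (this.eventually (hk.isOpen.mem_nhds (by simpa using hp))).filter_mono nhdsWithin_le_nhds
  have hd : ∀ v, Filter.Tendsto (fun t : ℝ => t⁻¹ • (k (p + t • v) - k p)) (𝓝[>] 0)
      (𝓝 (fderiv ℝ k p v)) := fun v => by
    have := ((hk.contDiffAt p hp).differentiableAt (by simp)).hasFDerivAt.hasLineDerivAt v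
    exact this.tendsto_slope_zero_right
  have h0 : k p = 0 := (hk.mem_iff p hp).1 hS
  refine ⟨hk.fderiv_ne_zero p ⟨hp, hS⟩, fun v hv => ?_, fun v hv => ?_⟩
  · filter_upwards [hU v, (hd v).eventually_const_lt hv, self_mem_nhdsWithin] with t h1 h2 h3
    rw [hP _ h1]
    rw [h0, sub_zero, smul_eq_mul] at h2
    exact (pos_iff_pos_of_mul_pos h2).1 (inv_pos.2 h3)
  · filter_upwards [hU v, (hd v).eventually_lt_const hv, self_mem_nhdsWithin] with t h1 h2 h3
    rw [hP _ h1]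
    rw [h0, sub_zero, smul_eq_mul] at h2
    intro h4
    exact absurd h2 (not_lt.2 (mul_pos (inv_pos.2 h3) h4).le)

/-- The sides of a hypersurface determine a continuous field of conormals. -/
theorem IsSide.exists_conormal {S P : Set E} (hP : IsSide S P) : ∃ ν : E → E →L[ℝ] ℝ,
    ContinuousOn ν S ∧ ∀ p ∈ S, IsConormal P p (ν p) := by
  classical
  choose! U k hU hk hPk using hP.exists_isDefiningFunction
  have hcon : ∀ p ∈ S, IsConormal P p (fderiv ℝ (k p) p) := fun p hp =>
    (hk p hp).isConormal (hPk p hp) (hU p hp) hp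
  -- Normalizing removes the dependence on the chosen local equation, so near a given point one
  -- equation computes ν and continuity follows.
  let ν : E → E →L[ℝ] ℝ := fun p => ‖fderiv ℝ (k p) p‖⁻¹ • fderiv ℝ (k p) p
  have hscale : ∀ {p φ} {c : ℝ}, 0 < c → IsConormal P p φ → IsConormal P p (c • φ) := by
    intro p φ c hc h
    refine ⟨smul_ne_zero hc.ne' h.ne_zero, fun v hv => h.pos v ?_, fun v hv => h.neg v ?_⟩
    · exact (pos_iff_pos_of_mul_pos (by simpa using hv)).1 hc
    · simp only [smul_apply, smul_eq_mul] at hv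
      by_contra! h0
      exact absurd hv (not_lt.2 (mul_nonneg hc.le h0))
  refine ⟨ν, fun p hp => ?_, fun p hp =>
    hscale (inv_pos.2 (norm_pos_iff.2 (hcon p hp).ne_zero)) (hcon p hp)⟩
  have hc : ContinuousAt (fun y => ‖fderiv ℝ (k p) y‖⁻¹ • fderiv ℝ (k p) y) p := by
    have h1 : ContinuousAt (fderiv ℝ (k p)) p :=
      (((hk p hp).contDiffAt p (hU p hp)).fderiv_right (m := 0) (by simp)).continuousAt
    exact (h1.norm.inv₀ (norm_ne_zero_iff.2 (hcon p hp).ne_zero)).smul h1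
  refine hc.continuousWithinAt.congr_of_eventuallyEq ?_ rfl
  filter_upwards [self_mem_nhdsWithin,
    nhdsWithin_le_nhds ((hk p hp).isOpen.mem_nhds (hU p hp))] with y hyS hyU
  obtain ⟨c, hc, e⟩ := ((hk p hp).isConormal (hPk p hp) hyU hyS).eq_smul (hcon y hyS)
  change ‖_‖⁻¹ • _ = _
  rw [e, norm_smul, Real.norm_eq_abs, abs_of_pos hc, smul_smul, mul_inv, mul_right_comm,
    inv_mul_cancel₀ hc.ne', one_mul]

end Conormal

/-! ### Sides of the lifted surface under deck transformations -/

section Sides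

variable {L : Type*} [TopologicalSpace L] [ChartedSpace (EuclideanSpace ℝ (Fin 3)) L]
  {Γ : Subgroup (Sol ≃ₜ Sol)} {q : Sol → L}
  {S N : Type*} [TopologicalSpace S] [ChartedSpace (EuclideanSpace ℝ (Fin 2)) S]
  [TopologicalSpace N] [ChartedSpace (EuclideanSpace ℝ (Fin 2)) N]
  {H : Subgroup (Sol ≃ₜ Sol)} {g : N → S} {f : S → L} {F : N → Sol}

theorem IsSurfaceLift.exists_isSide [IsManifold (𝓡 3) ∞ L] [T2Space L] [CompactSpace S]
    (hF : IsSurfaceLift Γ q H g f F) (hq : IsSolQuotient Γ q) : ∃ P, IsSide (range F) P := by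
  obtain ⟨P, h1, h2, h3⟩ := exists_side (hF.isClosed_range hq)
    fun _ hp => hF.exists_isDefiningFunction hq hp
  exact ⟨P, h1, h2, h3⟩

theorem fderiv_isometry_surjective {h : Sol ≃ₜ Sol} (hh : h ∈ solIsometryGroup) (p : Sol) :
    Function.Surjective (fderiv ℝ h p) := by
  intro w
  have h1 := fderiv_comp (h p) (g := h) (f := h.symm) (hh.1.differentiable (by simp) _)
    (hh.2.1.differentiable (by simp) _)
  have h2 : (h ∘ h.symm : Sol → Sol) = id := by ext x; simp
  rw [h2, fderiv_id, h.symm_apply_apply] at h1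
  exact ⟨fderiv ℝ h.symm (h p) w, (congrArg (fun T : Sol →L[ℝ] Sol => T w) h1).symm⟩

theorem IsDefiningFunction.comp_isometry {T U : Set Sol} {k : Sol → ℝ}
    (hk : IsDefiningFunction T U k) {h : Sol ≃ₜ Sol} (hh : h ∈ solIsometryGroup)
    (hS : ∀ p, h p ∈ T ↔ p ∈ T) : IsDefiningFunction T (h ⁻¹' U) (k ∘ h) where
  isOpen := hk.isOpen.preimage h.continuous
  contDiffAt y hy := (hk.contDiffAt _ hy).comp y (hh.1.contDiffAt.of_le (by simp))
  fderiv_ne_zero y hy h0 := by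
    apply hk.fderiv_ne_zero (h y) ⟨hy.1, (hS y).2 hy.2⟩
    rw [fderiv_comp y ((hk.contDiffAt _ hy.1).differentiableAt (by simp))
      (hh.1.differentiable (by simp) y)] at h0
    ext w
    obtain ⟨v, rfl⟩ := fderiv_isometry_surjective hh y w
    exact congrArg (fun T : Sol →L[ℝ] ℝ => T v) h0
  mem_iff y hy := by rw [← hS]; exact hk.mem_iff _ hy

/-- The points near which h preserves sides and those near which it exchanges them form two disjoint
open sets covering the connected space Sol. So one test point off the surface decides. -/
theorem IsSurfaceLift.side_invariant (hF : IsSurfaceLift Γ q H g f F) (hq : IsSolQuotient Γ q)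
    {P : Set Sol} (hP : IsSide (range F) P) {h : Sol ≃ₜ Sol} (hh : h ∈ H) {p₀ : Sol}
    (hp₀ : p₀ ∉ range F) (h0 : h p₀ ∈ P ↔ p₀ ∈ P) (p : Sol) : h p ∈ P ↔ p ∈ P := by
  have hS := hF.mem_range_iff hh
  have hiso := hq.isometry (hF.le hh)
  let Q : Prop → Set Sol := fun b => {x | ∀ᶠ y in 𝓝 x, y ∉ range F → ((h y ∈ P ↔ y ∈ P) ↔ b)}
  have hopen : ∀ b, IsOpen (Q b) := fun b => isOpen_iff_mem_nhds.2 fun x hx =>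
    eventually_eventually_nhds.2 hx
  have hdense : ∀ x, ∃ᶠ y in 𝓝 x, y ∉ range F := by
    intro x
    by_cases hx : x ∈ range F
    · obtain ⟨U, k, hxU, hk, -⟩ := hP.exists_isDefiningFunction x hx
      exact hk.frequently_notMem hxU
    · exact fun hf => hf.self_of_nhds hx
  have hcases : ∀ x, x ∈ Q True ∨ x ∈ Q False := by
    intro x
    by_cases hx : x ∈ range F
    · obtain ⟨U, k, hxU, hk, hPk⟩ := hP.exists_isDefiningFunction x hx
      obtain ⟨V, m, hxV, hm, hPm⟩ := hP.exists_isDefiningFunction (h x) ((hS x).2 hx)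
      have hm' := hm.comp_isometry hiso hS
      rcases hk.sameSide_or hm' hxU hxV with h1 | h1
      · left
        filter_upwards [h1, hk.isOpen.mem_nhds hxU, hm'.isOpen.mem_nhds hxV] with y h2 h3 h4 h5
        rw [hPk y h3, hPm (h y) h4, iff_true]
        exact (h2 h5).symm
      · right
        filter_upwards [h1, hk.isOpen.mem_nhds hxU, hm'.isOpen.mem_nhds hxV] with y h2 h3 h4 h5
        rw [hPk y h3, hPm (h y) h4, iff_false, h2 h5]
        have h6 := mt (hm'.mem_iff y h4).2 h5
        simp only [Function.comp_apply] at h6 ⊢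
        intro h7
        rcases lt_or_gt_of_ne h6 with h8 | h8
        · exact absurd (h7.2 (by simpa using h8)) (not_lt.2 h8.le)
        · have := h7.1 h8
          linarith
    · have h1 := hP.eventually x hx
      have h2 := h.continuous.continuousAt.eventually (hP.eventually (h x) (mt (hS x).1 hx))
      by_cases hb : h x ∈ P ↔ x ∈ P
      · left
        filter_upwards [h1, h2] with y h3 h4 _
        rw [h3, h4, iff_true]
        exact hb
      · right
        filter_upwards [h1, h2] with y h3 h4 _
        rw [h3, h4, iff_false]
        exact hb
  have hdisj : ∀ x, x ∈ Q True → x ∉ Q False := by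
    intro x h1 h2
    obtain ⟨y, hy, h3, h4⟩ := ((hdense x).and_eventually (h1.and h2)).exists
    exact (h4 hy).1 ((h3 hy).2 trivial)
  have hclopen : IsClopen (Q True) := by
    refine ⟨⟨?_⟩, hopen _⟩
    convert hopen False using 1
    ext x
    exact ⟨fun hx => (hcases x).resolve_left hx, fun hx hx' => hdisj x hx' hx⟩
  have hmem : p₀ ∈ Q True := by
    refine (hcases p₀).resolve_right fun hf => ?_
    exact (hf.self_of_nhds hp₀).1 h0
  have huniv := hclopen.eq_univ ⟨p₀, hmem⟩
  by_cases hp : p ∈ range F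
  · exact iff_of_false (hP.notMem ((hS p).2 hp)) (hP.notMem hp)
  · have : p ∈ Q True := huniv ▸ mem_univ p
    exact (this.self_of_nhds hp).2 trivial

/-- A local equation vanishes identically along F, so its derivative kills tangent vectors, and
every conormal is a multiple of that derivative. -/
theorem IsSurfaceLift.conormal_mfderiv (hF : IsSurfaceLift Γ q H g f F) (hq : IsSolQuotient Γ q)
    {P : Set Sol} (hP : IsSide (range F) P) {s : N} {φ : Sol →L[ℝ] ℝ} (hφ : IsConormal P (F s) φ)
    (v : EuclideanSpace ℝ (Fin 2)) : φ (mfderiv (𝓡 2) (𝓡 3) F s v) = 0 := by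
  obtain ⟨U, k, hU, hk, hPk⟩ := hP.exists_isDefiningFunction (F s) (mem_range_self s)
  obtain ⟨c, -, rfl⟩ := (hk.isConormal hPk hU (mem_range_self s)).eq_smul hφ
  have h1 : k ∘ F =ᶠ[𝓝 s] fun _ => 0 := by
    filter_upwards [hF.continuous.continuousAt.eventually (hk.isOpen.mem_nhds hU)] with s' hs'
    exact (hk.mem_iff _ hs').1 (mem_range_self s')
  have h2 := mfderiv_comp s (I'' := 𝓘(ℝ, ℝ))
    ((hk.contDiffAt _ hU).differentiableAt (by simp)).mdifferentiableAt
    ((hF.contMDiff hq s).mdifferentiableAt (by simp))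
  rw [h1.mfderiv_eq, mfderiv_const, mfderiv_eq_fderiv] at h2
  have h3 : fderiv ℝ k (F s) (mfderiv (𝓡 2) (𝓡 3) F s v) = 0 :=
    (congrArg (fun T : EuclideanSpace ℝ (Fin 2) →L[ℝ] ℝ => T v) h2).symm
  exact (congrArg (c * ·) h3).trans (mul_zero c)

/-- A surface is two-sided if the deck transformations preserve the sides of its lift to Sol. -/
theorem IsSurfaceLift.isTwoSided_of_isSide [IsManifold (𝓡 3) ∞ L]
    (hF : IsSurfaceLift Γ q H g f F) (hq : IsSolQuotient Γ q) {P : Set Sol}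
    (hP : IsSide (range F) P) (hinv : ∀ h ∈ H, ∀ p, h p ∈ P ↔ p ∈ P) : IsTwoSided f := by
  obtain ⟨ν, hνc, hν⟩ := hP.exists_conormal
  refine hF.isTwoSided hq (φ := fun s => ν (F s))
    (hνc.comp_continuous hF.continuous fun s => mem_range_self s)
    (fun s => (hν _ (mem_range_self s)).ne_zero)
    (fun s v => hF.conormal_mfderiv hq hP (hν _ (mem_range_self s)) v) ?_
  intro s s' hss
  obtain ⟨h, hh, e⟩ := hF.fiber s s' hss
  have hiso := hq.isometry (hF.le hh)
  obtain ⟨U, k, hU, hk, hPk⟩ := hP.exists_isDefiningFunction (F s') (mem_range_self s')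
  have hk' := hk.comp_isometry hiso (hF.mem_range_iff hh)
  have hU' : F s ∈ h ⁻¹' U := by rw [mem_preimage, ← e]; exact hU
  obtain ⟨c, hc, h1⟩ := (hk.isConormal hPk hU (mem_range_self s')).eq_smul
    (hν _ (mem_range_self s'))
  -- Since h preserves P, pulling back the equation at F s' by h gives an equation at F s positive
  -- on the same side.
  obtain ⟨d, hd, h2⟩ := (hν _ (mem_range_self s)).eq_smul
    (hk'.isConormal (fun y hy => by rw [← hinv h hh]; exact hPk _ hy) hU' (mem_range_self s))
  refine ⟨h, hF.le hh, e, c * d, mul_pos hc hd, fun v => ?_⟩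
  have h3 := fderiv_comp (F s) ((hk.contDiffAt _ hU').differentiableAt (by simp))
    (hiso.1.differentiable (by simp) (F s))
  have h4 : fderiv ℝ k (h (F s)) (fderiv ℝ h (F s) v) = d * ν (F s) v :=
    congrArg (fun T : Sol →L[ℝ] ℝ => T v) (h3.symm.trans h2)
  change ν (F s') _ = c * d * ν (F s) v
  rw [h1, e, smul_apply, h4, smul_eq_mul, mul_assoc]

end Sides

/-! ### Surfaces around a vertical axis -/

/-- The isometries of Sol which preserve the vertical line over `(x₀, y₀)` and its orientation. -/
def axisStabilizer (x₀ y₀ : ℝ) : Subgroup (Sol ≃ₜ Sol) where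
  carrier := {h | ∃ e₀ e₁ l : ℝ, e₀ * e₀ = 1 ∧ e₁ * e₁ = 1 ∧ ∀ p,
    h p 0 - x₀ = e₀ * Real.exp l * (p 0 - x₀) ∧ h p 1 - y₀ = e₁ * Real.exp (-l) * (p 1 - y₀) ∧
    h p 2 = p 2 + l}
  one_mem' := ⟨1, 1, 0, by norm_num, by norm_num, fun p => by simp⟩
  mul_mem' := by
    rintro h k ⟨e₀, e₁, l, he₀, he₁, hh⟩ ⟨d₀, d₁, m, hd₀, hd₁, hk⟩
    refine ⟨e₀ * d₀, e₁ * d₁, l + m, by linear_combination he₀ * d₀ * d₀ + hd₀,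
      by linear_combination he₁ * d₁ * d₁ + hd₁, fun p => ?_⟩
    obtain ⟨h1, h2, h3⟩ := hh (k p)
    obtain ⟨k1, k2, k3⟩ := hk p
    simp only [Homeomorph.mul_apply]
    rw [h1, h2, h3, k1, k2, k3, neg_add, Real.exp_add, Real.exp_add]
    exact ⟨by ring, by ring, by ring⟩
  inv_mem' := by
    rintro h ⟨e₀, e₁, l, he₀, he₁, hh⟩
    refine ⟨e₀, e₁, -l, he₀, he₁, fun p => ?_⟩
    obtain ⟨h1, h2, h3⟩ := hh (h⁻¹ p)
    rw [show h (h⁻¹ p) = p from h.apply_symm_apply p] at h1 h2 h3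
    have hl : Real.exp l * Real.exp (-l) = 1 := by rw [← Real.exp_add, add_neg_cancel, Real.exp_zero]
    rw [h1, h2, h3, neg_neg]
    refine ⟨?_, ?_, by ring⟩
    · linear_combination (-(h⁻¹ p 0 - x₀)) * (e₀ * e₀ * hl + he₀)
    · linear_combination (-(h⁻¹ p 1 - y₀)) * (e₁ * e₁ * hl + he₁)

theorem exists_forall_le_of_isQuotientMap {A B : Type*} [TopologicalSpace A] [TopologicalSpace B]
    [CompactSpace B] {g : A → B} (hg : IsQuotientMap g) {φ : A → ℝ} (hφ : Continuous φ)
    (h : ∀ s s', g s = g s' → φ s = φ s') : ∃ C, ∀ s, φ s ≤ C := by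
  have h1 : (φ ∘ Function.surjInv hg.surjective) ∘ g = φ :=
    funext fun s => h _ _ (Function.surjInv_eq hg.surjective (g s))
  have h2 : Continuous (φ ∘ Function.surjInv hg.surjective) := by
    rw [hg.continuous_iff, h1]
    exact hφ
  obtain ⟨C, hC⟩ := (isCompact_range h2).bddAbove
  exact ⟨C, fun s => by rw [← h1]; exact hC (mem_range_self _)⟩

/-- The point of Sol with coordinates `u`, `w`, `z` relative to the axis over `(x₀, y₀)`. -/
def axisPoint (x₀ y₀ : ℝ) (p : Sol) : Sol :=
  !₂[x₀ + p 0 * Real.exp (p 2), y₀ + p 1 * Real.exp (-p 2), p 2]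

theorem continuous_axisPoint (x₀ y₀ : ℝ) : Continuous (axisPoint x₀ y₀) := by
  refine (PiLp.continuous_toLp 2 _).comp (continuous_pi fun i => ?_)
  fin_cases i
  · change Continuous fun p : Sol => x₀ + p 0 * Real.exp (p 2)
    fun_prop
  · change Continuous fun p : Sol => y₀ + p 1 * Real.exp (-p 2)
    fun_prop
  · change Continuous fun p : Sol => p 2
    fun_prop

theorem axisPoint_surjective (x₀ y₀ : ℝ) (p : Sol) : axisPoint x₀ y₀
    !₂[(p 0 - x₀) * Real.exp (-p 2), (p 1 - y₀) * Real.exp (p 2), p 2] = p := by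
  have h : Real.exp (-p 2) * Real.exp (p 2) = 1 := by
    rw [← Real.exp_add, neg_add_cancel, Real.exp_zero]
  ext i
  fin_cases i
  · change x₀ + (p 0 - x₀) * Real.exp (-p 2) * Real.exp (p 2) = p 0
    linear_combination (p 0 - x₀) * h
  · change y₀ + (p 1 - y₀) * Real.exp (p 2) * Real.exp (-p 2) = p 1
    linear_combination (p 1 - y₀) * h
  · rfl

/-- The region is a union of four half-spaces, each overlapping the next around the square. -/
theorem isPreconnected_outside_square (C : ℝ) :
    IsPreconnected {p : Sol | C < |p 0| ∨ C < |p 1|} := by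
  have hlin : ∀ (c : ℝ) (i : Fin 3), IsPreconnected {p : Sol | C < c * p i} := fun c i =>
    (convex_halfSpace_gt (f := fun p : Sol => c * p i)
      ⟨fun x y => by simp; ring, fun a x => by simp; ring⟩ C).isPreconnected
  have h1 := (hlin 1 0).union' ⟨!₂[C + 1, C + 1, 0], by simp, by simp⟩ (hlin 1 1)
  have h2 := h1.union' ⟨!₂[-(C + 1), C + 1, 0], by simp, by simp⟩ (hlin (-1) 0)
  have h3 := h2.union' ⟨!₂[-(C + 1), -(C + 1), 0], by simp, by simp⟩ (hlin (-1) 1)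
  convert h3 using 1
  ext p
  simp only [mem_ofPred_eq, mem_union, lt_abs, one_mul, neg_one_mul]
  tauto

section Axis

variable {L : Type*} [TopologicalSpace L] [ChartedSpace (EuclideanSpace ℝ (Fin 3)) L]
  {Γ : Subgroup (Sol ≃ₜ Sol)} {q : Sol → L}
  {S N : Type*} [TopologicalSpace S] [ChartedSpace (EuclideanSpace ℝ (Fin 2)) S]
  [TopologicalSpace N] [ChartedSpace (EuclideanSpace ℝ (Fin 2)) N]
  {H : Subgroup (Sol ≃ₜ Sol)} {g : N → S} {f : S → L} {F : N → Sol}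

/-- A compact surface is two-sided if its deck transformations preserve a vertical axis. -/
theorem IsSurfaceLift.isTwoSided_of_le_axisStabilizer [IsManifold (𝓡 3) ∞ L] [T2Space L]
    [CompactSpace S] (hF : IsSurfaceLift Γ q H g f F) (hq : IsSolQuotient Γ q) {x₀ y₀ : ℝ}
    (hH : H ≤ axisStabilizer x₀ y₀) : IsTwoSided f := by
  obtain ⟨P, hP⟩ := hF.exists_isSide hq
  refine hF.isTwoSided_of_isSide hq hP ?_
  -- The functions u and w are invariant under the axis stabilizer, hence bounded on the lift of a
  -- compact surface: it lies in the tube u, w ≤ C.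
  let u : Sol → ℝ := fun p => |(p 0 - x₀) * Real.exp (-p 2)|
  let w : Sol → ℝ := fun p => |(p 1 - y₀) * Real.exp (p 2)|
  have habs : ∀ e : ℝ, e * e = 1 → |e| = 1 := fun e he => by
    rcases mul_self_eq_one_iff.1 he with rfl | rfl <;> simp
  have hinv : ∀ h ∈ H, ∀ p, u (h p) = u p ∧ w (h p) = w p := by
    intro h hh p
    obtain ⟨e₀, e₁, l, he₀, he₁, hp⟩ := hH hh
    obtain ⟨h1, h2, h3⟩ := hp p
    have hl : Real.exp l * Real.exp (-l) = 1 := by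
      rw [← Real.exp_add, add_neg_cancel, Real.exp_zero]
    constructor
    · change |_| = |_|
      rw [h1, h3, neg_add, Real.exp_add, ← one_mul |(p 0 - x₀) * _|, ← habs e₀ he₀, ← abs_mul]
      congr 1
      linear_combination (e₀ * (p 0 - x₀) * Real.exp (-p 2)) * hl
    · change |_| = |_|
      rw [h2, h3, Real.exp_add, ← one_mul |(p 1 - y₀) * _|, ← habs e₁ he₁, ← abs_mul]
      congr 1
      linear_combination (e₁ * (p 1 - y₀) * Real.exp (p 2)) * hl
  have hquot : IsQuotientMap g := hF.diffeo.isOpenMap.isQuotientMap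
    hF.diffeo.contMDiff.continuous hF.surjective
  have hFc := hF.continuous
  obtain ⟨C₁, hC₁⟩ := exists_forall_le_of_isQuotientMap hquot (φ := fun s => u (F s))
    (by simp only [u]; fun_prop) (fun s s' hs => by
      obtain ⟨h, hh, e⟩ := hF.fiber s s' hs
      rw [e, (hinv h hh _).1])
  obtain ⟨C₂, hC₂⟩ := exists_forall_le_of_isQuotientMap hquot (φ := fun s => w (F s))
    (by simp only [w]; fun_prop) (fun s s' hs => by
      obtain ⟨h, hh, e⟩ := hF.fiber s s' hs
      rw [e, (hinv h hh _).2])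
  set C := max 0 (max C₁ C₂)
  let T : Set Sol := axisPoint x₀ y₀ '' {p : Sol | C < |p 0| ∨ C < |p 1|}
  have hT : IsPreconnected T :=
    (isPreconnected_outside_square C).image _ (continuous_axisPoint x₀ y₀).continuousOn
  have hmem : ∀ p, p ∈ T ↔ C < u p ∨ C < w p := by
    intro p
    constructor
    · rintro ⟨p, hp, rfl⟩
      have h : Real.exp (p 2) * Real.exp (-p 2) = 1 := by
        rw [← Real.exp_add, add_neg_cancel, Real.exp_zero]
      have h1 : u (axisPoint x₀ y₀ p) = |p 0| := by
        change |(x₀ + p 0 * Real.exp (p 2) - x₀) * Real.exp (-p 2)| = _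
        congr 1
        linear_combination (p 0) * h
      have h2 : w (axisPoint x₀ y₀ p) = |p 1| := by
        change |(y₀ + p 1 * Real.exp (-p 2) - y₀) * Real.exp (p 2)| = _
        congr 1
        linear_combination (p 1) * h
      rw [h1, h2]
      exact hp
    · exact fun h => ⟨_, h, axisPoint_surjective x₀ y₀ p⟩
  have hdisj : Disjoint T (range F) := by
    rw [Set.disjoint_left]
    rintro _ h1 ⟨s, rfl⟩
    rcases (hmem _).1 h1 with h2 | h2
    · exact absurd h2 (not_lt.2 ((hC₁ s).trans ((le_max_left _ _).trans (le_max_right _ _))))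
    · exact absurd h2 (not_lt.2 ((hC₂ s).trans ((le_max_right _ _).trans (le_max_right _ _))))
  -- A test point outside the tube. Each h ∈ H keeps it in the connected set T, which misses the
  -- surface and so lies on one side.
  have hp₀ : axisPoint x₀ y₀ !₂[C + 1, 0, 0] ∈ T :=
    ⟨_, Or.inl (lt_of_lt_of_le (lt_add_one C) (le_abs_self _)), rfl⟩
  intro h hh
  refine hF.side_invariant hq hP hh (Set.disjoint_left.1 hdisj hp₀)
    (hP.mem_iff_of_isPreconnected hT hdisj ?_ hp₀)
  rw [hmem, (hinv h hh _).1, (hinv h hh _).2, ← hmem]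
  exact hp₀

end Axis

/-! ### Cocompact groups of isometries -/

theorem IsStraight.ext_apply {Φ : Sol → Sol} {e₀ e₁ l a b : ℝ} (h : IsStraight Φ e₀ e₁ l a b)
    {p p' : Sol} (h0 : p' 0 = e₀ * Real.exp l * p 0 + a) (h1 : p' 1 = e₁ * Real.exp (-l) * p 1 + b)
    (h2 : p' 2 = p 2 + l) : Φ p = p' := by
  obtain ⟨k0, k1, k2⟩ := h p
  ext i
  fin_cases i
  · exact k0.trans h0.symm
  · exact k1.trans h1.symm
  · exact k2.trans h2.symm

theorem abs_mul_exp_eq {e : ℝ} (he : e * e = 1) (l : ℝ) : |e * Real.exp l| = Real.exp l := by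
  rw [abs_mul, Real.abs_exp]
  rcases mul_self_eq_one_iff.1 he with rfl | rfl <;> simp

theorem mul_exp_ne_one {e l : ℝ} (he : e * e = 1) (hl : l ≠ 0) : e * Real.exp l ≠ 1 := by
  intro h
  have h1 := abs_mul_exp_eq he l
  rw [h, abs_one, eq_comm, Real.exp_eq_one_iff] at h1
  exact hl h1

theorem exists_isStraight_of_apply_two {h : Sol ≃ₜ Sol} (hh : h ∈ solIsometryGroup) {k : ℝ}
    (hk : ∀ p, h p 2 = p 2 + k) :
    ∃ e₀ e₁ a b : ℝ, e₀ * e₀ = 1 ∧ e₁ * e₁ = 1 ∧ IsStraight h e₀ e₁ k a b := by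
  obtain ⟨e₀, e₁, l, a, b, he₀, he₁, hs | hs⟩ := isStraight_or_isSwap hh
  · have h1 := (hs 0).2.2
    rw [hk] at h1
    obtain rfl : k = l := add_left_cancel h1
    exact ⟨e₀, e₁, a, b, he₀, he₁, hs⟩
  · have h1 := (hs 0).2.2
    have h2 := (hs !₂[0, 0, 1]).2.2
    rw [hk] at h1 h2
    simp at h1 h2
    linarith

theorem IsStraight.mem_axisStabilizer {h : Sol ≃ₜ Sol} {e₀ e₁ l a b x₀ y₀ : ℝ}
    (hs : IsStraight h e₀ e₁ l a b) (he₀ : e₀ * e₀ = 1) (he₁ : e₁ * e₁ = 1)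
    (hx : e₀ * Real.exp l * x₀ + a = x₀) (hy : e₁ * Real.exp (-l) * y₀ + b = y₀) :
    h ∈ axisStabilizer x₀ y₀ := by
  refine ⟨e₀, e₁, l, he₀, he₁, fun p => ?_⟩
  obtain ⟨h0, h1, h2⟩ := hs p
  exact ⟨by rw [h0]; linear_combination hx, by rw [h1]; linear_combination hy, h2⟩

/-- The isometries which commute with a hyperbolic isometry preserve its axis. -/
theorem IsStraight.exists_axis {h : Sol ≃ₜ Sol} {e₀ e₁ l a b : ℝ}
    (hs : IsStraight h e₀ e₁ l a b) (he₀ : e₀ * e₀ = 1) (he₁ : e₁ * e₁ = 1) (hl : l ≠ 0) :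
    ∃ x₀ y₀, h ∈ axisStabilizer x₀ y₀ ∧
      ∀ k ∈ solIsometryGroup, k * h = h * k → k ∈ axisStabilizer x₀ y₀ := by
  have hn0 : 1 - e₀ * Real.exp l ≠ 0 := sub_ne_zero.2 (mul_exp_ne_one he₀ hl).symm
  have hn1 : 1 - e₁ * Real.exp (-l) ≠ 0 :=
    sub_ne_zero.2 (mul_exp_ne_one he₁ (neg_ne_zero.2 hl)).symm
  -- As l ≠ 0, the affine actions on x and on y have multipliers different from 1 and hence fixed
  -- points: the axis of h.
  obtain ⟨x₀, hx⟩ : ∃ x₀, e₀ * Real.exp l * x₀ + a = x₀ :=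
    ⟨a / (1 - e₀ * Real.exp l), by field_simp; ring⟩
  obtain ⟨y₀, hy⟩ : ∃ y₀, e₁ * Real.exp (-l) * y₀ + b = y₀ :=
    ⟨b / (1 - e₁ * Real.exp (-l)), by field_simp; ring⟩
  refine ⟨x₀, y₀, hs.mem_axisStabilizer he₀ he₁ hx hy, fun k hk hkh => ?_⟩
  have hcomm : ∀ p, k (h p) = h (k p) := fun p => congrArg (fun φ : Sol ≃ₜ Sol => φ p) hkh
  obtain ⟨d₀, d₁, m, c, d, hd₀, hd₁, ht | ht⟩ := isStraight_or_isSwap hk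
  · have h1 := hcomm !₂[x₀, y₀, 0]
    have h2 := (ht (h !₂[x₀, y₀, 0])).1
    have h3 := (ht (h !₂[x₀, y₀, 0])).2.1
    have hp : h !₂[x₀, y₀, 0] = !₂[x₀, y₀, l] := hs.ext_apply hx.symm hy.symm (zero_add l).symm
    rw [h1, (hs _).1, (ht _).1, hp] at h2
    rw [h1, (hs _).2.1, (ht _).2.1, hp] at h3
    have h2 : e₀ * Real.exp l * (d₀ * Real.exp m * x₀ + c) + a = d₀ * Real.exp m * x₀ + c := h2
    have h3 : e₁ * Real.exp (-l) * (d₁ * Real.exp (-m) * y₀ + d) + b = d₁ * Real.exp (-m) * y₀ + d :=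
      h3
    refine ht.mem_axisStabilizer hd₀ hd₁ (mul_left_cancel₀ hn0 ?_) (mul_left_cancel₀ hn1 ?_)
    · linear_combination hx - h2
    · linear_combination hy - h3
  -- A swap reflects heights, so commuting with the shift by l would give l = -l.
  · have h1 := congrArg (fun p : Sol => p 2) (hcomm 0)
    simp only [(ht _).2.2, (hs _).2.2] at h1
    exact absurd (by linarith) hl

theorem IsStraight.det_fderiv {h : Sol ≃ₜ Sol} (hh : h ∈ solIsometryGroup) {e₀ e₁ l a b : ℝ}
    (hs : IsStraight h e₀ e₁ l a b) (p : Sol) : (fderiv ℝ h p).det = e₀ * e₁ := by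
  have hd : ∀ (c d : ℝ) (i : Fin 3) (v : Sol), fderiv ℝ (fun p : Sol => c * p i + d) p v = c * v i :=
    fun c d i v => by
      have := (((EuclideanSpace.proj i : Sol →L[ℝ] ℝ).hasFDerivAt (x := p)).const_mul c).add_const d
      exact congrArg (fun T : Sol →L[ℝ] ℝ => T v) this.fderiv
  have h0 : ∀ v, fderiv ℝ h p v 0 = e₀ * Real.exp l * v 0 := fun v => by
    rw [← fderiv_apply_coord hh.1, ← hd (e₀ * Real.exp l) a, funext fun p => (hs p).1]
  have h1 : ∀ v, fderiv ℝ h p v 1 = e₁ * Real.exp (-l) * v 1 := fun v => by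
    rw [← fderiv_apply_coord hh.1, ← hd (e₁ * Real.exp (-l)) b, funext fun p => (hs p).2.1]
  have h2 : ∀ v, fderiv ℝ h p v 2 = 1 * v 2 := fun v => by
    rw [← fderiv_apply_coord hh.1, ← hd 1 l, funext fun p => (hs p).2.2]
    simp only [one_mul]
  have hl : Real.exp l * Real.exp (-l) = 1 := by rw [← Real.exp_add, add_neg_cancel, Real.exp_zero]
  rw [ContinuousLinearMap.det, ← LinearMap.det_toMatrix (EuclideanSpace.basisFun (Fin 3) ℝ).toBasis,
    Matrix.det_fin_three]
  simp [LinearMap.toMatrix_apply, h0, h1, h2]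
  linear_combination (e₀ * e₁) * hl

theorem IsSwap.det_fderiv {h : Sol ≃ₜ Sol} (hh : h ∈ solIsometryGroup) {e₀ e₁ l a b : ℝ}
    (hs : IsSwap h e₀ e₁ l a b) (p : Sol) : (fderiv ℝ h p).det = e₀ * e₁ := by
  have hd : ∀ (c d : ℝ) (i : Fin 3) (v : Sol), fderiv ℝ (fun p : Sol => c * p i + d) p v = c * v i :=
    fun c d i v => by
      have := (((EuclideanSpace.proj i : Sol →L[ℝ] ℝ).hasFDerivAt (x := p)).const_mul c).add_const d
      exact congrArg (fun T : Sol →L[ℝ] ℝ => T v) this.fderiv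
  have h0 : ∀ v, fderiv ℝ h p v 0 = e₀ * Real.exp l * v 1 := fun v => by
    rw [← fderiv_apply_coord hh.1, ← hd (e₀ * Real.exp l) a, funext fun p => (hs p).1]
  have h1 : ∀ v, fderiv ℝ h p v 1 = e₁ * Real.exp (-l) * v 0 := fun v => by
    rw [← fderiv_apply_coord hh.1, ← hd (e₁ * Real.exp (-l)) b, funext fun p => (hs p).2.1]
  have h2 : ∀ v, fderiv ℝ h p v 2 = -1 * v 2 := fun v => by
    rw [← fderiv_apply_coord hh.1, ← hd (-1) l, funext fun p => (hs p).2.2]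
    simp only [neg_one_mul]
  have hl : Real.exp l * Real.exp (-l) = 1 := by rw [← Real.exp_add, add_neg_cancel, Real.exp_zero]
  rw [ContinuousLinearMap.det, ← LinearMap.det_toMatrix (EuclideanSpace.basisFun (Fin 3) ℝ).toBasis,
    Matrix.det_fin_three]
  simp [LinearMap.toMatrix_apply, h0, h1, h2]
  linear_combination (e₀ * e₁) * hl

theorem ContinuousLinearMap.det_comp {E : Type*} [NormedAddCommGroup E] [NormedSpace ℝ E]
    (A B : E →L[ℝ] E) : (A.comp B).det = A.det * B.det :=
  LinearMap.det_comp (A : E →ₗ[ℝ] E) (B : E →ₗ[ℝ] E)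

theorem EuclideanSpace.single_eq_smul (i : Fin 3) (t : ℝ) :
    EuclideanSpace.single i t = t • EuclideanSpace.single i (1 : ℝ) := by
  ext j
  simp

theorem EuclideanSpace.single_eq_zero (i : Fin 3) : EuclideanSpace.single i (0 : ℝ) = 0 := by
  rw [EuclideanSpace.single_eq_smul, zero_smul]

/-- The orientation preserving isometries of Sol. -/
def solOrientationSubgroup : Subgroup (Sol ≃ₜ Sol) where
  carrier := {h | h ∈ solIsometryGroup ∧ ∀ p, (fderiv ℝ h p).det = 1}
  one_mem' := ⟨one_mem _, fun p => by
    rw [show fderiv ℝ ((1 : Sol ≃ₜ Sol) : Sol → Sol) p = ContinuousLinearMap.id ℝ Sol from fderiv_id]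
    exact LinearMap.det_id⟩
  mul_mem' := by
    rintro h k ⟨hh, hh'⟩ ⟨hk, hk'⟩
    refine ⟨mul_mem hh hk, fun p => ?_⟩
    have h1 : fderiv ℝ ((h * k : Sol ≃ₜ Sol) : Sol → Sol) p =
        (fderiv ℝ h (k p)).comp (fderiv ℝ k p) :=
      fderiv_comp p (hh.1.differentiable (by simp) _) (hk.1.differentiable (by simp) _)
    rw [h1, ContinuousLinearMap.det_comp, hh', hk', one_mul]
  inv_mem' := by
    rintro h ⟨hh, hh'⟩
    refine ⟨inv_mem hh, fun p => ?_⟩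
    have h1 := fderiv_comp p (g := h) (f := h.symm) (hh.1.differentiable (by simp) _)
      (hh.2.1.differentiable (by simp) _)
    rw [show (h ∘ h.symm : Sol → Sol) = id by ext x; simp, fderiv_id] at h1
    have h2 := congrArg ContinuousLinearMap.det h1
    rw [ContinuousLinearMap.det_comp, hh', one_mul] at h2
    exact h2.symm.trans LinearMap.det_id

theorem mul_eq_one_or_neg_one {e₀ e₁ : ℝ} (he₀ : e₀ * e₀ = 1) (he₁ : e₁ * e₁ = 1) :
    e₀ * e₁ = 1 ∨ e₀ * e₁ = -1 :=
  mul_self_eq_one_iff.1 (by linear_combination he₀ * e₁ * e₁ + he₁)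

section Lattice

variable {L : Type*} [TopologicalSpace L] [ChartedSpace (EuclideanSpace ℝ (Fin 3)) L]
  {Γ : Subgroup (Sol ≃ₜ Sol)} {q : Sol → L}

/-- Otherwise straight elements fix the height and all swaps reflect it in a common level m / 2, so
|z - m / 2| descends to the compact L and is bounded, which is absurd. -/
theorem IsSolQuotient.exists_isStraight_ne_zero [CompactSpace L] (hq : IsSolQuotient Γ q) :
    ∃ η ∈ Γ, ∃ e₀ e₁ l a b : ℝ, e₀ * e₀ = 1 ∧ e₁ * e₁ = 1 ∧ l ≠ 0 ∧
      IsStraight η e₀ e₁ l a b := by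
  by_contra! hno
  have hquot : IsQuotientMap q := hq.isOpenMap.isQuotientMap hq.continuous hq.surjective
  have hz : ∀ η ∈ Γ, ∀ k, (∀ p, η p 2 = p 2 + k) → k = 0 := by
    intro η hη k hk
    obtain ⟨e₀, e₁, a, b, he₀, he₁, hs⟩ := exists_isStraight_of_apply_two (hq.isometry hη) hk
    by_contra h0
    exact hno η hη e₀ e₁ k a b he₀ he₁ h0 hs
  obtain ⟨m, hm⟩ : ∃ m : ℝ, ∀ γ ∈ Γ, ∀ p, |γ p 2 - m / 2| = |p 2 - m / 2| := by
    by_cases hswap : ∃ σ ∈ Γ, ∃ m, ∀ p, σ p 2 = -p 2 + m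
    · obtain ⟨σ, hσ, m, hm⟩ := hswap
      refine ⟨m, fun γ hγ p => ?_⟩
      obtain ⟨e₀, e₁, l, a, b, -, -, hs | hs⟩ := isStraight_or_isSwap (hq.isometry hγ)
      · rw [(hs p).2.2, hz γ hγ l fun p => (hs p).2.2, add_zero]
      · have h1 := hz (γ * σ) (mul_mem hγ hσ) (l - m) fun p => by
          simp only [Homeomorph.mul_apply]
          rw [(hs _).2.2, hm]
          ring
        rw [(hs p).2.2, sub_eq_zero.1 h1, ← abs_neg]
        congr 1
        ring
    · refine ⟨0, fun γ hγ p => ?_⟩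
      obtain ⟨e₀, e₁, l, a, b, -, -, hs | hs⟩ := isStraight_or_isSwap (hq.isometry hγ)
      · rw [(hs p).2.2, hz γ hγ l fun p => (hs p).2.2, add_zero]
      · exact absurd ⟨γ, hγ, l, fun p => (hs p).2.2⟩ hswap
  obtain ⟨C, hC⟩ := exists_forall_le_of_isQuotientMap hquot (φ := fun p => |p 2 - m / 2|)
    (by fun_prop) (fun p p' h => by
      obtain ⟨γ, hγ, rfl⟩ := (hq.fiber _ _).1 h
      exact (hm γ hγ p).symm)
  have := (le_abs_self _).trans (hC !₂[0, 0, m / 2 + C + 1])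
  change m / 2 + C + 1 - m / 2 ≤ C at this
  linarith

/-- Conjugating τ by powers of η gives translations by r ^ n * c in Γ. They tend to zero, while q is
injective near 0. -/
theorem IsSolQuotient.eq_zero_of_contracting (hq : IsSolQuotient Γ q) {i : Fin 3} {η : Sol ≃ₜ Sol}
    (hη : η ∈ Γ) {r : ℝ} (hr : |r| < 1)
    (h : ∀ p c, η (p + EuclideanSpace.single i c) = η p + EuclideanSpace.single i (r * c))
    {τ : Sol ≃ₜ Sol} (hτ : τ ∈ Γ) {c : ℝ} (hc : ∀ p, τ p = p + EuclideanSpace.single i c) :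
    c = 0 := by
  have hn : ∀ n : ℕ, ∃ δ ∈ Γ, ∀ p, δ p = p + EuclideanSpace.single i (r ^ n * c) := by
    intro n
    induction n with
    | zero => exact ⟨τ, hτ, by simpa using hc⟩
    | succ n ih =>
      obtain ⟨δ, hδ, e⟩ := ih
      refine ⟨η * δ * η⁻¹, mul_mem (mul_mem hη hδ) (inv_mem hη), fun p => ?_⟩
      change η (δ (η.symm p)) = _
      rw [e, h, η.apply_symm_apply, pow_succ', mul_assoc]
  by_contra h0
  rcases eq_or_ne r 0 with rfl | hr0
  · have h1 := h 0 c
    rw [zero_mul, EuclideanSpace.single_eq_zero, add_zero] at h1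
    have h2 := congrArg (fun p : Sol => p i) (η.injective h1)
    simp at h2
    exact h0 h2
  obtain ⟨U, hU, h0U, hinj⟩ := hq.exists_injOn 0
  have hlim : Filter.Tendsto (fun n : ℕ => (0 : Sol) + EuclideanSpace.single i (r ^ n * c))
      Filter.atTop (𝓝 0) := by
    have h1 := (tendsto_pow_atTop_nhds_zero_of_abs_lt_one hr).mul_const c
    have h2 : Continuous fun t : ℝ => (0 : Sol) + EuclideanSpace.single i t := by
      rw [show (fun t : ℝ => (0 : Sol) + EuclideanSpace.single i t) = fun t : ℝ =>
        (0 : Sol) + t • EuclideanSpace.single i (1 : ℝ) from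
          funext fun t => by rw [EuclideanSpace.single_eq_smul i t]]
      fun_prop
    have h3 := (h2.tendsto _).comp h1
    rwa [zero_mul, EuclideanSpace.single_eq_zero, add_zero] at h3
  obtain ⟨n, hnU⟩ := (hlim.eventually (hU.mem_nhds h0U)).exists
  obtain ⟨δ, hδ, e⟩ := hn n
  rw [← e] at hnU
  have h1 := hinj hnU h0U (hq.apply_eq hδ 0)
  rw [e, zero_add] at h1
  have h2 := congrArg (fun p : Sol => p i) h1
  simp at h2
  exact h2.elim (fun h => hr0 h.1) h0

/-- An element of Γ with nonzero height shift, or its inverse, contracts the given horizontal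
direction. -/
theorem IsSolQuotient.eq_zero_of_translation [CompactSpace L] (hq : IsSolQuotient Γ q) {i : Fin 3}
    (hi : i = 0 ∨ i = 1) {τ : Sol ≃ₜ Sol} (hτ : τ ∈ Γ) {c : ℝ}
    (hc : ∀ p, τ p = p + EuclideanSpace.single i c) : c = 0 := by
  obtain ⟨η, hη, e₀, e₁, l, a, b, he₀, he₁, hl, hs⟩ := hq.exists_isStraight_ne_zero
  obtain ⟨r, hr1, h⟩ : ∃ r : ℝ, |r| ≠ 1 ∧
      ∀ p c, η (p + EuclideanSpace.single i c) = η p + EuclideanSpace.single i (r * c) := by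
    rcases hi with rfl | rfl
    · refine ⟨e₀ * Real.exp l, by rwa [abs_mul_exp_eq he₀, Ne, Real.exp_eq_one_iff], fun p c => ?_⟩
      refine hs.ext_apply ?_ ?_ ?_ <;> simp [(hs p).1, (hs p).2.1, (hs p).2.2]
      ring
    · refine ⟨e₁ * Real.exp (-l),
        by rwa [abs_mul_exp_eq he₁, Ne, Real.exp_eq_one_iff, neg_eq_zero], fun p c => ?_⟩
      refine hs.ext_apply ?_ ?_ ?_ <;> simp [(hs p).1, (hs p).2.1, (hs p).2.2]
      ring
  rcases lt_or_gt_of_ne hr1 with h1 | h1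
  · exact hq.eq_zero_of_contracting hη h1 h hτ hc
  · have hr0 : r ≠ 0 := by rintro rfl; simp at h1; linarith
    refine hq.eq_zero_of_contracting (inv_mem hη) (r := r⁻¹)
      (by rw [abs_inv]; exact inv_lt_one_of_one_lt₀ h1) (fun p c => ?_) hτ hc
    apply η.injective
    rw [h, mul_inv_cancel_left₀ hr0]
    change η (η.symm _) = η (η.symm _) + _
    rw [η.apply_symm_apply, η.apply_symm_apply]

/-- The elements of a cocompact group acting freely which preserve the height are translations. -/
theorem IsSolQuotient.eq_one_of_isStraight_zero [CompactSpace L] (hq : IsSolQuotient Γ q)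
    {γ : Sol ≃ₜ Sol} (hγ : γ ∈ Γ) {e₀ e₁ a b : ℝ} (he₀ : e₀ * e₀ = 1) (he₁ : e₁ * e₁ = 1)
    (hs : IsStraight γ e₀ e₁ 0 a b) : e₀ = 1 ∧ e₁ = 1 := by
  -- A coordinate with sign -1 contributes nothing to γ². With mixed signs γ² is therefore a
  -- translation along one axis, hence trivial, and this produces a fixed point of γ.
  have hsq : ∀ p, (γ * γ) p = p + EuclideanSpace.single 0 (e₀ * a + a) +
      EuclideanSpace.single 1 (e₁ * b + b) := by
    intro p
    refine hs.ext_apply ?_ ?_ ?_ <;> simp [(hs p).1, (hs p).2.1, (hs p).2.2]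
    · linear_combination (-p 0) * he₀
    · linear_combination (-p 1) * he₁
  have hfix : ∀ p : Sol, e₀ * p 0 + a = p 0 → e₁ * p 1 + b = p 1 → e₀ = 1 ∧ e₁ = 1 := by
    intro p h0 h1
    have h2 := hq.free γ hγ p (hs.ext_apply (by simp [h0]) (by simp [h1]) (by simp))
    subst h2
    have k0 := (hs 0).1
    have k0' := (hs !₂[1, 0, 0]).1
    have k1 := (hs 0).2.1
    have k1' := (hs !₂[0, 1, 0]).2.1
    simp at k0 k0' k1 k1'
    exact ⟨by linarith, by linarith⟩
  rcases mul_self_eq_one_iff.1 he₀ with rfl | rfl <;> rcases mul_self_eq_one_iff.1 he₁ with rfl | rfl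
  · exact ⟨rfl, rfl⟩
  · have h1 := hq.eq_zero_of_translation (Or.inl rfl) (mul_mem hγ hγ) fun p => by
      rw [hsq, show -1 * b + b = 0 by ring, EuclideanSpace.single_eq_zero, add_zero]
    exact hfix !₂[0, b / 2, 0] (by simp; linarith) (by simp; ring)
  · have h1 := hq.eq_zero_of_translation (Or.inr rfl) (mul_mem hγ hγ) fun p => by
      rw [hsq, show -1 * a + a = 0 by ring, EuclideanSpace.single_eq_zero, add_zero]
    exact hfix !₂[a / 2, 0, 0] (by simp; ring) (by simp; linarith)
  · exact hfix !₂[a / 2, b / 2, 0] (by simp; ring) (by simp; ring)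

/-- The orientation reversing elements of a cocompact group acting freely are hyperbolic. -/
theorem IsSolQuotient.exists_isStraight_of_notMem [CompactSpace L] (hq : IsSolQuotient Γ q)
    {γ : Sol ≃ₜ Sol} (hγ : γ ∈ Γ) (h : γ ∉ solOrientationSubgroup) :
    ∃ e₀ e₁ l a b : ℝ, e₀ * e₀ = 1 ∧ e₁ * e₁ = 1 ∧ e₀ * e₁ = -1 ∧ l ≠ 0 ∧
      IsStraight γ e₀ e₁ l a b := by
  have hγi := hq.isometry hγ
  obtain ⟨e₀, e₁, l, a, b, he₀, he₁, hs | hs⟩ := isStraight_or_isSwap hγi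
  · have hneg : e₀ * e₁ = -1 := (mul_eq_one_or_neg_one he₀ he₁).resolve_left fun h1 =>
      h ⟨hγi, fun p => by rw [hs.det_fderiv hγi, h1]⟩
    refine ⟨e₀, e₁, l, a, b, he₀, he₁, hneg, ?_, hs⟩
    rintro rfl
    obtain ⟨rfl, rfl⟩ := hq.eq_one_of_isStraight_zero hγ he₀ he₁ hs
    norm_num at hneg
  · have hneg : e₀ * e₁ = -1 := (mul_eq_one_or_neg_one he₀ he₁).resolve_left fun h1 =>
      h ⟨hγi, fun p => by rw [hs.det_fderiv hγi, h1]⟩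
    -- With e₀ * e₁ = -1, substituting the y-equation of a swap into its x-equation gives x ↦ -x +
    -- e₀ exp(l) b + a. Its fixed value, with height l / 2, yields a fixed point, so γ = 1, which
    -- does not reflect heights.
    exfalso
    have hl : Real.exp l * Real.exp (-l) = 1 := by
      rw [← Real.exp_add, add_neg_cancel, Real.exp_zero]
    obtain ⟨x, hx⟩ : ∃ x, x = (e₀ * Real.exp l * b + a) / 2 := ⟨_, rfl⟩
    obtain ⟨k0, k1, k2⟩ := hs !₂[x, e₁ * Real.exp (-l) * x + b, l / 2]
    simp at k0 k1 k2
    have := hq.free γ hγ !₂[x, e₁ * Real.exp (-l) * x + b, l / 2] (by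
      ext i
      fin_cases i
      · change γ _ 0 = x
        rw [k0]
        linear_combination (x * hl * (e₀ * e₁)) + x * hneg - 2 * hx
      · exact k1
      · change γ _ 2 = l / 2
        rw [k2]
        ring)
    subst this
    have h1 := (hs 0).2.2
    have h2 := (hs !₂[0, 0, 1]).2.2
    simp at h1 h2
    linarith

end Lattice

/-! ### Surfaces covered by the plane -/

/-- The deck transformation `(s, t) ↦ (s + 1, ε t)` of the plane. -/
def planeGlide (ε : ℝ) (hε : ε * ε = 1) : EuclideanSpace ℝ (Fin 2) ≃ₜ EuclideanSpace ℝ (Fin 2) where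
  toFun s := !₂[s 0 + 1, ε * s 1]
  invFun s := !₂[s 0 - 1, ε * s 1]
  left_inv s := by ext i; fin_cases i <;> simp [← mul_assoc, hε]
  right_inv s := by ext i; fin_cases i <;> simp [← mul_assoc, hε]
  continuous_toFun := (PiLp.continuous_toLp 2 _).comp (continuous_pi fun i => by
    fin_cases i
    · change Continuous fun s : EuclideanSpace ℝ (Fin 2) => s 0 + 1
      fun_prop
    · change Continuous fun s : EuclideanSpace ℝ (Fin 2) => ε * s 1
      fun_prop)
  continuous_invFun := (PiLp.continuous_toLp 2 _).comp (continuous_pi fun i => by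
    fin_cases i
    · change Continuous fun s : EuclideanSpace ℝ (Fin 2) => s 0 - 1
      fun_prop
    · change Continuous fun s : EuclideanSpace ℝ (Fin 2) => ε * s 1
      fun_prop)

/-- The deck transformation `(s, t) ↦ (s, t + 1)` of the plane. -/
def planeShift : EuclideanSpace ℝ (Fin 2) ≃ₜ EuclideanSpace ℝ (Fin 2) :=
  Homeomorph.addRight !₂[0, 1]

theorem planeGlide_zpow {ε : ℝ} (hε : ε * ε = 1) (m : ℤ) (s : EuclideanSpace ℝ (Fin 2)) :
    (planeGlide ε hε ^ m) s = !₂[s 0 + m, ε ^ m * s 1] := by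
  have hε0 : ε ≠ 0 := by rintro rfl; simp at hε
  have hinv : ε⁻¹ = ε := inv_eq_of_mul_eq_one_left hε
  induction m generalizing s with
  | zero => ext i; fin_cases i <;> simp
  | succ m ih =>
    rw [zpow_add_one, Homeomorph.mul_apply, ih, zpow_add_one₀ hε0]
    ext i
    fin_cases i
    · change s 0 + 1 + _ = s 0 + _
      push_cast
      ring
    · exact (mul_assoc _ _ _).symm
  | pred m ih =>
    rw [zpow_sub_one, Homeomorph.mul_apply, ih, zpow_sub_one₀ hε0, hinv]
    ext i
    fin_cases i
    · change s 0 - 1 + _ = s 0 + _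
      push_cast
      ring
    · exact (mul_assoc _ _ _).symm

theorem planeShift_zpow (n : ℤ) (s : EuclideanSpace ℝ (Fin 2)) :
    (planeShift ^ n) s = !₂[s 0, s 1 + n] := by
  induction n generalizing s with
  | zero => ext i; fin_cases i <;> simp
  | succ m ih =>
    rw [zpow_add_one, Homeomorph.mul_apply, ih]
    ext i
    fin_cases i
    · exact add_zero _
    · change s 1 + 1 + _ = s 1 + _
      push_cast
      ring
  | pred m ih =>
    rw [zpow_sub_one, Homeomorph.mul_apply, ih]
    ext i
    fin_cases i
    · change s 0 + -0 = s 0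
      simp
    · change s 1 + -1 + _ = s 1 + _
      push_cast
      ring

/-- The pairs of homeomorphisms of `N` and `Sol` which are intertwined by `F`. -/
def intertwiners {N : Type*} [TopologicalSpace N] (F : N → Sol) :
    Subgroup ((N ≃ₜ N) × (Sol ≃ₜ Sol)) where
  carrier := {D | ∀ s, F (D.1 s) = D.2 (F s)}
  one_mem' := fun _ => rfl
  mul_mem' := fun {C D} hC hD s => (hC (D.1 s)).trans (congrArg C.2 (hD s))
  inv_mem' := fun {D} hD s => by
    apply D.2.injective
    rw [← hD]
    exact (congrArg F (D.1.apply_symm_apply s)).trans (D.2.apply_symm_apply (F s)).symm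

section Stabilizer

variable {L : Type*} [TopologicalSpace L] [ChartedSpace (EuclideanSpace ℝ (Fin 3)) L]
  {Γ : Subgroup (Sol ≃ₜ Sol)} {q : Sol → L}
  {S N : Type*} [TopologicalSpace S] [ChartedSpace (EuclideanSpace ℝ (Fin 2)) S]
  [TopologicalSpace N] [ChartedSpace (EuclideanSpace ℝ (Fin 2)) N]
  {g : N → S} {f : S → L} {F : N → Sol}

/-- The elements of `Γ` which preserve the range of `F`. -/
def rangeStabilizer (Γ : Subgroup (Sol ≃ₜ Sol)) (F : N → Sol) : Subgroup (Sol ≃ₜ Sol) where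
  carrier := {h | h ∈ Γ ∧ ∀ p, h p ∈ range F ↔ p ∈ range F}
  one_mem' := ⟨one_mem _, fun _ => Iff.rfl⟩
  mul_mem' := fun {h k} hh hk => ⟨mul_mem hh.1 hk.1, fun p => (hh.2 (k p)).trans (hk.2 p)⟩
  inv_mem' := fun {h} hh => ⟨inv_mem hh.1, fun p => by
    rw [← hh.2, show h (h⁻¹ p) = p from h.apply_symm_apply p]⟩

/-- For a deck homeomorphism D of g, both F and F ∘ D lift f ∘ g, so they differ by an element of Γ
preserving the range. Conversely, injectivity of f keeps elements of the stabilizer within the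
fibres of g. -/
theorem IsSolQuotient.isSurfaceLift (hq : IsSolQuotient Γ q) [ConnectedSpace N]
    (hg : IsLocalDiffeomorph (𝓡 2) (𝓡 2) ∞ g) (hgs : Function.Surjective g)
    (hf : IsSmoothEmbedding (𝓡 2) (𝓡 3) ∞ f) (hF : Continuous F) (hlift : ∀ s, q (F s) = f (g s))
    (hdeck : ∀ s s', g s = g s' → ∃ D : N ≃ₜ N, (∀ x, g (D x) = g x) ∧ D s = s') :
    IsSurfaceLift Γ q (rangeStabilizer Γ F) g f F where
  le _ hh := hh.1
  diffeo := hg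
  surjective := hgs
  embedding := hf
  continuous := hF
  lift := hlift
  fiber s s' h := by
    obtain ⟨D, hD, rfl⟩ := hdeck s s' h
    obtain ⟨γ, hγ, e⟩ := hq.exists_deck hF (hF.comp D.continuous) fun x => by
      simp only [Function.comp_apply]
      rw [hlift, hlift, hD]
    have e : ∀ x, F (D x) = γ (F x) := e
    refine ⟨γ, ⟨hγ, fun p => ⟨?_, ?_⟩⟩, e s⟩
    · rintro ⟨x, hx⟩
      refine ⟨D.symm x, γ.injective ?_⟩
      rw [← e, D.apply_symm_apply, hx]
    · rintro ⟨x, rfl⟩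
      exact ⟨D x, e x⟩
  invariant h hh s := by
    obtain ⟨s', hs'⟩ := (hh.2 (F s)).2 (mem_range_self s)
    refine ⟨s', hf.isEmbedding.injective ?_, hs'⟩
    rw [← hlift, ← hlift, hs', hq.apply_eq hh.1]

end Stabilizer

theorem isCompact_unitSquare :
    IsCompact {s : EuclideanSpace ℝ (Fin 2) | s 0 ∈ Icc (0 : ℝ) 1 ∧ s 1 ∈ Icc (0 : ℝ) 1} := by
  have h1 : Continuous fun x : ℝ × ℝ => (!₂[x.1, x.2] : EuclideanSpace ℝ (Fin 2)) :=
    (PiLp.continuous_toLp 2 _).comp (continuous_pi fun i => by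
      fin_cases i
      · exact continuous_fst
      · exact continuous_snd)
  convert (isCompact_Icc (a := (0 : ℝ)) (b := 1)).prod (isCompact_Icc (a := (0 : ℝ)) (b := 1))
    |>.image h1 using 1
  ext s
  constructor
  · rintro ⟨h0, h1⟩
    exact ⟨(s 0, s 1), ⟨h0, h1⟩, by ext i; fin_cases i <;> rfl⟩
  · rintro ⟨x, hx, rfl⟩
    exact hx

theorem exists_mem_unitSquare {S : Type*} {g : EuclideanSpace ℝ (Fin 2) → S} {ε : ℝ}
    (hfib : ∀ x y : EuclideanSpace ℝ (Fin 2), g x = g y ↔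
      ∃ m n : ℤ, y 0 = x 0 + (m : ℝ) ∧ y 1 = ε ^ m * x 1 + (n : ℝ))
    (s : EuclideanSpace ℝ (Fin 2)) :
    ∃ s' : EuclideanSpace ℝ (Fin 2), (s' 0 ∈ Icc (0 : ℝ) 1 ∧ s' 1 ∈ Icc (0 : ℝ) 1) ∧ g s' = g s := by
  have hfl : ∀ x : ℝ, x + ((-⌊x⌋ : ℤ) : ℝ) ∈ Icc (0 : ℝ) 1 := fun x => by
    push_cast
    rw [← sub_eq_add_neg]
    exact ⟨Int.fract_nonneg x, (Int.fract_lt_one x).le⟩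
  refine ⟨!₂[s 0 + ((-⌊s 0⌋ : ℤ) : ℝ), ε ^ (-⌊s 0⌋) * s 1 + ((-⌊ε ^ (-⌊s 0⌋) * s 1⌋ : ℤ) : ℝ)],
    ⟨hfl _, hfl _⟩, ?_⟩
  rw [eq_comm, hfib]
  exact ⟨_, _, rfl, rfl⟩

theorem compactSpace_of_plane {S : Type*} [TopologicalSpace S]
    {g : EuclideanSpace ℝ (Fin 2) → S} {ε : ℝ} (hg : Continuous g) (hgs : Function.Surjective g)
    (hfib : ∀ x y : EuclideanSpace ℝ (Fin 2), g x = g y ↔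
      ∃ m n : ℤ, y 0 = x 0 + (m : ℝ) ∧ y 1 = ε ^ m * x 1 + (n : ℝ)) : CompactSpace S := by
  refine ⟨?_⟩
  convert isCompact_unitSquare.image hg
  refine (eq_univ_of_forall fun x => ?_).symm
  obtain ⟨s, rfl⟩ := hgs x
  obtain ⟨s', h1, h2⟩ := exists_mem_unitSquare hfib s
  exact ⟨s', h1, h2⟩

section Plane

variable {L : Type*} [TopologicalSpace L] [ChartedSpace (EuclideanSpace ℝ (Fin 3)) L]
  {Γ : Subgroup (Sol ≃ₜ Sol)} {q : Sol → L}
  {S : Type*} [TopologicalSpace S] [ChartedSpace (EuclideanSpace ℝ (Fin 2)) S]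
  {g : EuclideanSpace ℝ (Fin 2) → S} {f : S → L} {ε : ℝ}

theorem IsSolQuotient.exists_planeLift (hq : IsSolQuotient Γ q) (hε : ε * ε = 1)
    (hg : IsLocalDiffeomorph (𝓡 2) (𝓡 2) ∞ g) (hgs : Function.Surjective g)
    (hfib : ∀ x y : EuclideanSpace ℝ (Fin 2), g x = g y ↔
      ∃ m n : ℤ, y 0 = x 0 + (m : ℝ) ∧ y 1 = ε ^ m * x 1 + (n : ℝ))
    (hf : IsSmoothEmbedding (𝓡 2) (𝓡 3) ∞ f) :
    ∃ H F, IsSurfaceLift Γ q H g f F ∧ ∃ α ∈ Γ, ∃ β ∈ Γ, (∀ s, F (planeGlide ε hε s) = α (F s)) ∧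
      (∀ s, F (planeShift s) = β (F s)) ∧ ∀ K : Subgroup (Sol ≃ₜ Sol), α ∈ K → β ∈ K → H ≤ K := by
  obtain ⟨F, hF, hlift⟩ := hq.exists_lift (hf.contMDiff.continuous.comp hg.contMDiff.continuous)
  have hglide : ∀ (m : ℤ) s, g ((planeGlide ε hε ^ m) s) = g s := fun m s => by
    rw [eq_comm, hfib, planeGlide_zpow]
    exact ⟨m, 0, rfl, by simp⟩
  have hshift : ∀ (n : ℤ) s, g ((planeShift ^ n) s) = g s := fun n s => by
    rw [eq_comm, hfib, planeShift_zpow]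
    exact ⟨0, n, by simp, by simp⟩
  have hdeck : ∀ s s', g s = g s' → ∃ m n : ℤ, s' = (planeShift ^ n * planeGlide ε hε ^ m) s := by
    intro s s' h
    obtain ⟨m, n, h0, h1⟩ := (hfib _ _).1 h
    refine ⟨m, n, ?_⟩
    rw [Homeomorph.mul_apply, planeShift_zpow, planeGlide_zpow]
    ext i
    fin_cases i
    · exact h0
    · exact h1
  have hS := hq.isSurfaceLift hg hgs hf hF hlift fun s s' h => by
    obtain ⟨m, n, rfl⟩ := hdeck s s' h
    exact ⟨planeShift ^ n * planeGlide ε hε ^ m, fun x => (hshift n _).trans (hglide m x), rfl⟩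
  obtain ⟨α, hα, hα'⟩ := hq.exists_deck hF (hF.comp (planeGlide ε hε).continuous) fun x => by
    have := hglide 1 x
    rw [zpow_one] at this
    rw [Function.comp_apply, hlift, hlift, Function.comp_apply, Function.comp_apply, this]
  obtain ⟨β, hβ, hβ'⟩ := hq.exists_deck hF (hF.comp planeShift.continuous) fun x => by
    have := hshift 1 x
    rw [zpow_one] at this
    rw [Function.comp_apply, hlift, hlift, Function.comp_apply, Function.comp_apply, this]
  -- H is generated by α and β: h moves F 0 to the image of a deck translate of 0, so it agrees
  -- there with some β ^ n * α ^ m, and the action is free.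
  refine ⟨_, F, hS, α, hα, β, hβ, hα', hβ', fun K hαK hβK h hh => ?_⟩
  obtain ⟨s', h1, h2⟩ := hS.invariant h hh 0
  obtain ⟨m, n, rfl⟩ := hdeck _ _ h1.symm
  have hmem := mul_mem (zpow_mem (show (planeShift, β) ∈ intertwiners F from hβ') n)
    (zpow_mem (show (planeGlide ε hε, α) ∈ intertwiners F from hα') m)
  have h3 := hmem 0
  rw [show h = β ^ n * α ^ m from hq.eq_of_apply_eq (hS.le hh)
    (mul_mem (zpow_mem hβ n) (zpow_mem hα m)) (h2.symm.trans h3)]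
  exact mul_mem (zpow_mem hβK n) (zpow_mem hαK m)

end Plane

/-! ### Tori -/

/-- The linear form `w ↦ det (u, v, w)`. -/
def crossForm (u v : Sol) : Sol →L[ℝ] ℝ :=
  (u 1 * v 2 - u 2 * v 1) • (EuclideanSpace.proj 0 : Sol →L[ℝ] ℝ) +
  (u 2 * v 0 - u 0 * v 2) • (EuclideanSpace.proj 1 : Sol →L[ℝ] ℝ) +
  (u 0 * v 1 - u 1 * v 0) • (EuclideanSpace.proj 2 : Sol →L[ℝ] ℝ)

theorem crossForm_apply (u v w : Sol) : crossForm u v w =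
    (u 1 * v 2 - u 2 * v 1) * w 0 + (u 2 * v 0 - u 0 * v 2) * w 1 +
      (u 0 * v 1 - u 1 * v 0) * w 2 := rfl

theorem crossForm_eq_det (u v w : Sol) : crossForm u v w =
    (EuclideanSpace.basisFun (Fin 3) ℝ).toBasis.det ![u, v, w] := by
  rw [crossForm_apply, Module.Basis.det_apply, Matrix.det_fin_three]
  simp [Module.Basis.toMatrix_apply]
  ring

theorem crossForm_map (A : Sol →L[ℝ] Sol) (u v w : Sol) :
    crossForm (A u) (A v) (A w) = A.det * crossForm u v w := by
  rw [crossForm_eq_det, crossForm_eq_det, ContinuousLinearMap.det, ← Module.Basis.det_comp]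
  congr 1
  ext i
  fin_cases i <;> rfl

section Torus

variable {L : Type*} [TopologicalSpace L] [ChartedSpace (EuclideanSpace ℝ (Fin 3)) L]
  {Γ : Subgroup (Sol ≃ₜ Sol)} {q : Sol → L}
  {S : Type*} [TopologicalSpace S] [ChartedSpace (EuclideanSpace ℝ (Fin 2)) S]
  {g : EuclideanSpace ℝ (Fin 2) → S} {f : S → L} {H : Subgroup (Sol ≃ₜ Sol)}
  {F : EuclideanSpace ℝ (Fin 2) → Sol}

/-- A surface covered by the plane is two-sided if its deck transformations are translations of
the plane and preserve the orientation of Sol. -/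
theorem IsSurfaceLift.isTwoSided_of_le_orientation [IsManifold (𝓡 3) ∞ L] [IsManifold (𝓡 2) ∞ S]
    (hF : IsSurfaceLift Γ q H g f F) (hq : IsSolQuotient Γ q) (hH : H ≤ solOrientationSubgroup)
    (htrans : ∀ s s', g s = g s' → ∀ x, g (x + (s' - s)) = g x) : IsTwoSided f := by
  have hsm : ContDiff ℝ ∞ F := (hF.contMDiff hq).contDiff
  have hinj : ∀ s, Function.Injective (fderiv ℝ F s) := fun s => by
    have := hF.mfderiv_injective hq s
    rwa [mfderiv_eq_fderiv] at this
  let u : EuclideanSpace ℝ (Fin 2) → Sol := fun s => fderiv ℝ F s (EuclideanSpace.single 0 1)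
  let v : EuclideanSpace ℝ (Fin 2) → Sol := fun s => fderiv ℝ F s (EuclideanSpace.single 1 1)
  have hd : Continuous (fderiv ℝ F) := hsm.continuous_fderiv (by simp)
  have hu : Continuous u := hd.clm_apply continuous_const
  have hv : Continuous v := hd.clm_apply continuous_const
  have hbasis : ∀ s (a : EuclideanSpace ℝ (Fin 2)), fderiv ℝ F s a = a 0 • u s + a 1 • v s := by
    intro s a
    have ha : a = a 0 • EuclideanSpace.single 0 (1 : ℝ) + a 1 • EuclideanSpace.single 1 (1 : ℝ) := by
      ext i; fin_cases i <;> simp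
    conv_lhs => rw [ha, map_add, map_smul, map_smul]
  refine hF.isTwoSided hq (φ := fun s => crossForm (u s) (v s)) ?_ ?_ ?_ ?_
  · unfold crossForm
    fun_prop
  · intro s h0
    have hall : ∀ i, u s i = 0 := by
      intro i
      -- If u × v = 0 then -vᵢ u + uᵢ v = 0 for each i, and injectivity of dF gives uᵢ = 0.
      have h1 : fderiv ℝ F s (!₂[-v s i, u s i]) = 0 := by
        have k0 : u s 1 * v s 2 - u s 2 * v s 1 = 0 := by
          simpa [crossForm_apply] using congrArg (fun T : Sol →L[ℝ] ℝ => T !₂[1, 0, 0]) h0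
        have k1 : u s 2 * v s 0 - u s 0 * v s 2 = 0 := by
          simpa [crossForm_apply] using congrArg (fun T : Sol →L[ℝ] ℝ => T !₂[0, 1, 0]) h0
        have k2 : u s 0 * v s 1 - u s 1 * v s 0 = 0 := by
          simpa [crossForm_apply] using congrArg (fun T : Sol →L[ℝ] ℝ => T !₂[0, 0, 1]) h0
        rw [hbasis]
        ext j
        change -v s i * u s j + u s i * v s j = 0
        fin_cases i <;> fin_cases j <;> simp <;> linarith
      have h2 := hinj s (h1.trans (map_zero _).symm)
      exact congrArg (fun a : EuclideanSpace ℝ (Fin 2) => a 1) h2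
    have h1 : u s = 0 := by ext i; exact hall i
    have h2 := hinj s (h1.trans (map_zero _).symm)
    simpa using congrArg (fun a : EuclideanSpace ℝ (Fin 2) => a 0) h2
  · intro s a
    have h1 : ∀ a : EuclideanSpace ℝ (Fin 2), crossForm (u s) (v s) (fderiv ℝ F s a) = 0 := by
      intro a
      rw [hbasis, crossForm_apply]
      simp only [PiLp.add_apply, PiLp.smul_apply, smul_eq_mul]
      ring
    rw [mfderiv_eq_fderiv]
    exact h1 a
  · intro s s' h
    obtain ⟨k, hk, e⟩ := hF.fiber s s' h
    have hkΓ := hF.le hk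
    -- The deck map is a translation, so differentiating this identity shows that k carries the
    -- coordinate tangent vectors at s to those at s'; as det dk = 1, the cross form is preserved
    -- exactly.
    have h1 : F ∘ (fun x => x + (s' - s)) = k ∘ F :=
      hq.eq_of_lift_eq (hF.continuous.comp (continuous_add_const _))
        (k.continuous.comp hF.continuous) (fun x => by
          simp only [Function.comp_apply]
          rw [hq.apply_eq hkΓ, hF.lift, hF.lift, htrans s s' h]) (a := s)
        (by simp only [Function.comp_apply]; rw [add_sub_cancel]; exact e)
    have h2 : fderiv ℝ F s' = (fderiv ℝ k (F s)).comp (fderiv ℝ F s) := by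
      rw [← fderiv_comp s ((hq.isometry hkΓ).1.differentiable (by simp) _)
        (hsm.differentiable (by simp) _), ← h1]
      have := fderiv_comp_add_right (𝕜 := ℝ) (f := F) (x := s) (s' - s)
      rw [add_sub_cancel] at this
      exact this.symm
    refine ⟨k, hkΓ, e, 1, one_pos, fun w => ?_⟩
    change crossForm (fderiv ℝ F s' _) (fderiv ℝ F s' _) _ = _
    rw [h2]
    exact (crossForm_map (fderiv ℝ k (F s)) _ _ w).trans (by rw [(hH hk).2]; rfl)

/-- Since α and β commute, an orientation-reversing one among them has an axis preserved by both; if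
there is none, the cross form of the tangent frame serves as conormal. -/
theorem IsSolQuotient.isTwoSided_of_torus [IsManifold (𝓡 3) ∞ L] [T2Space L] [CompactSpace L]
    [IsManifold (𝓡 2) ∞ S] (hq : IsSolQuotient Γ q) (hS : IsTwoTorus S)
    (hf : IsSmoothEmbedding (𝓡 2) (𝓡 3) ∞ f) : IsTwoSided f := by
  obtain ⟨g, hg, hgs, hfib⟩ := hS
  have hfib' : ∀ x y : EuclideanSpace ℝ (Fin 2), g x = g y ↔
      ∃ m n : ℤ, y 0 = x 0 + (m : ℝ) ∧ y 1 = (1 : ℝ) ^ m * x 1 + (n : ℝ) := by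
    simpa only [one_zpow, one_mul] using hfib
  obtain ⟨H, F, hF, α, hα, β, hβ, hα', hβ', hK⟩ :=
    hq.exists_planeLift (mul_one 1) hg hgs hfib' hf
  have hSc : CompactSpace S := compactSpace_of_plane hg.contMDiff.continuous hgs hfib'
  have hcomm : β * α = α * β := by
    refine hq.eq_of_apply_eq (mul_mem hβ hα) (mul_mem hα hβ) (p := F 0) ?_
    rw [Homeomorph.mul_apply, Homeomorph.mul_apply, ← hα', ← hβ', ← hβ', ← hα']
    congr 1
    ext i
    fin_cases i <;> simp [planeGlide, planeShift]
  have key : ∀ k ∈ Γ, k ∉ solOrientationSubgroup → α * k = k * α → β * k = k * β →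
      IsTwoSided f := by
    intro k hk hk' h1 h2
    obtain ⟨e₀, e₁, l, a, b, he₀, he₁, -, hl, hs⟩ := hq.exists_isStraight_of_notMem hk hk'
    obtain ⟨x₀, y₀, -, hcent⟩ := hs.exists_axis he₀ he₁ hl
    exact hF.isTwoSided_of_le_axisStabilizer hq
      (hK _ (hcent α (hq.isometry hα) h1) (hcent β (hq.isometry hβ) h2))
  by_cases h1 : α ∈ solOrientationSubgroup
  · by_cases h2 : β ∈ solOrientationSubgroup
    · refine hF.isTwoSided_of_le_orientation hq (hK _ h1 h2) fun s s' h x => ?_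
      obtain ⟨m, n, h0, h1⟩ := (hfib _ _).1 h
      rw [eq_comm, hfib]
      exact ⟨m, n, by simp [h0], by simp [h1]⟩
    · exact key β hβ h2 hcomm.symm rfl
  · exact key α hα h1 rfl hcomm

end Torus

/-! ### Orientable neighborhoods -/

theorem subtypeRestr_mem_maximalAtlas {n : ℕ} {M : Type*} [TopologicalSpace M]
    [ChartedSpace (EuclideanSpace ℝ (Fin n)) M] {e : OpenPartialHomeomorph M (EuclideanSpace ℝ (Fin n))}
    (he : e ∈ IsManifold.maximalAtlas (𝓡 n) ∞ M) {U : TopologicalSpace.Opens M} (hU : Nonempty U) :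
    e.subtypeRestr hU ∈ IsManifold.maximalAtlas (𝓡 n) ∞ U := by
  intro e' he'
  obtain ⟨x, hx⟩ := TopologicalSpace.Opens.chart_eq hU he'
  rw [hx]
  have h := he (chartAt _ (x : M)) (chart_mem_atlas _ _)
  exact ⟨StructureGroupoid.mem_of_eqOnSource _
      (closedUnderRestriction' h.1 (e.isOpen_inter_preimage_symm U.2))
      (e.subtypeRestr_symm_trans_subtypeRestr hU _),
    StructureGroupoid.mem_of_eqOnSource _
      (closedUnderRestriction' h.2 ((chartAt _ (x : M)).isOpen_inter_preimage_symm U.2))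
      ((chartAt _ (x : M)).subtypeRestr_symm_trans_subtypeRestr hU _)⟩

section Orientable

variable {L : Type*} [TopologicalSpace L] [ChartedSpace (EuclideanSpace ℝ (Fin 3)) L]
  {Γ : Subgroup (Sol ≃ₜ Sol)} {q : Sol → L}

/-- The local inverses of q with values in W form the atlas. Their transition maps are locally
elements of Γ joining points of W, of determinant 1. -/
theorem IsSolQuotient.isOrientableManifold [IsManifold (𝓡 3) ∞ L] (hq : IsSolQuotient Γ q)
    {W : Set Sol} (hW : IsOpen W)
    (h : ∀ p ∈ W, ∀ γ ∈ Γ, γ p ∈ W → γ ∈ solOrientationSubgroup) {U : TopologicalSpace.Opens L}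
    (hU : (U : Set L) = q '' W) : IsOrientableManifold 3 U := by
  refine ⟨{e | e ∈ IsManifold.maximalAtlas (𝓡 3) ∞ U ∧ ∀ x ∈ e.source, e x ∈ W ∧ q (e x) = x},
    fun e he => he.1, fun x => ?_, ?_⟩
  · obtain ⟨w, hw, hwx⟩ : (x : L) ∈ q '' W := hU ▸ x.2
    obtain ⟨Φ, hwΦ, hΦ⟩ := hq.diffeo w
    have hne : Nonempty U := ⟨x⟩
    let e₀ : OpenPartialHomeomorph L (EuclideanSpace ℝ (Fin 3)) := Φ.symm.toOpenPartialHomeomorph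
    have he₀ : e₀ ∈ IsManifold.maximalAtlas (𝓡 3) ∞ L :=
      e₀.mem_maximalAtlas_of_contMDiffOn Φ.contMDiffOn_invFun Φ.contMDiffOn_toFun
    have hopen := e₀.isOpen_inter_preimage hW
    have hq₀ : ∀ y ∈ e₀.source, q (e₀ y) = y := fun y hy =>
      (hΦ (e₀.map_source hy)).trans (e₀.left_inv hy)
    have hx₀ : (x : L) ∈ e₀.source := by
      rw [← hwx, hΦ hwΦ]
      exact Φ.map_source hwΦ
    have hx₁ : e₀ x = w := by
      rw [← hwx, hΦ hwΦ]
      exact Φ.left_inv hwΦ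
    refine ⟨(e₀.restr (e₀.source ∩ e₀ ⁻¹' W)).subtypeRestr hne,
      ⟨subtypeRestr_mem_maximalAtlas (restr_mem_maximalAtlas _ he₀ hopen) hne, fun y hy => ?_⟩, ?_⟩
    · rw [OpenPartialHomeomorph.subtypeRestr_source, mem_preimage, e₀.restr_source' _ hopen] at hy
      exact ⟨hy.2.2, hq₀ _ hy.1⟩
    · rw [OpenPartialHomeomorph.subtypeRestr_source, mem_preimage, e₀.restr_source' _ hopen]
      exact ⟨hx₀, hx₀, by rw [mem_preimage, hx₁]; exact hw⟩
  · rintro e ⟨-, he⟩ e' ⟨-, he'⟩ x ⟨hx, hx'⟩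
    obtain ⟨h1, h2⟩ := he x hx
    obtain ⟨h3, h4⟩ := he' x hx'
    obtain ⟨γ, hγ, hγx⟩ := (hq.fiber _ _).1 (h2.trans h4.symm)
    have hor := h _ h1 γ hγ (by rw [hγx]; exact h3)
    obtain ⟨V, hV, hxV, hinj⟩ := hq.exists_injOn (e' x)
    have hsymm : ContinuousAt e.symm (e x) := e.continuousAt_symm (e.map_source hx)
    have hc : ContinuousAt (e' ∘ e.symm) (e x) := by
      refine ContinuousAt.comp ?_ hsymm
      rw [e.left_inv hx]
      exact e'.continuousAt hx'
    have h5 : e' ∘ e.symm =ᶠ[𝓝 (e x)] γ := by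
      filter_upwards [e.open_target.mem_nhds (e.map_source hx),
        hsymm.eventually (e'.open_source.mem_nhds (by rw [e.left_inv hx]; exact hx')),
        hc.eventually (hV.mem_nhds (by rw [Function.comp_apply, e.left_inv hx]; exact hxV)),
        γ.continuous.continuousAt.eventually (hV.mem_nhds (by rw [hγx]; exact hxV))] with y y1 y2 y3 y4
      refine hinj y3 y4 ?_
      rw [hq.apply_eq hγ, Function.comp_apply, (he' _ y2).2, ← (he _ (e.map_target y1)).2,
        e.right_inv y1]
    rw [h5.fderiv_eq, hor.2]
    exact one_pos

/-- The condition on pairs of points persists near K × K: nearby pairs are related only by the same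
element of Γ, or by none as L is Hausdorff. The tube lemma then enlarges K to an open set. -/
theorem IsSolQuotient.exists_isOrientableManifold [IsManifold (𝓡 3) ∞ L] [T2Space L]
    (hq : IsSolQuotient Γ q) {K : Set Sol} (hK : IsCompact K)
    (h : ∀ p ∈ K, ∀ γ ∈ Γ, γ p ∈ K → γ ∈ solOrientationSubgroup) :
    ∃ U : TopologicalSpace.Opens L, q '' K ⊆ U ∧ IsOrientableManifold 3 U := by
  let G : Set (Sol × Sol) := {x | ∀ γ ∈ Γ, γ x.1 = x.2 → γ ∈ solOrientationSubgroup}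
  have hG : K ×ˢ K ⊆ interior G := by
    rintro ⟨x, y⟩ ⟨hx, hy⟩
    rw [mem_interior_iff_mem_nhds]
    by_cases hxy : q x = q y
    · obtain ⟨δ, hδ, rfl⟩ := (hq.fiber _ _).1 hxy
      obtain ⟨V, hV, hyV, hinj⟩ := hq.exists_injOn (δ x)
      have h1 : ∀ᶠ z : Sol × Sol in 𝓝 (x, δ x), δ z.1 ∈ V :=
        (δ.continuous.comp continuous_fst).continuousAt.eventually (hV.mem_nhds hyV)
      have h2 : ∀ᶠ z : Sol × Sol in 𝓝 (x, δ x), z.2 ∈ V :=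
        continuous_snd.continuousAt.eventually (hV.mem_nhds hyV)
      filter_upwards [h1, h2] with z z1 z2 γ hγ e
      have h3 : γ z.1 = δ z.1 := hinj (e ▸ z2) z1 (by rw [hq.apply_eq hγ, hq.apply_eq hδ])
      rw [hq.eq_of_apply_eq hγ hδ h3]
      exact h x hx δ hδ hy
    · obtain ⟨A, B, hA, hB, hxA, hyB, hAB⟩ := t2_separation hxy
      have h1 : ∀ᶠ z : Sol × Sol in 𝓝 (x, y), q z.1 ∈ A :=
        (hq.continuous.comp continuous_fst).continuousAt.eventually (hA.mem_nhds hxA)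
      have h2 : ∀ᶠ z : Sol × Sol in 𝓝 (x, y), q z.2 ∈ B :=
        (hq.continuous.comp continuous_snd).continuousAt.eventually (hB.mem_nhds hyB)
      filter_upwards [h1, h2] with z z1 z2 γ hγ e
      rw [← e, hq.apply_eq hγ] at z2
      exact absurd z2 (Set.disjoint_left.1 hAB z1)
  obtain ⟨u, v, hu, hv, hKu, hKv, huv⟩ := generalized_tube_lemma hK hK isOpen_interior hG
  refine ⟨⟨q '' (u ∩ v), hq.isOpenMap _ (hu.inter hv)⟩, image_mono (subset_inter hKu hKv),
    hq.isOrientableManifold (hu.inter hv) (fun p hp γ hγ hp' => ?_) rfl⟩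
  exact (interior_subset (huv (⟨hp.1, hp'.2⟩ : (p, γ p) ∈ u ×ˢ v)) : (p, γ p) ∈ G) γ hγ rfl

end Orientable

/-! ### Klein bottles -/

section Klein

variable {L : Type*} [TopologicalSpace L] [ChartedSpace (EuclideanSpace ℝ (Fin 3)) L]
  {Γ : Subgroup (Sol ≃ₜ Sol)} {q : Sol → L}
  {S : Type*} [TopologicalSpace S] [ChartedSpace (EuclideanSpace ℝ (Fin 2)) S] {f : S → L}

/-- An orientation-reversing β shifts heights by l ≠ 0. For straight α the relation gives 2 l = 0;
for a swap α it multiplies a nonzero linear coefficient by e₀ * e₁ = -1 and leaves it unchanged. -/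
theorem IsSolQuotient.mem_orientation_of_mul_mul [CompactSpace L] (hq : IsSolQuotient Γ q)
    {α β : Sol ≃ₜ Sol} (hα : α ∈ Γ) (hβ : β ∈ Γ) (h : β * α * β = α) :
    β ∈ solOrientationSubgroup := by
  by_contra hor
  obtain ⟨e₀, e₁, l, a, b, he₀, he₁, hneg, hl, hs⟩ := hq.exists_isStraight_of_notMem hβ hor
  have hp : ∀ p, β (α (β p)) = α p := fun p => congrArg (fun φ : Sol ≃ₜ Sol => φ p) h
  obtain ⟨d₀, d₁, m, c, d, hd₀, hd₁, ht | ht⟩ := isStraight_or_isSwap (hq.isometry hα)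
  · have h1 := congrArg (fun p : Sol => p 2) (hp 0)
    simp only [(hs _).2.2, (ht _).2.2] at h1
    exact hl (by linarith)
  · have h1 := congrArg (fun p : Sol => p 0) (hp !₂[0, 0, 0])
    have h2 := congrArg (fun p : Sol => p 0) (hp !₂[0, 1, 0])
    simp only [(hs _).1, (hs _).2.1, (ht _).1] at h1 h2
    simp at h1 h2
    have hl' : Real.exp l * Real.exp (-l) = 1 := by
      rw [← Real.exp_add, add_neg_cancel, Real.exp_zero]
    have h3 : d₀ * Real.exp m = 0 := by
      linear_combination (h1 - h2 + d₀ * Real.exp m * (e₀ * e₁ * hl' + hneg)) / 2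
    rcases mul_eq_zero.1 h3 with rfl | h4
    · simp at hd₀
    · exact (Real.exp_pos m).ne' h4

/-- Comparing heights, β is not a swap and has no height shift, so it is a translation. Its
components are killed by 1 + e₀ exp(l) and 1 + e₁ exp(-l), nonzero because l ≠ 0. -/
theorem IsSolQuotient.eq_one_of_mul_mul [CompactSpace L] (hq : IsSolQuotient Γ q)
    {α β : Sol ≃ₜ Sol} (hβ : β ∈ Γ) {e₀ e₁ l a b : ℝ} (he₀ : e₀ * e₀ = 1) (he₁ : e₁ * e₁ = 1)
    (hl : l ≠ 0) (hs : IsStraight α e₀ e₁ l a b) (h : β * α * β = α) : β = 1 := by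
  have hp : ∀ p, β (α (β p)) = α p := fun p => congrArg (fun φ : Sol ≃ₜ Sol => φ p) h
  obtain ⟨d₀, d₁, m, c, d, hd₀, hd₁, ht | ht⟩ := isStraight_or_isSwap (hq.isometry hβ)
  · have h1 := congrArg (fun p : Sol => p 2) (hp 0)
    simp only [(hs _).2.2, (ht _).2.2] at h1
    obtain rfl : m = 0 := by linarith
    obtain ⟨rfl, rfl⟩ := hq.eq_one_of_isStraight_zero hβ hd₀ hd₁ ht
    have h2 := congrArg (fun p : Sol => p 0) (hp 0)
    have h3 := congrArg (fun p : Sol => p 1) (hp 0)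
    simp only [(hs _).1, (hs _).2.1, (ht _).1, (ht _).2.1] at h2 h3
    simp at h2 h3
    have h4 := mul_exp_ne_one (e := -e₀) (by linear_combination he₀) hl
    have h5 := mul_exp_ne_one (e := -e₁) (by linear_combination he₁) (neg_ne_zero.2 hl)
    have hc : c = 0 := by
      rcases mul_eq_zero.1 (show c * (1 - -e₀ * Real.exp l) = 0 by linear_combination h2) with h6 | h6
      · exact h6
      · exact absurd (sub_eq_zero.1 h6).symm h4
    have hd : d = 0 := by
      rcases mul_eq_zero.1 (show d * (1 - -e₁ * Real.exp (-l)) = 0 by linear_combination h3) with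
        h6 | h6
      · exact h6
      · exact absurd (sub_eq_zero.1 h6).symm h5
    exact hq.free β hβ 0 (ht.ext_apply (by simp [hc]) (by simp [hd]) (by simp))
  · have h1 := congrArg (fun p : Sol => p 2) (hp 0)
    simp only [(hs _).2.2, (ht _).2.2] at h1
    exact absurd (by linarith) hl

theorem IsSolQuotient.isTwoSided_of_klein [IsManifold (𝓡 3) ∞ L] [T2Space L] [CompactSpace L]
    (hq : IsSolQuotient Γ q) (hS : IsKleinBottle S)
    (hf : IsSmoothEmbedding (𝓡 2) (𝓡 3) ∞ f) (hn : HasNonorientableNeighborhood f) :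
    IsTwoSided f := by
  obtain ⟨g, hg, hgs, hfib⟩ := hS
  obtain ⟨H, F, hF, α, hα, β, hβ, hα', hβ', hK⟩ :=
    hq.exists_planeLift (show (-1 : ℝ) * -1 = 1 by norm_num) hg hgs hfib hf
  have hSc : CompactSpace S := compactSpace_of_plane hg.contMDiff.continuous hgs hfib
  have hrel : β * α * β = α := by
    refine hq.eq_of_apply_eq (mul_mem (mul_mem hβ hα) hβ) hα (p := F 0) ?_
    rw [Homeomorph.mul_apply, Homeomorph.mul_apply, ← hβ', ← hα', ← hβ', ← hα']
    congr 1
    ext i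
    fin_cases i <;> simp [planeGlide, planeShift]
  have hβo := hq.mem_orientation_of_mul_mul hα hβ hrel
  by_cases hαo : α ∈ solOrientationSubgroup
  -- All of H preserves orientation, and elements of Γ joining two points of the lift belong to H.
  -- So the image of a fundamental square has an orientable neighborhood, which contains f(S).
  · exfalso
    have hH := hK _ hαo hβo
    obtain ⟨U, hU, hUo⟩ := hq.exists_isOrientableManifold
      (isCompact_unitSquare.image hF.continuous) (by
        rintro _ ⟨s, -, rfl⟩ γ hγ ⟨s', -, e⟩
        have h1 : g s = g s' := hf.isEmbedding.injective (by
          rw [← hF.lift, ← hF.lift, e, hq.apply_eq hγ])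
        obtain ⟨h, hh, e'⟩ := hF.fiber s s' h1
        rw [hq.eq_of_apply_eq hγ (hF.le hh) (e.symm.trans e')]
        exact hH hh)
    refine hn U (Subset.trans ?_ hU) hUo
    rintro _ ⟨x, rfl⟩
    obtain ⟨s, rfl⟩ := hgs x
    obtain ⟨s', hs', e⟩ := exists_mem_unitSquare hfib s
    exact ⟨F s', ⟨s', hs', rfl⟩, by rw [hF.lift, e]⟩
  · obtain ⟨e₀, e₁, l, a, b, he₀, he₁, -, hl, hs⟩ := hq.exists_isStraight_of_notMem hα hαo
    obtain ⟨x₀, y₀, hαx, -⟩ := hs.exists_axis he₀ he₁ hl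
    refine hF.isTwoSided_of_le_axisStabilizer hq (hK _ hαx ?_)
    rw [hq.eq_one_of_mul_mul hβ he₀ he₁ hl hs hrel]
    exact one_mem _

end Klein

/-! ### Projective planes -/

section Sphere

variable {L : Type*} [TopologicalSpace L] [ChartedSpace (EuclideanSpace ℝ (Fin 3)) L]
  {Γ : Subgroup (Sol ≃ₜ Sol)} {q : Sol → L}

/-- Maps from the sphere lift to Sol. -/
theorem IsSolQuotient.exists_lift_sphere (hq : IsSolQuotient Γ q) {f : Metric.sphere (0 : EuclideanSpace ℝ (Fin 3)) 1 → L}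
    (hf : Continuous f) : ∃ F : Metric.sphere (0 : EuclideanSpace ℝ (Fin 3)) 1 → Sol, Continuous F ∧ ∀ x, q (F x) = f x := by
  classical
  have : Fact (Module.finrank ℝ (EuclideanSpace ℝ (Fin 3)) = 2 + 1) := ⟨by simp⟩
  let v : Metric.sphere (0 : EuclideanSpace ℝ (Fin 3)) 1 := ⟨EuclideanSpace.single 0 1, by simp⟩
  have hv : ‖(v : EuclideanSpace ℝ (Fin 3))‖ = 1 := norm_eq_of_mem_sphere v
  have hw : ‖((-v : Metric.sphere (0 : EuclideanSpace ℝ (Fin 3)) 1) : EuclideanSpace ℝ (Fin 3))‖ = 1 := norm_eq_of_mem_sphere (-v)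
  have hvw : (v : EuclideanSpace ℝ (Fin 3)) ≠ ((-v : Metric.sphere (0 : EuclideanSpace ℝ (Fin 3)) 1) : EuclideanSpace ℝ (Fin 3)) := fun h =>
    ne_neg_of_mem_unit_sphere ℝ v (Subtype.ext h)
  set φ := stereographic hv
  set ψ := stereographic hw
  have hφs : ∀ x : Metric.sphere (0 : EuclideanSpace ℝ (Fin 3)) 1, x ≠ v → x ∈ φ.source := fun x hx => hx
  have hψs : ∀ x : Metric.sphere (0 : EuclideanSpace ℝ (Fin 3)) 1, x ≠ -v → x ∈ ψ.source := fun x hx => hx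
  have hφc : Continuous φ.symm := (isOpenEmbedding_stereographic_symm hv).continuous
  have hψc : Continuous ψ.symm := (isOpenEmbedding_stereographic_symm hw).continuous
  obtain ⟨F₁, hF₁, h₁⟩ := hq.exists_lift (hf.comp hφc)
  obtain ⟨F₂, hF₂, h₂⟩ := hq.exists_lift (hf.comp hψc)
  have hne : ∀ a, a ≠ 0 → φ.symm a ≠ -v := by
    intro a ha h
    apply ha
    rw [← φ.right_inv (mem_univ a), h]
    exact stereographic_apply_neg v
  have hne' : ∀ a, φ.symm a ≠ v := by
    intro a
    exact φ.map_target (mem_univ a)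
  have hconn : IsConnected ({0}ᶜ : Set (ℝ ∙ (v : EuclideanSpace ℝ (Fin 3)))ᗮ) := by
    refine isConnected_compl_singleton_of_one_lt_rank ?_ 0
    refine Module.lt_rank_of_lt_finrank ?_
    rw [Submodule.finrank_orthogonal_span_singleton (n := 2) (ne_zero_of_mem_unit_sphere v)]
    norm_num
  have : ConnectedSpace ({0}ᶜ : Set (ℝ ∙ (v : EuclideanSpace ℝ (Fin 3)))ᗮ) :=
    isConnected_iff_connectedSpace.1 hconn
  -- The lifts over the two stereographic charts differ by one deck transformation on the overlap,
  -- which is connected; correcting by γ glues them.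
  obtain ⟨γ, hγ, hγF⟩ := hq.exists_deck
    (F := fun a : ({0}ᶜ : Set (ℝ ∙ (v : EuclideanSpace ℝ (Fin 3)))ᗮ) => F₁ a)
    (G := fun a => F₂ (ψ (φ.symm a))) (hF₁.comp continuous_subtype_val)
    (hF₂.comp (continuous_iff_continuousAt.2 fun a => by
      have h1 : ContinuousAt ψ (φ.symm a) := ψ.continuousAt (hψs _ (hne a a.2))
      exact ContinuousAt.comp
        (f := fun a : ({0}ᶜ : Set (ℝ ∙ (v : EuclideanSpace ℝ (Fin 3)))ᗮ) => φ.symm a) h1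
        (hφc.comp continuous_subtype_val).continuousAt))
    (fun a => by
      rw [h₁, h₂, Function.comp_apply, Function.comp_apply, ψ.left_inv (hψs _ (hne a a.2))])
  have hglue : ∀ x : Metric.sphere (0 : EuclideanSpace ℝ (Fin 3)) 1, x ≠ v → x ≠ -v → F₂ (ψ x) = γ (F₁ (φ x)) := by
    intro x hx hx'
    have h0 : φ x ≠ 0 := fun h0 => hx' (φ.injOn (hφs x hx) (hφs (-v) (by
        intro h; exact hvw (congrArg Subtype.val h.symm))) (h0.trans
      (stereographic_apply_neg v).symm))
    have := hγF ⟨φ x, h0⟩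
    simp only [φ.left_inv (hφs x hx)] at this
    exact this
  refine ⟨fun x => if x = v then γ.symm (F₂ (ψ x)) else F₁ (φ x), ?_, ?_⟩
  · refine continuous_iff_continuousAt.2 fun x => ?_
    by_cases hx : x = v
    · have hxw : x ≠ -v := by
        rw [hx]
        exact fun h => hvw (congrArg Subtype.val h)
      have hc : ContinuousAt (fun x => γ.symm (F₂ (ψ x))) x :=
        (γ.symm.continuous.comp hF₂).continuousAt.comp (ψ.continuousAt (hψs x hxw))
      refine hc.congr ?_
      filter_upwards [isOpen_ne.mem_nhds hxw] with y hy
      split_ifs with h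
      · rfl
      · rw [hglue y h hy, γ.symm_apply_apply]
    · have hc : ContinuousAt (fun x => F₁ (φ x)) x :=
        hF₁.continuousAt.comp (φ.continuousAt (hφs x hx))
      refine hc.congr ?_
      filter_upwards [isOpen_ne.mem_nhds hx] with y hy
      rw [if_neg hy]
  · intro x
    beta_reduce
    split_ifs with hx
    · have hxw : x ≠ -v := by
        rw [hx]
        exact fun h => hvw (congrArg Subtype.val h)
      rw [show γ.symm (F₂ (ψ x)) = γ⁻¹ (F₂ (ψ x)) from rfl, hq.apply_eq (inv_mem hγ), h₂,
        Function.comp_apply, ψ.left_inv (hψs x hxw)]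
    · rw [h₁, Function.comp_apply, φ.left_inv (hφs x hx)]

/-- The radial projection onto the unit sphere. -/
def radialProj (y : EuclideanSpace ℝ (Fin 3)) : Metric.sphere (0 : EuclideanSpace ℝ (Fin 3)) 1 :=
  open Classical in
  if h : y = 0 then ⟨EuclideanSpace.single 0 1, by simp⟩
  else ⟨‖y‖⁻¹ • y, by simp [norm_smul, h]⟩

theorem coe_radialProj {y : EuclideanSpace ℝ (Fin 3)} (hy : y ≠ 0) :
    (radialProj y : EuclideanSpace ℝ (Fin 3)) = ‖y‖⁻¹ • y := by
  rw [radialProj, dif_neg hy]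

theorem radialProj_coe (x : Metric.sphere (0 : EuclideanSpace ℝ (Fin 3)) 1) : radialProj x = x := by
  ext1
  rw [coe_radialProj (ne_zero_of_mem_unit_sphere x), norm_eq_of_mem_sphere, inv_one, one_smul]

theorem radialProj_neg {y : EuclideanSpace ℝ (Fin 3)} (hy : y ≠ 0) :
    radialProj (-y) = -radialProj y := by
  ext1
  rw [coe_radialProj (neg_ne_zero.2 hy), norm_neg, smul_neg, ← coe_radialProj hy]
  rfl

theorem radialProj_smul {y : EuclideanSpace ℝ (Fin 3)} (hy : y ≠ 0) {t : ℝ} (ht : 0 < t) :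
    radialProj (t • y) = radialProj y := by
  ext1
  rw [coe_radialProj (smul_ne_zero ht.ne' hy), coe_radialProj hy, norm_smul, Real.norm_eq_abs,
    abs_of_pos ht, smul_smul, mul_inv, mul_right_comm, inv_mul_cancel₀ ht.ne', one_mul]

/-- Extending F to be constant along rays replaces derivatives on the sphere by ordinary derivatives
in ℝ³. -/
theorem contDiffAt_comp_radialProj {F : Metric.sphere (0 : EuclideanSpace ℝ (Fin 3)) 1 → Sol} (hF : ContMDiff (𝓡 2) (𝓡 3) ∞ F)
    {y : EuclideanSpace ℝ (Fin 3)} (hy : y ≠ 0) : ContDiffAt ℝ ∞ (F ∘ radialProj) y := by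
  have : Fact (Module.finrank ℝ (EuclideanSpace ℝ (Fin 3)) = 2 + 1) := ⟨by simp⟩
  let U : TopologicalSpace.Opens (EuclideanSpace ℝ (Fin 3)) := ⟨{0}ᶜ, isOpen_compl_singleton⟩
  have h1 : ContMDiff (𝓡 3) (𝓡 3) ∞
      fun x : U => (radialProj (x : EuclideanSpace ℝ (Fin 3)) : EuclideanSpace ℝ (Fin 3)) := by
    intro x
    refine (contMDiffAt_subtype_iff (f := fun y : EuclideanSpace ℝ (Fin 3) =>
      (radialProj y : EuclideanSpace ℝ (Fin 3)))).2 ?_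
    have h2 : ContDiffAt ℝ ∞ (fun y : EuclideanSpace ℝ (Fin 3) => ‖y‖⁻¹ • y) x :=
      ((contDiffAt_norm ℝ x.2).inv (norm_ne_zero_iff.2 x.2)).smul contDiffAt_id
    refine (h2.congr_of_eventuallyEq ?_).contMDiffAt
    filter_upwards [isOpen_ne.mem_nhds x.2] with z hz using coe_radialProj hz
  have h2 : ContMDiff (𝓡 3) (𝓡 2) ∞ fun x : U => radialProj (x : EuclideanSpace ℝ (Fin 3)) :=
    h1.codRestrict_sphere fun x => (radialProj (x : EuclideanSpace ℝ (Fin 3))).2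
  have h3 := hF.comp h2 ⟨y, hy⟩
  exact (contMDiffAt_subtype_iff (f := F ∘ radialProj) (x := (⟨y, hy⟩ : U))).1 h3 |>.contDiffAt

end Sphere

section ProjectivePlane

variable {L : Type*} [TopologicalSpace L] [ChartedSpace (EuclideanSpace ℝ (Fin 3)) L]
  {Γ : Subgroup (Sol ≃ₜ Sol)} {q : Sol → L}
  {S : Type*} [TopologicalSpace S] [ChartedSpace (EuclideanSpace ℝ (Fin 2)) S]
  {g : Metric.sphere (0 : EuclideanSpace ℝ (Fin 3)) 1 → S} {f : S → L}
  {F : Metric.sphere (0 : EuclideanSpace ℝ (Fin 3)) 1 → Sol}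

/-- Groups of isometries of Sol which act freely have no elements of order two. -/
theorem IsSolQuotient.eq_one_of_mul_self (hq : IsSolQuotient Γ q) {γ : Sol ≃ₜ Sol} (hγ : γ ∈ Γ)
    (h : γ * γ = 1) : γ = 1 := by
  have h1 : γ (γ 0) = 0 := congrArg (fun φ : Sol ≃ₜ Sol => φ 0) h
  have h2 : ∀ i, γ (γ 0) i = 0 := fun i => by rw [h1]; rfl
  -- Isometries are affine in the coordinates, and γ exchanges 0 and γ 0, so it fixes their
  -- midpoint.
  refine hq.free γ hγ ((1 / 2 : ℝ) • γ 0) ?_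
  obtain ⟨e₀, e₁, l, a, b, -, -, hs | hs⟩ := isStraight_or_isSwap (hq.isometry hγ)
  · have k0 := h2 0
    have k1 := h2 1
    have k2 := h2 2
    simp only [(hs _).1, (hs _).2.1, (hs _).2.2] at k0 k1 k2
    ext i
    fin_cases i <;> simp [(hs _).1, (hs _).2.1, (hs _).2.2] at k0 k1 k2 ⊢ <;> linarith
  · have k0 := h2 0
    have k1 := h2 1
    have k2 := h2 2
    simp only [(hs _).1, (hs _).2.1, (hs _).2.2] at k0 k1 k2
    ext i
    fin_cases i <;> simp [(hs _).1, (hs _).2.1, (hs _).2.2] at k0 k1 k2 ⊢ <;> linarith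

/-- In odd dimension det(-T) = -det T, so the determinant takes opposite signs at antipodes of the
connected sphere. -/
theorem exists_det_eq_zero_of_odd {T : Metric.sphere (0 : EuclideanSpace ℝ (Fin 3)) 1 → Sol →L[ℝ] Sol}
    (hT : Continuous T) (hodd : ∀ x, T (-x) = -T x) : ∃ x, (T x).det = 0 := by
  have hconn : PreconnectedSpace (Metric.sphere (0 : EuclideanSpace ℝ (Fin 3)) 1) :=
    isPreconnected_iff_preconnectedSpace.1 (isPreconnected_sphere
      (Module.lt_rank_of_lt_finrank (by simp)) 0 1)
  have hc : Continuous fun x => (T x).det := ContinuousLinearMap.continuous_det.comp hT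
  have hneg : ∀ x, (T (-x)).det = -(T x).det := fun x => by
    rw [hodd, ContinuousLinearMap.det, ContinuousLinearMap.det,
      show ((-T x : Sol →L[ℝ] Sol) : Sol →ₗ[ℝ] Sol) = (-1 : ℝ) • (T x : Sol →ₗ[ℝ] Sol) by
        ext v i; simp, LinearMap.det_smul]
    simp
    norm_num
  let x : Metric.sphere (0 : EuclideanSpace ℝ (Fin 3)) 1 := ⟨EuclideanSpace.single 0 1, by simp⟩
  rcases le_total (T x).det 0 with h | h
  · exact mem_range_of_exists_le_of_exists_ge hc ⟨x, h⟩ ⟨-x, by rw [hneg]; linarith⟩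
  · exact mem_range_of_exists_le_of_exists_ge hc ⟨-x, by rw [hneg]; linarith⟩ ⟨x, h⟩

theorem fderiv_comp_radialProj_self {x : Metric.sphere (0 : EuclideanSpace ℝ (Fin 3)) 1}
    (hF : DifferentiableAt ℝ (F ∘ radialProj) (x : EuclideanSpace ℝ (Fin 3))) :
    fderiv ℝ (F ∘ radialProj) (x : EuclideanSpace ℝ (Fin 3)) x = 0 := by
  have h1 := hF.hasFDerivAt.hasLineDerivAt (x : EuclideanSpace ℝ (Fin 3))
  refine h1.unique (HasDerivAt.congr_of_eventuallyEq (hasDerivAt_const 0 (F x)) ?_)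
  have hlt : ∀ᶠ t : ℝ in 𝓝 0, -1 < t := lt_mem_nhds (by norm_num)
  filter_upwards [hlt] with t ht
  have h2 : (x : EuclideanSpace ℝ (Fin 3)) + t • (x : EuclideanSpace ℝ (Fin 3)) = (1 + t) • x := by
    rw [add_smul, one_smul]
  rw [h2, Function.comp_apply, radialProj_smul (ne_zero_of_mem_unit_sphere x) (by linarith),
    radialProj_coe]

/-- There are no projective planes in a closed Sol-manifold. -/
theorem IsSolQuotient.not_isProjectivePlane [IsManifold (𝓡 3) ∞ L] [T2Space L]
    [IsManifold (𝓡 2) ∞ S] (hq : IsSolQuotient Γ q) (hS : IsProjectivePlane S)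
    (hf : IsSmoothEmbedding (𝓡 2) (𝓡 3) ∞ f) : False := by
  have : Fact (Module.finrank ℝ (EuclideanSpace ℝ (Fin 3)) = 2 + 1) := ⟨by simp⟩
  obtain ⟨g, hg, hgs, hfib⟩ := hS
  have hSc : CompactSpace S := by
    refine ⟨?_⟩
    rw [← hgs.range_eq]
    exact isCompact_range hg.contMDiff.continuous
  have hconn : ConnectedSpace (Metric.sphere (0 : EuclideanSpace ℝ (Fin 3)) 1) :=
    isConnected_iff_connectedSpace.1 (isConnected_sphere
      (Module.lt_rank_of_lt_finrank (by simp)) 0 zero_le_one)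
  obtain ⟨F, hFc, hlift⟩ := hq.exists_lift_sphere
    (hf.contMDiff.continuous.comp hg.contMDiff.continuous)
  -- The antipodal map lifts to some γ ∈ Γ; γ² fixes a point, so γ² = 1 and then γ = 1.
  have hneg : ∀ x, F (-x) = F x := by
    obtain ⟨γ, hγ, e⟩ := hq.exists_deck hFc (hFc.comp continuous_neg) fun x => by
      rw [Function.comp_apply, hlift, hlift, Function.comp_apply, Function.comp_apply,
        (hfib x (-x)).2 (Or.inr rfl)]
    have e : ∀ x, F (-x) = γ (F x) := e
    obtain ⟨x₀⟩ : Nonempty (Metric.sphere (0 : EuclideanSpace ℝ (Fin 3)) 1) := inferInstance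
    have h1 : γ = 1 := hq.eq_one_of_mul_self hγ (hq.free _ (mul_mem hγ hγ) (F x₀) (by
      rw [Homeomorph.mul_apply, ← e, ← e, neg_neg]))
    intro x
    rw [e, h1]
    rfl
  have hF : IsSurfaceLift Γ q ⊥ g f F :=
    { le := bot_le
      diffeo := hg
      surjective := hgs
      embedding := hf
      continuous := hFc
      lift := hlift
      fiber := fun s s' h => by
        refine ⟨1, one_mem _, ?_⟩
        rcases (hfib s s').1 h with rfl | rfl
        · rfl
        · exact hneg s
      invariant := fun h hh s => ⟨s, rfl, by rw [Subgroup.mem_bot.1 hh]; rfl⟩ }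
  obtain ⟨P, hP⟩ := hF.exists_isSide hq
  obtain ⟨ν, hνc, hν⟩ := hP.exists_conormal
  have hνF : Continuous fun x => ν (F x) := hνc.comp_continuous hFc fun x => mem_range_self x
  have hν0 : ∀ x, ν (F x) ≠ 0 := fun x => (hν _ (mem_range_self x)).ne_zero
  let n : Metric.sphere (0 : EuclideanSpace ℝ (Fin 3)) 1 → Sol := fun x => solNormal (F x) (ν (F x))
  have hn : Continuous n := continuous_solNormal hFc hνF hν0
  have hsm : ∀ x : Metric.sphere (0 : EuclideanSpace ℝ (Fin 3)) 1,
      ContDiffAt ℝ ∞ (F ∘ radialProj) (x : EuclideanSpace ℝ (Fin 3)) := fun x =>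
    contDiffAt_comp_radialProj (hF.contMDiff hq) (ne_zero_of_mem_unit_sphere x)
  have hdiff : ∀ x : Metric.sphere (0 : EuclideanSpace ℝ (Fin 3)) 1,
      DifferentiableAt ℝ (F ∘ radialProj) (x : EuclideanSpace ℝ (Fin 3)) := fun x =>
    (hsm x).differentiableAt (by simp)
  -- Tangent vectors go to their images under dF and the radial vector x goes to n x. As F and n are
  -- even, T is odd.
  let T : Metric.sphere (0 : EuclideanSpace ℝ (Fin 3)) 1 → Sol →L[ℝ] Sol := fun x =>
    fderiv ℝ (F ∘ radialProj) (x : EuclideanSpace ℝ (Fin 3)) +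
      (innerSL ℝ (x : EuclideanSpace ℝ (Fin 3))).smulRight (n x)
  have hT : Continuous T := by
    refine Continuous.add ?_ ?_
    · refine continuous_iff_continuousAt.2 fun x => ?_
      have h1 : ContinuousAt (fderiv ℝ (F ∘ radialProj)) (x : EuclideanSpace ℝ (Fin 3)) :=
        ((hsm x).fderiv_right (m := 0) (by simp)).continuousAt
      exact h1.comp continuous_subtype_val.continuousAt
    · fun_prop
  have hodd : ∀ x, T (-x) = -T x := by
    intro x
    have h1 : (F ∘ radialProj) ∘ (fun y => -y) =ᶠ[𝓝 (x : EuclideanSpace ℝ (Fin 3))]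
        F ∘ radialProj := by
      filter_upwards [isOpen_ne.mem_nhds (ne_zero_of_mem_unit_sphere x)] with y hy
      simp only [Function.comp_apply]
      rw [radialProj_neg hy, hneg]
    have h2 := ((hdiff (-x)).hasFDerivAt.comp (x : EuclideanSpace ℝ (Fin 3))
      (hasFDerivAt_id (𝕜 := ℝ) (x : EuclideanSpace ℝ (Fin 3))).neg).fderiv
    have h3 : fderiv ℝ ((F ∘ radialProj) ∘ (fun y => -y)) (x : EuclideanSpace ℝ (Fin 3)) = _ := h2
    rw [h1.fderiv_eq] at h3
    ext v : 1
    have h4 : fderiv ℝ (F ∘ radialProj) (x : EuclideanSpace ℝ (Fin 3)) v =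
        -fderiv ℝ (F ∘ radialProj) ((-x : Metric.sphere (0 : EuclideanSpace ℝ (Fin 3)) 1) :
          EuclideanSpace ℝ (Fin 3)) v := by
      rw [h3]
      simp
    have h5 : n (-x) = n x := by simp only [n, hneg]
    simp only [T, h5, add_apply, neg_apply, ContinuousLinearMap.smulRight_apply, h4]
    simp
    abel
  obtain ⟨x, hx⟩ := exists_det_eq_zero_of_odd hT hodd
  obtain ⟨w, hw, hw0⟩ := (Submodule.ne_bot_iff _).1 (LinearMap.bot_lt_ker_of_det_eq_zero hx).ne'
  have hw : fderiv ℝ (F ∘ radialProj) (x : EuclideanSpace ℝ (Fin 3)) w +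
    inner ℝ (x : EuclideanSpace ℝ (Fin 3)) w • n x = 0 := hw
  -- The tangential part of the kernel vector. Applying the conormal kills the radial part, and
  -- injectivity of dF then kills this one.
  set w' : EuclideanSpace ℝ (Fin 3) := w - inner ℝ (x : EuclideanSpace ℝ (Fin 3)) w • x with hw'
  have hmem : w' ∈ (ℝ ∙ (x : EuclideanSpace ℝ (Fin 3)))ᗮ := by
    rw [Submodule.mem_orthogonal_singleton_iff_inner_right, hw', inner_sub_right, inner_smul_right,
      real_inner_self_eq_norm_sq, norm_eq_of_mem_sphere]
    ring
  rw [← range_mvfderiv_subtypeVal (n := 2) x] at hmem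
  obtain ⟨u, hu⟩ := hmem
  have hcoe : (F ∘ radialProj) ∘ ((↑) : Metric.sphere (0 : EuclideanSpace ℝ (Fin 3)) 1 → _) = F :=
    funext fun x => congrArg F (radialProj_coe x)
  have hchain := mfderiv_comp x (I'' := 𝓡 3) (hdiff x).mdifferentiableAt
    ((contMDiff_coe_sphere (m := 1) (n := 2) x).mdifferentiableAt one_ne_zero)
  rw [hcoe, mfderiv_eq_fderiv] at hchain
  have hFu : mfderiv (𝓡 2) (𝓡 3) F x u =
      fderiv ℝ (F ∘ radialProj) (x : EuclideanSpace ℝ (Fin 3)) w' := by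
    rw [← hu]
    exact congrArg (fun A : EuclideanSpace ℝ (Fin 2) →L[ℝ] Sol => A u) hchain
  have hww' : fderiv ℝ (F ∘ radialProj) (x : EuclideanSpace ℝ (Fin 3)) w' =
      fderiv ℝ (F ∘ radialProj) (x : EuclideanSpace ℝ (Fin 3)) w := by
    rw [hw', map_sub, map_smul, fderiv_comp_radialProj_self (hdiff x), smul_zero, sub_zero]
  have hν1 : ν (F x) (fderiv ℝ (F ∘ radialProj) (x : EuclideanSpace ℝ (Fin 3)) w) = 0 := by
    rw [← hww', ← hFu]
    exact hF.conormal_mfderiv hq hP (hν _ (mem_range_self x)) u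
  have hin : inner ℝ (x : EuclideanSpace ℝ (Fin 3)) w = 0 := by
    have h1 := congrArg (ν (F x)) hw
    rw [map_add, hν1, zero_add, map_smul, map_zero, smul_eq_mul] at h1
    exact (mul_eq_zero.1 h1).resolve_right (apply_solNormal_pos (hν0 x)).ne'
  rw [hin, zero_smul, add_zero] at hw
  have hu0 : u = 0 := hF.mfderiv_injective hq x (by
    rw [map_zero]
    exact (hFu.trans hww').trans hw)
  apply hw0
  rw [hin, zero_smul, sub_zero] at hw'
  rw [← hw', ← hu, hu0, map_zero]

end ProjectivePlane

/-! ### Conclusion -/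

theorem IsSolManifold.exists_isSolQuotient {L : Type*} [TopologicalSpace L]
    [ChartedSpace (EuclideanSpace ℝ (Fin 3)) L] (hL : IsSolManifold L) :
    ∃ Γ q, IsSolQuotient (L := L) Γ q := by
  obtain ⟨Γ, hΓ, -, hfree, q, hq, hqs, hfib⟩ := hL
  exact ⟨Γ, q, hΓ, hfree, hq, hqs, hfib⟩

end

theorem mainTheorem8 (L : Type*) [TopologicalSpace L] [T2Space L] [CompactSpace L]
    [ChartedSpace (EuclideanSpace ℝ (Fin 3)) L] [IsManifold (𝓡 3) ∞ L]
    (hL : IsSolManifold L) :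
    (¬ ∃ (S : Type*) (_ : TopologicalSpace S) (_ : ChartedSpace (EuclideanSpace ℝ (Fin 2)) S)
        (_ : IsManifold (𝓡 2) ∞ S) (f : S → L),
        IsProjectivePlane S ∧ IsSmoothEmbedding (𝓡 2) (𝓡 3) ∞ f) ∧
    (¬ ∃ (S : Type*) (_ : TopologicalSpace S) (_ : ChartedSpace (EuclideanSpace ℝ (Fin 2)) S)
        (_ : IsManifold (𝓡 2) ∞ S) (f : S → L),
        IsTwoTorus S ∧ IsSmoothEmbedding (𝓡 2) (𝓡 3) ∞ f ∧ ¬ IsTwoSided f) ∧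
    (¬ ∃ (S : Type*) (_ : TopologicalSpace S) (_ : ChartedSpace (EuclideanSpace ℝ (Fin 2)) S)
        (_ : IsManifold (𝓡 2) ∞ S) (f : S → L),
        IsKleinBottle S ∧ IsSmoothEmbedding (𝓡 2) (𝓡 3) ∞ f ∧ ¬ IsTwoSided f ∧
          HasNonorientableNeighborhood f) := by
  obtain ⟨Γ, q, hq⟩ := hL.exists_isSolQuotient
  refine ⟨?_, ?_, ?_⟩
  · rintro ⟨S, _, _, _, f, hS, hf⟩
    exact hq.not_isProjectivePlane hS hf
  · rintro ⟨S, _, _, _, f, hS, hf, h⟩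
    exact h (hq.isTwoSided_of_torus hS hf)
  · rintro ⟨S, _, _, _, f, hS, hf, h, hn⟩
    exact h (hq.isTwoSided_of_klein hS hf hn)
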